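/- Let $g\ge 1$, let $D=\mathrm{diag}(d_1,\dots,d_g)$ be a polarization type (positive integers with $d_1\mid d_2\mid\cdots\mid d_g$), and let $a,b\in\mathbb R^g$. Let $\mathcal H_g$ be the Siegel upper half space of symmetric $\tau\in M_g(\mathbb C)$ with $\operatorname{Im}\tau$ positive definite. For $(z,\tau)\in\mathbb C^g\times\mathcal H_g$ put $$\vartheta(z,\tau)=\sum_{n\in\mathbb Z^g}\exp\bigl(\pi i({}^tn\tau n+2\,{}^tnz)\bigr),\qquad \vartheta\begin{bmatrix}a\\ b\end{bmatrix}(z,\tau)=\exp\bigl(\pi i({}^ta\tau a+2\,{}^ta(z+b))\bigr)\,\vartheta(z+\tau a+b,\tau).$$ A real symmetric $g\times g$ matrix $\beta$ is Minkowski reduced if $\beta_{1,1}>0$; ${}^tn\beta n\ge\beta_{k,k}$ for all $1\le k\le g$ and all $n\in\mathbb Z^g$ with $\gcd(n_k,\dots,n_g)=1$; and $\beta_{k,k+1}\ge0$ for $1\le k\le g-1$. The Siegel fundamental set $\mathfrak F_g\subseteq\mathcal H_g$ is the set of symmetric $\tau\in M_g(\mathbb C)$ such that $\operatorname{Im}\tau$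 is Minkowski reduced, $|\operatorname{Re}\tau_{i,j}|\le\frac12$ for all $i,j$, and $\det\operatorname{Im}(\sigma\cdot\tau)\le\det\operatorname{Im}\tau$ for all $\sigma\in Sp(2g,\mathbb Z)$, where $\begin{pmatrix}\alpha&\beta\\ \gamma&\delta\end{pmatrix}\cdot\tau=(\alpha\tau+\beta)(\gamma\tau+\delta)^{-1}$. For $\tau\in\mathcal H_g$ let $$E^D_\tau=\{\tau r+Ds: r,s\in[0,1)^g\},\qquad \bar E^D_\tau=\{\tau r+Ds: r,s\in[0,1]^g\}$$ be the fundamental parallelogram of the lattice $\tau\mathbb Z^g+D\mathbb Z^g$ and its closure. Let $\mathbb R_{an,exp}$ be the expansion of the real field by the real exponential function and by all restrictions of real analytic functions to compact boxes in $\mathbb R^n$, $n\ge 0$; definability is with real parameters, after identifying $\mathbb C$ with $\mathbb R^2$ and the space of symmetric complex $g\times g$ matrices with $\mathbb C^{g(g+1)/2}$. A function is definable if its graph is. Then: 1. The restriction of $\vartheta\begin{bmatrix}a\\ b\end{bmatrix}$ to $\{(z,\tau)\in\mathbb C^g\times\mathcal H_g:\tau\in\mathfrak F_g,\ z\in E^D_\tau\}$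 is definable in $\mathbb R_{an,exp}$, and so is its restriction to $\{(z,\tau)\in\mathbb C^g\times\mathcal H_g:\tau\in\mathfrak F_g,\ z\in\bar E^D_\tau\}$. 2. For every real $K>0$ there is an open set $U\subseteq\mathbb C^g\times\mathcal H_g$ containing $\{(z,\tau)\in\mathbb C^g\times\mathcal H_g:\tau\in\mathfrak F_g,\ z=\tau r+Ds\text{ for some } r,s\in(-K,K)^g\}$ such that the restriction of $\vartheta\begin{bmatrix}a\\ b\end{bmatrix}$ to $U$ is definable in $\mathbb R_{an,exp}$. 3. There is an open set $U\subseteq\mathbb C^g\times\mathcal H_g$ containing $\{(z,\tau)\in\mathbb C^g\times\mathcal H_g:\tau\in\mathfrak F_g,\ z\in\bar E^D_\tau\}$ such that the restriction of $\vartheta\begin{bmatrix}a\\ b\end{bmatrix}$ to $U$ is definable in $\mathbb R_{an,exp}$. -/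

import Mathlib

namespace SiegelTheta

noncomputable section

open Matrix

/-! ### The structure `ℝ_{an,exp}` -/

/-- Function symbols: the ring operations, the exponential function, and one symbol for every
function that is real analytic (in a neighbourhood of every point of) a compact box
`[l, u] ⊆ ℝⁿ`. -/
inductive AnExpFunc : ℕ → Type
  | zero : AnExpFunc 0
  | one : AnExpFunc 0
  | neg : AnExpFunc 1
  | add : AnExpFunc 2
  | mul : AnExpFunc 2
  | exp : AnExpFunc 1
  | restricted {n : ℕ} (f : (Fin n → ℝ) → ℝ) (l u : Fin n → ℝ)
      (hf : AnalyticOnNhd ℝ f (Set.Icc l u)) : AnExpFunc n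

/-- The language of `ℝ_{an,exp}` (the order is definable from the field operations). -/
def anExp : FirstOrder.Language := ⟨AnExpFunc, fun _ => Empty⟩

open Classical in
/-- The interpretation of the function symbols; a restricted analytic function is extended by `0`
outside its box. -/
def AnExpFunc.interp : {n : ℕ} → AnExpFunc n → (Fin n → ℝ) → ℝ
  | _, .zero, _ => 0
  | _, .one, _ => 1
  | _, .neg, x => - x 0
  | _, .add, x => x 0 + x 1
  | _, .mul, x => x 0 * x 1
  | _, .exp, x => Real.exp (x 0)
  | _, .restricted f l u _, x => if x ∈ Set.Icc l u then f x else 0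

/-- The structure `ℝ_{an,exp}`. -/
instance anExpStructure : anExp.Structure ℝ where
  funMap := fun {_} f x => AnExpFunc.interp f x
  RelMap := fun {_} r _ => Empty.elim r

/-! ### The Siegel upper half space and the symplectic action -/

/-- The entrywise imaginary part of a complex matrix. -/
def imPart {g : ℕ} (τ : Matrix (Fin g) (Fin g) ℂ) : Matrix (Fin g) (Fin g) ℝ :=
  τ.map Complex.im

/-- The Siegel upper half space of degree `g`. -/
def siegelHalfSpace (g : ℕ) : Set (Matrix (Fin g) (Fin g) ℂ) :=
  {τ | τ.IsSymm ∧ (imPart τ).PosDef}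

/-- `M · τ = (α τ + β) (γ τ + δ)⁻¹` for `M = (α β; γ δ)`. -/
def siegelAction {g : ℕ} (M : Matrix (Fin g ⊕ Fin g) (Fin g ⊕ Fin g) ℤ)
    (τ : Matrix (Fin g) (Fin g) ℂ) : Matrix (Fin g) (Fin g) ℂ :=
  (M.toBlocks₁₁.map (Int.cast : ℤ → ℂ) * τ + M.toBlocks₁₂.map (Int.cast : ℤ → ℂ)) *
    (M.toBlocks₂₁.map (Int.cast : ℤ → ℂ) * τ + M.toBlocks₂₂.map (Int.cast : ℤ → ℂ))⁻¹

/-- Minkowski reduced real symmetric matrices (rows and columns are numbered from `0`). -/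
structure IsMinkowskiReduced {g : ℕ} (β : Matrix (Fin g) (Fin g) ℝ) : Prop where
  symm : β.IsSymm
  pos : ∀ i : Fin g, (i : ℕ) = 0 → 0 < β i i
  le : ∀ (k : Fin g) (a : Fin g → ℤ), (Finset.Ici k).gcd a = 1 →
    β k k ≤ (fun i => (a i : ℝ)) ⬝ᵥ (β *ᵥ fun i => (a i : ℝ))
  nonneg : ∀ k l : Fin g, (l : ℕ) = k + 1 → 0 ≤ β k l

/-- The Siegel fundamental set `𝔉_g` for the action of `Sp(2g, ℤ)`. -/
def siegelFundamentalSet (g : ℕ) : Set (Matrix (Fin g) (Fin g) ℂ) :=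
  {τ | τ.IsSymm ∧ IsMinkowskiReduced (imPart τ) ∧ (∀ i j, |(τ i j).re| ≤ 1 / 2) ∧
    ∀ σ ∈ Matrix.symplecticGroup (Fin g) ℤ,
      (imPart (siegelAction σ τ)).det ≤ (imPart τ).det}

/-! ### Polarization types and fundamental parallelograms -/

/-- `diag(d_1, …, d_g)` with positive integers `d_1 ∣ d_2 ∣ ⋯ ∣ d_g`. -/
def IsPolarizationType {g : ℕ} (d : Fin g → ℕ) : Prop :=
  (∀ i, 0 < d i) ∧ ∀ i j, i ≤ j → d i ∣ d j

/-- The point `τ r + D s` of `ℂ^g`, for `r, s ∈ ℝ^g` and `D = diag(d)`. -/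
def latticeCombination {g : ℕ} (d : Fin g → ℕ) (τ : Matrix (Fin g) (Fin g) ℂ)
    (r s : Fin g → ℝ) : Fin g → ℂ :=
  τ *ᵥ (fun i => (r i : ℂ)) + Matrix.diagonal (fun i => (d i : ℂ)) *ᵥ (fun i => (s i : ℂ))

/-- The (half-open) fundamental parallelogram of the lattice `τ ℤ^g + D ℤ^g`. -/
def parallelogram {g : ℕ} (d : Fin g → ℕ) (τ : Matrix (Fin g) (Fin g) ℂ) : Set (Fin g → ℂ) :=
  {z | ∃ r s : Fin g → ℝ, (∀ i, 0 ≤ r i ∧ r i < 1) ∧ (∀ i, 0 ≤ s i ∧ s i < 1) ∧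
    z = latticeCombination d τ r s}

/-- The closed fundamental parallelogram of the lattice `τ ℤ^g + D ℤ^g`. -/
def closedParallelogram {g : ℕ} (d : Fin g → ℕ) (τ : Matrix (Fin g) (Fin g) ℂ) :
    Set (Fin g → ℂ) :=
  {z | ∃ r s : Fin g → ℝ, (∀ i, 0 ≤ r i ∧ r i ≤ 1) ∧ (∀ i, 0 ≤ s i ∧ s i ≤ 1) ∧
    z = latticeCombination d τ r s}

/-- The points `τ r + D s` with `r`, `s` of sup norm less than `K`. -/
def wideParallelogram {g : ℕ} (d : Fin g → ℕ) (K : ℝ) (τ : Matrix (Fin g) (Fin g) ℂ) :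
    Set (Fin g → ℂ) :=
  {z | ∃ r s : Fin g → ℝ, (∀ i, |r i| < K) ∧ (∀ i, |s i| < K) ∧
    z = latticeCombination d τ r s}

/-- For a family `P τ` of subsets of `ℂ^g`, the set of all `(z, τ) ∈ ℂ^g × ℍ_g` with
`τ ∈ 𝔉_g` and `z ∈ P τ`. -/
def overFundamentalSet {g : ℕ} (P : Matrix (Fin g) (Fin g) ℂ → Set (Fin g → ℂ)) :
    Set ((Fin g → ℂ) × siegelHalfSpace g) :=
  {p | (p.2 : Matrix (Fin g) (Fin g) ℂ) ∈ siegelFundamentalSet g ∧ p.1 ∈ P p.2}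

/-! ### Theta functions -/

/-- `ϑ(z, τ) = ∑_{n ∈ ℤ^g} exp(π i (ᵗn τ n + 2 ᵗn z))`. -/
def riemannTheta {g : ℕ} (z : Fin g → ℂ) (τ : Matrix (Fin g) (Fin g) ℂ) : ℂ :=
  ∑' n : Fin g → ℤ, Complex.exp (Real.pi * Complex.I *
    ((fun i => (n i : ℂ)) ⬝ᵥ (τ *ᵥ fun i => (n i : ℂ)) + 2 * ((fun i => (n i : ℂ)) ⬝ᵥ z)))

/-- The theta function with characteristics `a, b ∈ ℝ^g`, on `ℂ^g × ℍ_g`. -/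
def thetaChar {g : ℕ} (a b : Fin g → ℝ) (p : (Fin g → ℂ) × siegelHalfSpace g) : ℂ :=
  let τ : Matrix (Fin g) (Fin g) ℂ := p.2
  let a' : Fin g → ℂ := fun i => (a i : ℂ)
  let b' : Fin g → ℂ := fun i => (b i : ℂ)
  Complex.exp (Real.pi * Complex.I * (a' ⬝ᵥ (τ *ᵥ a') + 2 * (a' ⬝ᵥ (p.1 + b')))) *
    riemannTheta (p.1 + τ *ᵥ a' + b') τ

/-! ### Definability of functions on subsets of `ℂ^g × ℍ_g` -/

/-- The complex coordinates on `ℂ^g × Sym(g, ℂ) = ℂ^g × ℂ^{g(g+1)/2}`: the entries of the vector,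
and the entries of the symmetric matrix on and above the diagonal. -/
def coords {g : ℕ} (p : (Fin g → ℂ) × siegelHalfSpace g) :
    Fin g ⊕ {ij : Fin g × Fin g // ij.1 ≤ ij.2} → ℂ :=
  Sum.elim p.1 (fun ij => (p.2 : Matrix (Fin g) (Fin g) ℂ) ij.1.1 ij.1.2)

/-- The identification of `ℂ^ι` with `ℝ^ι × ℝ^ι` by real and imaginary parts. -/
def realCoords {ι : Type} (w : ι → ℂ) : ι ⊕ ι → ℝ :=
  Sum.elim (fun i => (w i).re) (fun i => (w i).im)

/-- The restriction of `f` to `S ⊆ ℂ^g × ℍ_g` is definable in `ℝ_{an,exp}` (with real parameters):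
its graph is a definable set, in real coordinates. -/
def DefinableOn {g : ℕ} (f : (Fin g → ℂ) × siegelHalfSpace g → ℂ)
    (S : Set ((Fin g → ℂ) × siegelHalfSpace g)) : Prop :=
  (Set.univ : Set ℝ).Definable anExp
    ((fun p => realCoords (Sum.elim (coords p) (fun _ : Unit => f p))) '' S)

end

end SiegelTheta

/-! The plan is to write theta, on a region containing the relevant points, as elementary definable
factors times one function that is analytic near a compact box. The difficulty is that `Im τ` is
unbounded on the Siegel set, so compactness alone does not apply.

Put `Y = Im τ` and suppose that `|Im z_i| ≤ K Y_ii`. A Minkowski reduced positive definite `Y` is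
`Balanced`: as a quadratic form it is comparable to its diagonal
(`exists_balanced_of_isMinkowskiReduced`). For suitable constants `c₁` and `l`, the polynomial `ᵗn
(Y - c₁) n + 2 ᵗn Im z + l (1 + tr Y)` is then a quadratic form in `(n, 1)` whose matrix is again
balanced, with constants independent of `z` and `τ` (`exists_balanced_extendMatrix`). The central
fact is `exists_cone`: all balanced matrices with given constants are combinations `∑ t_v v ᵗv` with
`t_v ≥ 0` and `v` in one finite set `T` of integral vectors. With `q_v = exp(-π t_v) ∈ (0, 1]` and
`a = (n, 1)`, theta becomes `exp(π l (1 + tr Y))` times a sum over `n` of `exp(-π c₁ |n|²) ∏ q_v ^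
(v·a)²` times a phase in the real parts. The Gaussian factor gives convergence for `|q_v|` slightly
above `1`, so the sum is analytic near the box containing the `q_v` and the bounded real parts
(`analyticOnNhd_thetaSeries`). The `t_v` need not be unique or depend analytically on the point:
every admissible choice gives the same value, so an existential quantifier over `t` defines the
graph.

The same cone shows that the fundamental set is definable inside the region, that is, that finitely
many of its inequalities suffice. A value at an integral vector is `∑ t_v (a·v)²`. The number
`|det(γτ + δ)|²` is `det Y` times a Gram determinant of the rows `(δ, γ)`, hence by Cauchy–Binet a
nonnegative combination of squares of integral determinants. Dickson's lemma selects finitely many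
vectors and symplectic matrices whose integral data lie below those of all others
(`exists_finset_minkowski`, `exists_finset_symplectic`).

The open sets are the sets cut out by `InRegion`, a strict form of these bounds, on which the
formula for theta remains valid. -/

namespace SiegelTheta

open Matrix

/-! ### Balanced matrices and a common finitely generated cone of integral squares -/

/-- The quadratic form of a real square matrix. -/
def quadForm {ι : Type*} [Fintype ι] (β : Matrix ι ι ℝ) (v : ι → ℝ) : ℝ := v ⬝ᵥ (β *ᵥ v)

lemma quadForm_eq_sum {ι : Type*} [Fintype ι] (β : Matrix ι ι ℝ) (v : ι → ℝ) :
    quadForm β v = ∑ i, ∑ j, β i j * (v i * v j) := by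
  simp only [quadForm, dotProduct, mulVec, Finset.mul_sum]
  exact Finset.sum_congr rfl fun i _ => Finset.sum_congr rfl fun j _ => by ring

/-- Symmetric matrices with positive diagonal which are, up to constants, dominated from above
entrywise and from below as quadratic forms by their diagonal. -/
structure Balanced {ι : Type*} [Fintype ι] (c C : ℝ) (β : Matrix ι ι ℝ) : Prop where
  symm : ∀ i j, β i j = β j i
  pos : ∀ i, 0 < β i i
  abs_entry_le : ∀ i j, |β i j| ≤ C * β i i
  le_quadForm : ∀ v, c * ∑ i, β i i * v i ^ 2 ≤ quadForm β v

/-- `β` is a nonnegative combination of the squares of the linear forms in `T`. -/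
def InCone {ι : Type*} (T : Finset (ι → ℤ)) (β : Matrix ι ι ℝ) : Prop :=
  ∃ t : (ι → ℤ) → ℝ, (∀ v, 0 ≤ t v) ∧ ∀ i j, β i j = ∑ v ∈ T, t v * ((v i : ℝ) * v j)

lemma InCone.zero {ι : Type*} (T : Finset (ι → ℤ)) : InCone T (0 : Matrix ι ι ℝ) :=
  ⟨0, fun _ => le_rfl, fun i j => by simp⟩

lemma InCone.add {ι : Type*} {T : Finset (ι → ℤ)} {β β' : Matrix ι ι ℝ} (h : InCone T β)
    (h' : InCone T β') : InCone T (β + β') := by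
  obtain ⟨t, ht, hβ⟩ := h
  obtain ⟨t', ht', hβ'⟩ := h'
  refine ⟨t + t', fun v => add_nonneg (ht v) (ht' v), fun i j => ?_⟩
  simp [hβ, hβ', add_mul, Finset.sum_add_distrib]

lemma InCone.sum {ι κ : Type*} {T : Finset (ι → ℤ)} {s : Finset κ} {β : κ → Matrix ι ι ℝ}
    (h : ∀ k ∈ s, InCone T (β k)) : InCone T (∑ k ∈ s, β k) := by
  classical
  induction s using Finset.induction_on with
  | empty => simpa using InCone.zero T
  | insert a s ha ih =>
    rw [Finset.sum_insert ha]
    exact (h a (Finset.mem_insert_self a s)).add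
      (ih fun k hk => h k (Finset.mem_insert_of_mem hk))

lemma InCone.of_mem {ι : Type*} {T : Finset (ι → ℤ)} {v : ι → ℤ} (hv : v ∈ T) {s : ℝ}
    (hs : 0 ≤ s) : InCone T (Matrix.of fun i j => s * ((v i : ℝ) * v j)) := by
  classical
  refine ⟨Pi.single v s, fun w => ?_, fun i j => ?_⟩
  · by_cases h : w = v
    · subst h; simpa using hs
    · simp [h]
  · rw [Finset.sum_eq_single v]
    · simp
    · intro w _ hw; simp [hw]
    · exact fun h => absurd hv h

/-- The nonnegative combination of the squares of the `V0` and the `V0 + N e_j` with weights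
`1 - ∑ f_j / N` and `f_j / N` is the square of `V0 + f`, up to an error on the diagonal. -/
lemma square_decomposition {n : ℕ} (N : ℝ) (hN : N ≠ 0) (k f : Fin n → ℝ) (a b : Fin n) :
    (k a + f a) * (k b + f b) = (1 - ∑ j, f j / N) * (k a * k b) +
      ∑ j, f j / N * ((k a + if a = j then N else 0) * (k b + if b = j then N else 0)) +
      (f a * f b - if a = b then N * f a else 0) := by
  have h : ∀ j, f j / N * ((k a + if a = j then N else 0) * (k b + if b = j then N else 0)) =
      f j / N * (k a * k b) + (if b = j then k a * f j else 0) + (if a = j then k b * f j else 0)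
      + (if a = j then (if b = j then N * f j else 0) else 0) := by
    intro j
    split_ifs <;> (field_simp; ring)
  simp only [h, Finset.sum_add_distrib, Finset.sum_ite_eq, Finset.mem_univ, if_true,
    ← Finset.sum_mul]
  by_cases hab : a = b
  · subst hab; simp; ring
  · simp [hab, Ne.symm hab]; ring

/-- The companion of `square_decomposition` for entries in the pivot row. All the vectors share the
pivot coordinate `M`, so only their weighted mean matters and no error appears. -/
lemma square_decomposition_left {n : ℕ} (N M : ℝ) (hN : N ≠ 0) (k f : Fin n → ℝ) (b : Fin n) :
    M * (k b + f b) = (1 - ∑ j, f j / N) * (M * k b) +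
      ∑ j, f j / N * (M * (k b + if b = j then N else 0)) := by
  have h : ∀ j, f j / N * (M * (k b + if b = j then N else 0)) =
      f j / N * (M * k b) + (if b = j then M * f j else 0) := by
    intro j
    split_ifs
    · field_simp
    · simp
  simp only [h, Finset.sum_add_distrib, Finset.sum_ite_eq, Finset.mem_univ, if_true,
    ← Finset.sum_mul]
  ring

/-- The remainder of a balanced matrix after splitting off an approximation of the square of its
pivot row is balanced. -/
lemma Balanced.remainder {n : ℕ} {c C : ℝ} (hc : 0 < c) (hC : 0 < C)
    {β : Matrix (Fin (n + 1)) (Fin (n + 1)) ℝ} (hβ : Balanced c C β) (p : Fin (n + 1))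
    (hp : ∀ j, β p p ≤ β j j) (M N : ℝ) (hM : 1 ≤ M) (hN : 1 ≤ N) (hMN : 2 * N ≤ c * M ^ 2)
    (f : Fin n → ℝ) (hf0 : ∀ j, 0 ≤ f j) (hf1 : ∀ j, f j ≤ 1) :
    Balanced (c / 4) (2 / c * (C + C ^ 2 + 1 + N))
      (Matrix.of fun j k : Fin n => β (p.succAbove j) (p.succAbove k) -
        β p (p.succAbove j) * β p (p.succAbove k) / β p p +
        β p p / M ^ 2 * (f j * f k - if j = k then N * f j else 0)) := by
  set h := β p p with hh
  have hpos : 0 < h := hβ.pos p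
  have hM2 : 1 ≤ M ^ 2 := one_le_pow₀ hM
  set β' : Matrix (Fin n) (Fin n) ℝ := Matrix.of fun j k : Fin n =>
    β (p.succAbove j) (p.succAbove k) - β p (p.succAbove j) * β p (p.succAbove k) / h +
        h / M ^ 2 * (f j * f k - if j = k then N * f j else 0) with hβ'
  -- Evaluating `β` with pivot coordinate `-s / h` produces the Schur complement, which inherits the
  -- lower bound `c`. In the correction the square of `∑ f j * v j` only helps, and the negative
  -- diagonal part costs at most half of the bound because `h ≤ β j j` and `2 * N ≤ c * M ^ 2`.
  have hq : ∀ v : Fin n → ℝ, c / 2 * ∑ j, β (p.succAbove j) (p.succAbove j) * v j ^ 2 ≤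
      quadForm β' v := by
    intro v
    set s : ℝ := ∑ j, β p (p.succAbove j) * v j with hs
    have h1 := hβ.le_quadForm (p.insertNth (-(s / h)) v)
    have e1 : quadForm β (p.insertNth (-(s / h)) v) =
        (∑ j, ∑ k, β (p.succAbove j) (p.succAbove k) * (v j * v k)) - s ^ 2 / h := by
      rw [quadForm_eq_sum, Fin.sum_univ_succAbove _ p]
      simp only [Fin.sum_univ_succAbove _ p, Fin.insertNth_apply_same,
        Fin.insertNth_apply_succAbove, Finset.sum_add_distrib]
      have e2 : ∑ j, β p (p.succAbove j) * (-(s / h) * v j) = -(s / h) * s := by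
        rw [hs, Finset.mul_sum]
        exact Finset.sum_congr rfl fun j _ => by ring
      have e3 : ∑ j, β (p.succAbove j) p * (v j * -(s / h)) = -(s / h) * s := by
        rw [← e2]
        exact Finset.sum_congr rfl fun j _ => by rw [hβ.symm (p.succAbove j) p]; ring
      rw [e2, e3, ← hh]
      field_simp
      ring
    have e4 : quadForm β' v = (∑ j, ∑ k, β (p.succAbove j) (p.succAbove k) * (v j * v k))
        - s ^ 2 / h + h / M ^ 2 * ((∑ j, f j * v j) ^ 2 - N * ∑ j, f j * v j ^ 2) := by
      rw [quadForm_eq_sum]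
      have e5 : ∀ j k, β' j k * (v j * v k) = β (p.succAbove j) (p.succAbove k) * (v j * v k)
          - (β p (p.succAbove j) * v j) * (β p (p.succAbove k) * v k) / h
          + h / M ^ 2 * ((f j * v j) * (f k * v k) - if j = k then N * (f j * v j ^ 2) else 0) := by
        intro j k
        simp only [hβ', Matrix.of_apply]
        by_cases hjk : j = k
        · subst hjk; simp; ring
        · simp [hjk]; ring
      simp only [e5, Finset.sum_add_distrib, Finset.sum_sub_distrib, ← Finset.sum_div,
        ← Finset.mul_sum, ← Finset.sum_mul, Finset.sum_ite_eq, Finset.mem_univ, if_true, ← hs]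
      ring
    have h2 : c * ∑ j, β (p.succAbove j) (p.succAbove j) * v j ^ 2 ≤
        quadForm β (p.insertNth (-(s / h)) v) := by
      refine le_trans (mul_le_mul_of_nonneg_left ?_ hc.le) h1
      rw [Fin.sum_univ_succAbove _ p]
      simp only [Fin.insertNth_apply_same, Fin.insertNth_apply_succAbove]
      have := mul_nonneg hpos.le (sq_nonneg (-(s / h)))
      linarith
    have h3 : h / M ^ 2 * (N * ∑ j, f j * v j ^ 2) ≤
        c / 2 * ∑ j, β (p.succAbove j) (p.succAbove j) * v j ^ 2 := by
      have a1 : h * ∑ j, f j * v j ^ 2 ≤ ∑ j, β (p.succAbove j) (p.succAbove j) * v j ^ 2 := by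
        rw [Finset.mul_sum]
        refine Finset.sum_le_sum fun j _ => ?_
        rw [← mul_assoc]
        refine mul_le_mul_of_nonneg_right ?_ (sq_nonneg _)
        have := hp (p.succAbove j)
        nlinarith [hf0 j, hf1 j]
      have a2 : N / M ^ 2 ≤ c / 2 := by
        rw [div_le_div_iff₀ (by positivity) (by norm_num)]
        linarith
      calc h / M ^ 2 * (N * ∑ j, f j * v j ^ 2) = N / M ^ 2 * (h * ∑ j, f j * v j ^ 2) := by ring
        _ ≤ c / 2 * ∑ j, β (p.succAbove j) (p.succAbove j) * v j ^ 2 :=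
          mul_le_mul a2 a1 (mul_nonneg hpos.le (Finset.sum_nonneg fun j _ =>
            mul_nonneg (hf0 j) (sq_nonneg _))) (by positivity)
    have h4 : 0 ≤ h / M ^ 2 * (∑ j, f j * v j) ^ 2 := by positivity
    rw [e4, mul_sub]
    rw [e1] at h2
    linarith
  have hdiag : ∀ j, c / 2 * β (p.succAbove j) (p.succAbove j) ≤ β' j j := by
    intro j
    have := hq (Pi.single j 1)
    have e1 : quadForm β' (Pi.single j 1) = β' j j := by
      simp [quadForm]
    rw [e1] at this
    have e2 : ∑ i, β (p.succAbove i) (p.succAbove i) * (Pi.single j 1 : Fin n → ℝ) i ^ 2 =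
        β (p.succAbove j) (p.succAbove j) := by
      rw [Finset.sum_eq_single j]
      · simp
      · intro b _ hb; simp [hb]
      · simp
    rwa [e2] at this
  -- Both corrections on the diagonal are nonpositive, so the factor `2` is slack; it is what turns
  -- `c / 2` in `hq` into the final `c / 4`.
  have hle : ∀ j, β' j j ≤ 2 * β (p.succAbove j) (p.succAbove j) := by
    intro j
    simp only [hβ', Matrix.of_apply, if_true]
    have a1 : 0 ≤ β p (p.succAbove j) * β p (p.succAbove j) / h :=
      div_nonneg (mul_self_nonneg _) hpos.le
    have a2 : h / M ^ 2 * (f j * f j - N * f j) ≤ 0 := by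
      refine mul_nonpos_of_nonneg_of_nonpos (by positivity) ?_
      nlinarith [hf0 j, hf1 j]
    have := hβ.pos (p.succAbove j)
    linarith
  refine ⟨fun i j => ?_, fun i => ?_, fun i j => ?_, fun v => ?_⟩
  · simp only [hβ', Matrix.of_apply, hβ.symm (p.succAbove i) (p.succAbove j), eq_comm (a := i)]
    by_cases hij : j = i
    · subst hij; simp
    · simp [hij]; ring
  · have := hdiag i
    have := hβ.pos (p.succAbove i)
    have : 0 < c / 2 * β (p.succAbove i) (p.succAbove i) := by positivity
    linarith
  · have b0 := hβ.pos (p.succAbove i)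
    have a1 := hβ.abs_entry_le (p.succAbove i) (p.succAbove j)
    have a2 : |β p (p.succAbove i) * β p (p.succAbove j) / h| ≤
        C ^ 2 * β (p.succAbove i) (p.succAbove i) := by
      rw [abs_div, abs_mul, abs_of_pos hpos, div_le_iff₀ hpos]
      have x1 := hβ.abs_entry_le p (p.succAbove i)
      have x2 := hβ.abs_entry_le p (p.succAbove j)
      calc _ ≤ (C * h) * (C * h) := mul_le_mul x1 x2 (abs_nonneg _) (by positivity)
        _ = C ^ 2 * h * h := by ring
        _ ≤ _ := by
          have := hp (p.succAbove i)
          gcongr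
    have a3 : |h / M ^ 2 * (f i * f j - if i = j then N * f i else 0)| ≤
        (1 + N) * β (p.succAbove i) (p.succAbove i) := by
      rw [abs_mul]
      have x1 : |h / M ^ 2| ≤ β (p.succAbove i) (p.succAbove i) := by
        rw [abs_of_pos (by positivity)]
        exact (div_le_self hpos.le hM2).trans (hp _)
      have x2 : |f i * f j - if i = j then N * f i else 0| ≤ 1 + N := by
        have y1 : f i * f j ≤ 1 := mul_le_one₀ (hf1 i) (hf0 j) (hf1 j)
        have y2 : 0 ≤ f i * f j := mul_nonneg (hf0 i) (hf0 j)
        have y3 : N * f i ≤ N := mul_le_of_le_one_right (by linarith) (hf1 i)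
        have y4 : 0 ≤ N * f i := mul_nonneg (by linarith) (hf0 i)
        rw [abs_le]
        split_ifs <;> constructor <;> linarith
      calc _ ≤ β (p.succAbove i) (p.succAbove i) * (1 + N) :=
            mul_le_mul x1 x2 (abs_nonneg _) b0.le
        _ = _ := by ring
    have a4 : |β' i j| ≤ (C + C ^ 2 + 1 + N) * β (p.succAbove i) (p.succAbove i) := by
      simp only [hβ', Matrix.of_apply]
      refine (abs_add_le _ _).trans ?_
      have := abs_sub (β (p.succAbove i) (p.succAbove j))
        (β p (p.succAbove i) * β p (p.succAbove j) / h)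
      linarith
    refine a4.trans ?_
    have a5 : β (p.succAbove i) (p.succAbove i) ≤ 2 / c * β' i i := by
      rw [div_mul_eq_mul_div, le_div_iff₀ hc]
      have := hdiag i
      linarith
    calc _ ≤ (C + C ^ 2 + 1 + N) * (2 / c * β' i i) := by gcongr
      _ = _ := by ring
  · refine le_trans ?_ (hq v)
    have : ∑ i, β' i i * v i ^ 2 ≤ 2 * ∑ j, β (p.succAbove j) (p.succAbove j) * v j ^ 2 := by
      rw [Finset.mul_sum]
      refine Finset.sum_le_sum fun j _ => ?_
      rw [← mul_assoc]
      exact mul_le_mul_of_nonneg_right (hle j) (sq_nonneg _)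
    nlinarith

/-- Padding each linear form by a zero at the pivot carries the cone found for the remainder back to
the full dimension. -/
lemma InCone.insertNth_zero {n : ℕ} {T : Finset (Fin n → ℤ)} {β : Matrix (Fin n) (Fin n) ℝ}
    (h : InCone T β) (p : Fin (n + 1)) (β' : Matrix (Fin (n + 1)) (Fin (n + 1)) ℝ)
    (hp : ∀ j, β' p j = 0) (hp' : ∀ j, β' j p = 0)
    (hβ' : ∀ j k, β' (p.succAbove j) (p.succAbove k) = β j k)
    (T' : Finset (Fin (n + 1) → ℤ)) (hT' : ∀ v ∈ T, p.insertNth (α := fun _ => ℤ) 0 v ∈ T') :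
    InCone T' β' := by
  obtain ⟨t, ht, hβ⟩ := h
  have : β' = ∑ v ∈ T, Matrix.of fun i j => t v *
      (((p.insertNth (α := fun _ => ℤ) 0 v i : ℤ) : ℝ) *
        ((p.insertNth (α := fun _ => ℤ) 0 v j : ℤ) : ℝ)) := by
    ext i j
    rw [Matrix.sum_apply]
    simp only [Matrix.of_apply]
    rcases Fin.eq_self_or_eq_succAbove p i with rfl | ⟨i, rfl⟩
    · simp [hp]
    · rcases Fin.eq_self_or_eq_succAbove p j with rfl | ⟨j, rfl⟩
      · simp [hp']
      · simp [hβ', hβ]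
  rw [this]
  exact InCone.sum fun v hv => InCone.of_mem (hT' v hv) (ht v)

/-- All balanced matrices with given constants lie in one cone generated by finitely many squares
of integral linear forms. -/
theorem exists_cone_fin (n : ℕ) : ∀ c C : ℝ, 0 < c → 0 < C → ∃ T : Finset (Fin n → ℤ),
    ∀ β : Matrix (Fin n) (Fin n) ℝ, Balanced c C β → InCone T β := by
  classical
  induction n with
  | zero => exact fun c C _ _ => ⟨∅, fun β _ => ⟨0, fun _ => le_rfl, fun i => i.elim0⟩⟩
  | succ n ih =>
    intro c C hc hC
    -- `N ≥ n` makes the weight `1 - ∑ f j / N` nonnegative, `M` meets the requirement `2 * N ≤ c *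
    -- M ^ 2` of `Balanced.remainder`, and `K` bounds the coordinates of all integral vectors used
    -- below. None of them depends on `β`, and the generating set allows for every possible pivot.
    set N : ℕ := n + 1 with hN
    obtain ⟨M, hM⟩ := exists_nat_ge (max 1 (2 * N / c))
    have hM1 : (1 : ℝ) ≤ M := (le_max_left _ _).trans hM
    have hMN : 2 * (N : ℝ) ≤ c * (M : ℝ) ^ 2 := by
      have h1 : 2 * (N : ℝ) / c ≤ M := (le_max_right _ _).trans hM
      rw [div_le_iff₀ hc] at h1
      nlinarith
    have hN1 : (1 : ℝ) ≤ N := by simp [hN]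
    have hN0 : (N : ℝ) ≠ 0 := by positivity
    obtain ⟨K, hK⟩ := exists_nat_ge (M * C + 1 + N)
    obtain ⟨T', hT'⟩ := ih (c / 4) (2 / c * (C + C ^ 2 + 1 + N)) (by positivity) (by positivity)
    set box : Finset (Fin n → ℤ) := Fintype.piFinset fun _ => Finset.Icc (-(K : ℤ)) K with hbox
    refine ⟨Finset.univ.biUnion fun p : Fin (n + 1) =>
      T'.image (fun v => p.insertNth (α := fun _ => ℤ) 0 v) ∪
        box.image (fun k => p.insertNth (α := fun _ => ℤ) (M : ℤ) k), fun β hβ => ?_⟩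
    obtain ⟨p, -, hp⟩ := Finset.exists_min_image (Finset.univ : Finset (Fin (n + 1)))
      (fun j => β j j) ⟨0, Finset.mem_univ _⟩
    replace hp : ∀ j, β p p ≤ β j j := fun j => hp j (Finset.mem_univ j)
    set h := β p p with hh
    have hpos : 0 < h := hβ.pos p
    set u : Fin n → ℝ := fun j => β p (p.succAbove j) / h with hu
    have huC : ∀ j, |u j| ≤ C := fun j => by
      rw [hu]; dsimp only
      rw [abs_div, abs_of_pos hpos, div_le_iff₀ hpos]
      exact hβ.abs_entry_le p _
    set k : Fin n → ℤ := fun j => ⌊M * u j⌋ with hk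
    set f : Fin n → ℝ := fun j => Int.fract (M * u j) with hf
    have hkf : ∀ j, (k j : ℝ) + f j = M * u j := fun j => Int.floor_add_fract _
    have hf0 : ∀ j, 0 ≤ f j := fun j => Int.fract_nonneg _
    have hf1 : ∀ j, f j ≤ 1 := fun j => (Int.fract_lt_one _).le
    have hMu : ∀ j, |M * u j| ≤ M * C := fun j => by
      rw [abs_mul, abs_of_nonneg (by positivity : (0 : ℝ) ≤ M)]
      exact mul_le_mul_of_nonneg_left (huC j) (by positivity)
    have hkbox : ∀ e : Fin n → ℤ, (∀ j, 0 ≤ e j ∧ e j ≤ N) → k + e ∈ box := by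
      intro e he
      rw [hbox, Fintype.mem_piFinset]
      intro j
      have h1 := abs_le.mp (hMu j)
      have h2 := hkf j
      have h3 := hf0 j
      have h4 := hf1 j
      have h5 : (0 : ℝ) ≤ e j := by exact_mod_cast (he j).1
      have h6 : (e j : ℝ) ≤ N := by exact_mod_cast (he j).2
      rw [Finset.mem_Icc]
      constructor
      · have : (-(K : ℝ)) ≤ (k j : ℝ) + e j := by linarith
        simp only [Pi.add_apply]
        exact_mod_cast this
      · have : (k j : ℝ) + e j ≤ K := by linarith
        simp only [Pi.add_apply]
        exact_mod_cast this
    set T : Finset (Fin (n + 1) → ℤ) := Finset.univ.biUnion fun p : Fin (n + 1) =>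
      T'.image (fun v => p.insertNth (α := fun _ => ℤ) 0 v) ∪
        box.image (fun k => p.insertNth (α := fun _ => ℤ) (M : ℤ) k) with hT
    have hmem : ∀ k' ∈ box, p.insertNth (α := fun _ => ℤ) (M : ℤ) k' ∈ T := fun k' hk' =>
      Finset.mem_biUnion.mpr ⟨p, Finset.mem_univ _, Finset.mem_union_right _
        (Finset.mem_image_of_mem _ hk')⟩
    have hmem' : ∀ v ∈ T', p.insertNth (α := fun _ => ℤ) 0 v ∈ T := fun v hv =>
      Finset.mem_biUnion.mpr ⟨p, Finset.mem_univ _, Finset.mem_union_left _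
        (Finset.mem_image_of_mem _ hv)⟩
    set V : Fin n → Fin (n + 1) → ℤ := fun j =>
      p.insertNth (α := fun _ => ℤ) (M : ℤ) (k + Pi.single j (N : ℤ)) with hV
    set V0 : Fin (n + 1) → ℤ := p.insertNth (α := fun _ => ℤ) (M : ℤ) k with hV0
    have hV0T : V0 ∈ T := hmem k (by simpa using hkbox 0 (fun j => by simp))
    have hVT : ∀ j, V j ∈ T := fun j => hmem _ (hkbox _ fun i => by
      by_cases hij : i = j
      · subst hij; simp
      · simp [hij])
    -- The weighted mean of `V0` and the `V j` is `M • (1, u)` (pivot coordinate first), so `A`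
    -- agrees with `β` on the whole pivot row and column. Elsewhere it differs from the rank-one
    -- matrix `h u ᵗu` only by the error of `square_decomposition`. Hence `β - A` lives off the
    -- pivot and is exactly the matrix of `Balanced.remainder`.
    set A : Matrix (Fin (n + 1)) (Fin (n + 1)) ℝ :=
      (Matrix.of fun a b => (h / M ^ 2 * (1 - ∑ j, f j / N)) * ((V0 a : ℝ) * V0 b)) +
      ∑ j, Matrix.of fun a b => (h / M ^ 2 * (f j / N)) * ((V j a : ℝ) * V j b) with hA
    have hAcone : InCone T A := by
      refine InCone.add (InCone.of_mem hV0T (mul_nonneg (by positivity) ?_))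
        (InCone.sum fun j _ => InCone.of_mem (hVT j)
          (mul_nonneg (by positivity) (div_nonneg (hf0 j) (by positivity))))
      rw [sub_nonneg, ← Finset.sum_div, div_le_one (by positivity)]
      calc ∑ j, f j ≤ ∑ _j : Fin n, (1 : ℝ) := Finset.sum_le_sum fun j _ => hf1 j
        _ ≤ N := by simp [hN]
    have hVa : ∀ j a, ((V j (p.succAbove a) : ℤ) : ℝ) = k a + if a = j then (N : ℝ) else 0 := by
      intro j a
      simp only [hV, Fin.insertNth_apply_succAbove, Pi.add_apply, Pi.single_apply]
      split_ifs <;> simp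
    have hMne : (M : ℝ) ≠ 0 := by positivity
    have hA0 : A p p = h := by
      simp only [hA, Matrix.add_apply, Matrix.sum_apply, Matrix.of_apply, hV, hV0,
        Fin.insertNth_apply_same, Int.cast_natCast, ← Finset.sum_mul, ← Finset.mul_sum]
      field_simp
      ring
    have hA1 : ∀ b, A p (p.succAbove b) = h * u b := by
      intro b
      have := square_decomposition_left (N : ℝ) M hN0 (fun j => (k j : ℝ)) f b
      rw [hkf] at this
      simp only [hA, Matrix.add_apply, Matrix.sum_apply, Matrix.of_apply, hVa]
      simp only [hV, hV0, Fin.insertNth_apply_same, Fin.insertNth_apply_succAbove,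
        Int.cast_natCast, mul_assoc, ← Finset.mul_sum]
      rw [← mul_add, ← this]
      field_simp
    have hA2 : ∀ a b, A (p.succAbove a) (p.succAbove b) = h * u a * u b -
        h / M ^ 2 * (f a * f b - if a = b then N * f a else 0) := by
      intro a b
      have := square_decomposition (N : ℝ) hN0 (fun j => (k j : ℝ)) f a b
      rw [hkf, hkf] at this
      simp only [hA, Matrix.add_apply, Matrix.sum_apply, Matrix.of_apply, hVa]
      simp only [hV0, Fin.insertNth_apply_succAbove, mul_assoc, ← Finset.mul_sum]
      rw [← mul_add, eq_sub_iff_add_eq.mpr this.symm]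
      field_simp
    have hAsymm : ∀ a b, A a b = A b a := by
      intro a b
      simp only [hA, Matrix.add_apply, Matrix.sum_apply, Matrix.of_apply]
      congr 1
      · ring
      · exact Finset.sum_congr rfl fun j _ => by ring
    have hrem := hT' _ (hβ.remainder hc hC p hp M N hM1 hN1 hMN f hf0 hf1)
    have hcone : InCone T (β - A) := by
      refine hrem.insertNth_zero p _ (fun j => ?_) (fun j => ?_) (fun a b => ?_) T hmem'
      · rcases Fin.eq_self_or_eq_succAbove p j with rfl | ⟨j, rfl⟩
        · rw [Matrix.sub_apply, hA0, sub_self]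
        · rw [Matrix.sub_apply, hA1, hu]
          field_simp
          ring
      · rw [Matrix.sub_apply, hβ.symm, hAsymm]
        rcases Fin.eq_self_or_eq_succAbove p j with rfl | ⟨j, rfl⟩
        · rw [hA0, sub_self]
        · rw [hA1, hu]
          field_simp
          ring
      · rw [Matrix.sub_apply, hA2, Matrix.of_apply, ← hh]
        simp only [hu]
        field_simp
        ring
    have := hAcone.add hcone
    rwa [add_sub_cancel] at this

lemma Balanced.submatrix {ι κ : Type*} [Fintype ι] [Fintype κ] {c C : ℝ} {β : Matrix ι ι ℝ}
    (hβ : Balanced c C β) (e : κ ≃ ι) : Balanced c C (β.submatrix e e) := by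
  refine ⟨fun i j => hβ.symm _ _, fun i => hβ.pos _, fun i j => hβ.abs_entry_le _ _, fun v => ?_⟩
  have := hβ.le_quadForm (v ∘ e.symm)
  rw [quadForm_eq_sum] at this ⊢
  simpa [← e.sum_comp] using this

/-- All balanced matrices with given constants lie in one cone generated by finitely many squares
of integral linear forms. -/
theorem exists_cone {ι : Type*} [Fintype ι] {c C : ℝ} (hc : 0 < c) (hC : 0 < C) :
    ∃ T : Finset (ι → ℤ), ∀ β : Matrix ι ι ℝ, Balanced c C β → InCone T β := by
  classical
  obtain ⟨T, hT⟩ := exists_cone_fin (Fintype.card ι) c C hc hC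
  set e : Fin (Fintype.card ι) ≃ ι := (Fintype.equivFin ι).symm
  refine ⟨T.image fun v => v ∘ e.symm, fun β hβ => ?_⟩
  obtain ⟨t, ht, h⟩ := hT _ (hβ.submatrix e)
  refine ⟨fun v => t (v ∘ e), fun v => ht _, fun i j => ?_⟩
  rw [Finset.sum_image fun v _ w _ hvw => ?_]
  · have := h (e.symm i) (e.symm j)
    simp only [Matrix.submatrix_apply, Equiv.apply_symm_apply] at this
    simp [this, Function.comp_assoc]
  · have := congrArg (fun w => w ∘ e) hvw
    simpa [Function.comp_assoc] using this

/-! ### Minkowski reduced matrices are balanced -/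

/-- Simultaneous Diophantine approximation, with a bound for the common denominator which does not
depend on the numbers to be approximated. -/
lemma exists_simultaneous_approx (n : ℕ) {ε : ℝ} (hε : 0 < ε) : ∃ Q : ℕ, ∀ v : Fin n → ℝ,
    ∃ q : ℕ, 1 ≤ q ∧ q ≤ Q ∧ ∃ m : Fin n → ℤ, ∀ j, |q * v j - m j| ≤ ε := by
  classical
  obtain ⟨M, hM⟩ := exists_nat_gt (1 / ε)
  have hMpos : (0 : ℝ) < M := lt_trans (by positivity) hM
  refine ⟨M ^ n, fun v => ?_⟩
  -- Dirichlet's pigeonhole: the fractional parts of `M ^ n + 1` multiples of `v` fall into `M ^ n`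
  -- cubes of side `1 / M`.
  set φ : ℕ → Fin n → ℤ := fun s j => ⌊M * Int.fract ((s : ℝ) * v j)⌋ with hφ
  have hcard : (Fintype.piFinset fun _ : Fin n => Finset.Ico (0 : ℤ) M).card <
      (Finset.range (M ^ n + 1)).card := by
    simp
  have hmaps : ∀ s ∈ Finset.range (M ^ n + 1),
      φ s ∈ Fintype.piFinset fun _ : Fin n => Finset.Ico (0 : ℤ) M := by
    intro s _
    rw [Fintype.mem_piFinset]
    intro j
    rw [Finset.mem_Ico]
    refine ⟨Int.floor_nonneg.mpr (mul_nonneg hMpos.le (Int.fract_nonneg _)), ?_⟩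
    rw [Int.floor_lt]
    have := Int.fract_lt_one ((s : ℝ) * v j)
    push_cast
    nlinarith
  obtain ⟨x, hx, y, hy, hxy, heq⟩ := Finset.exists_ne_map_eq_of_card_lt_of_maps_to hcard hmaps
  have key : ∀ x y : ℕ, x < y → y ∈ Finset.range (M ^ n + 1) → φ x = φ y →
      ∃ q : ℕ, 1 ≤ q ∧ q ≤ M ^ n ∧ ∃ m : Fin n → ℤ, ∀ j, |q * v j - m j| ≤ ε := by
    intro x y hlt hy heq
    rw [Finset.mem_range] at hy
    refine ⟨y - x, by omega, by omega, fun j => ⌊(y : ℝ) * v j⌋ - ⌊(x : ℝ) * v j⌋, fun j => ?_⟩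
    have h1 := Int.abs_sub_lt_one_of_floor_eq_floor (congrFun heq j)
    rw [← mul_sub, abs_mul, abs_of_pos hMpos] at h1
    have h2 : 1 < M * ε := by rwa [div_lt_iff₀ hε] at hM
    have h3 : |Int.fract ((x : ℝ) * v j) - Int.fract ((y : ℝ) * v j)| ≤ ε := by
      by_contra! h
      nlinarith
    rw [abs_sub_comm] at h3
    convert h3 using 2
    rw [Nat.cast_sub hlt.le]
    simp only [Int.fract]
    push_cast
    ring
  rcases lt_or_gt_of_ne hxy with h | h
  · exact key x y h hy heq
  · exact key y x h hx heq.symm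

open scoped MatrixOrder Matrix.Norms.L2Operator in
/-- The square root of a positive semidefinite quadratic form is a seminorm. -/
lemma exists_seminorm {ι : Type*} [Fintype ι] {β : Matrix ι ι ℝ}
    (hβ : β.PosSemidef) : ∃ N : Seminorm ℝ (ι → ℝ), ∀ v, quadForm β v = N v ^ 2 := by
  classical
  -- Writing `β = A* A`, the seminorm is the Euclidean norm of `A v`.
  obtain ⟨A, rfl⟩ := CStarAlgebra.nonneg_iff_eq_star_mul_self.mp hβ.nonneg
  rw [Matrix.star_eq_conjTranspose]
  refine ⟨(normSeminorm ℝ (EuclideanSpace ℝ ι)).comp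
    ((WithLp.linearEquiv 2 ℝ (ι → ℝ)).symm.toLinearMap ∘ₗ A.mulVecLin), fun v => ?_⟩
  simp only [Seminorm.comp_apply, coe_normSeminorm, LinearMap.comp_apply]
  rw [EuclideanSpace.norm_sq_eq, quadForm, ← Matrix.mulVec_mulVec, Matrix.dotProduct_mulVec,
    Matrix.conjTranspose_eq_transpose_of_trivial, Matrix.vecMul_transpose]
  simp [dotProduct, sq]

lemma quadForm_single {ι : Type*} [Fintype ι] [DecidableEq ι] (β : Matrix ι ι ℝ) (i : ι) (s : ℝ) :
    quadForm β (Pi.single i s) = s ^ 2 * β i i := by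
  simp [quadForm]
  ring

lemma seminorm_le_sum {ι : Type*} [Fintype ι] [DecidableEq ι] (N : Seminorm ℝ (ι → ℝ))
    (v : ι → ℝ) : N v ≤ ∑ j, |v j| * N (Pi.single j 1) := by
  have h : v = ∑ j, v j • (Pi.single j 1 : ι → ℝ) := by
    ext i
    simp [Finset.sum_apply, Pi.single_apply]
  calc N v = N (∑ j, v j • (Pi.single j 1 : ι → ℝ)) := by rw [← h]
    _ ≤ ∑ j, N (v j • (Pi.single j 1 : ι → ℝ)) := Finset.le_sum_of_subadditive N (map_zero N).le (map_add_le_add N) _ _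
    _ = _ := Finset.sum_congr rfl fun j _ => by rw [map_smul_eq_mul, Real.norm_eq_abs]

lemma gcd_eq_one_of_isUnit {ι : Type*} {s : Finset ι} {a : ι → ℤ} {j : ι} (hj : j ∈ s)
    (ha : IsUnit (a j)) : s.gcd a = 1 := by
  have h1 : IsUnit (s.gcd a) := isUnit_of_dvd_unit (Finset.gcd_dvd hj) ha
  rw [← Finset.normalize_gcd, normalize_eq_one.mpr h1]

section Minkowski

variable {g : ℕ} {β : Matrix (Fin g) (Fin g) ℝ}

lemma IsMinkowskiReduced.le_quadForm (h : IsMinkowskiReduced β) (k : Fin g) (a : Fin g → ℤ)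
    (ha : (Finset.Ici k).gcd a = 1) : β k k ≤ quadForm β fun i => (a i : ℝ) := h.le k a ha

lemma IsMinkowskiReduced.diag_mono (h : IsMinkowskiReduced β) {i j : Fin g} (hij : i ≤ j) :
    β i i ≤ β j j := by
  have h1 := h.le_quadForm i (Pi.single j 1) (gcd_eq_one_of_isUnit (Finset.mem_Ici.mpr hij)
    (by simp))
  have h2 : (fun l => ((Pi.single j 1 : Fin g → ℤ) l : ℝ)) = Pi.single j 1 := by
    ext l
    by_cases hl : l = j
    · subst hl; simp
    · simp [hl]
  rw [h2, quadForm_single] at h1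
  simpa using h1

/-- The vectors `e_j ± e_i` are admissible in the condition for index `j`, their `j`-th coordinate
being `1`; comparing their values with `β j j` bounds the off-diagonal entry. -/
lemma IsMinkowskiReduced.two_mul_abs_le (h : IsMinkowskiReduced β) {i j : Fin g} (hij : i < j) :
    2 * |β i j| ≤ β i i := by
  have key : ∀ s : ℤ, s ^ 2 = 1 → 0 ≤ β i i + 2 * s * β i j := by
    intro s hs
    have h1 := h.le_quadForm j (Pi.single j 1 + Pi.single i s)
      (gcd_eq_one_of_isUnit (Finset.mem_Ici.mpr le_rfl) (by simp [hij.ne']))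
    have h2 : (fun l => ((Pi.single j 1 + Pi.single i s : Fin g → ℤ) l : ℝ)) =
        Pi.single j 1 + Pi.single i (s : ℝ) := by
      ext l
      by_cases hl : l = j
      · subst hl; simp [hij.ne']
      · by_cases hl' : l = i
        · subst hl'; simp [hl]
        · simp [hl, hl']
    have hs' : (s : ℝ) ^ 2 = 1 := by exact_mod_cast hs
    have h3 : β j i = β i j := h.symm.apply i j
    rw [h2] at h1
    simp [quadForm, Matrix.mulVec_add, h3] at h1
    have h4 : (s : ℝ) * β i i * s = β i i := by linear_combination β i i * hs'
    linarith
  have h1 := key 1 (by norm_num)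
  have h2 := key (-1) (by norm_num)
  push_cast at h1 h2
  have : |β i j| ≤ β i i / 2 := abs_le.mpr ⟨by linarith, by linarith⟩
  linarith

/-- A discrete Gronwall inequality, resting on `2^0 + ⋯ + 2^(l-1) = 2^l - 1`. -/
lemma le_two_pow_mul {b : Fin g → ℝ} {i : Fin g} {X : ℝ}
    (h : ∀ l ≤ i, b l ≤ ∑ j ∈ Finset.Iio l, b j + X) : ∀ l ≤ i, b l ≤ 2 ^ (l : ℕ) * X := by
  intro l
  induction l using WellFoundedLT.induction with
  | ind l ih =>
    intro hl
    refine (h l hl).trans ?_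
    have h1 : ∑ j ∈ Finset.Iio l, b j ≤ ∑ j ∈ Finset.Iio l, 2 ^ (j : ℕ) * X :=
      Finset.sum_le_sum fun j hj => ih j (Finset.mem_Iio.mp hj)
        ((Finset.mem_Iio.mp hj).le.trans hl)
    have h2 : ∑ j ∈ Finset.Iio l, (2 : ℝ) ^ (j : ℕ) * X = (2 ^ (l : ℕ) - 1) * X := by
      rw [← Finset.sum_mul]
      congr 1
      have := Finset.sum_map (Finset.Iio l) Fin.valEmbedding (fun x : ℕ => (2 : ℝ) ^ x)
      simp only [Fin.map_valEmbedding_Iio] at this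
      refine Eq.trans this.symm ?_
      rw [ Nat.Iio_eq_range, geom_sum_eq (by norm_num)]
      norm_num
    linarith

/-- The diagonal entries of a reduced matrix bound its values from below at vectors
whose last nonzero coordinate is given. -/
lemma exists_diag_le_of_isMinkowskiReduced (g : ℕ) : ∃ C : ℝ, 0 < C ∧
    ∀ β : Matrix (Fin g) (Fin g) ℝ, IsMinkowskiReduced β → ∀ N : Seminorm ℝ (Fin g → ℝ),
      (∀ v, quadForm β v = N v ^ 2) → ∀ (i : Fin g) (v : Fin g → ℝ), (∀ j, i < j → v j = 0) →
        |v i| * N (Pi.single i 1) ≤ C * N v := by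
  -- Being below `1`, `ε` forces `m i = q` and `m j = 0` for `j > i`. It is also small enough that
  -- `2 ^ g * g * ε ≤ 1 / 2`, so the term in `b i` on the right of the final estimate can be
  -- absorbed on the left.
  set ε : ℝ := 1 / (2 ^ (g + 1) * (g + 1)) with hε
  have hεpos : 0 < ε := by positivity
  have hε1 : ε < 1 := by
    rw [hε, div_lt_one (by positivity)]
    have h1 : (1 : ℝ) < 2 ^ (g + 1) := one_lt_pow₀ (by norm_num) (by omega)
    have h2 : (1 : ℝ) ≤ g + 1 := by simp
    nlinarith
  obtain ⟨Q, hQ⟩ := exists_simultaneous_approx g hεpos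
  refine ⟨2 ^ (g + 1) * (Q + 1), by positivity, fun β hβ N hN i v hv => ?_⟩
  wlog hvi : v i = 1 generalizing v
  · by_cases h0 : v i = 0
    · rw [h0, abs_zero, zero_mul]; positivity
    · have := this ((v i)⁻¹ • v) (fun j hj => by simp [hv j hj]) (by simp [h0])
      simp only [Pi.smul_apply, smul_eq_mul, inv_mul_cancel₀ h0, abs_one, one_mul,
        map_smul_eq_mul, norm_inv, Real.norm_eq_abs] at this
      have h1 : 0 < |v i| := abs_pos.mpr h0
      calc |v i| * N (Pi.single i 1) ≤ |v i| * (2 ^ (g + 1) * (Q + 1) * (|v i|⁻¹ * N v)) := by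
            gcongr
        _ = _ := by field_simp
  obtain ⟨q, hq1, hqQ, m, hm⟩ := hQ v
  set b : Fin g → ℝ := fun j => N (Pi.single j 1) with hb
  have hb0 : ∀ j, 0 ≤ b j := fun j => apply_nonneg N _
  have hb2 : ∀ j, b j ^ 2 = β j j := fun j => by rw [hb]; dsimp only; rw [← hN, quadForm_single]; simp
  have hbi : ∀ j ≤ i, b j ≤ b i := fun j hj => by
    refine pow_le_pow_iff_left₀ (hb0 j) (hb0 i) two_ne_zero |>.mp ?_
    rw [hb2, hb2]
    exact hβ.diag_mono hj
  have hmi : m i = q := by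
    have h1 := hm i
    rw [hvi, mul_one] at h1
    have h2 : |((q : ℤ) - m i : ℤ)| < 1 := by
      have h3 : |(((q : ℤ) - m i : ℤ) : ℝ)| < 1 := by push_cast; linarith
      exact_mod_cast h3
    rw [Int.abs_lt_one_iff] at h2
    omega
  have hmj : ∀ j, i < j → m j = 0 := by
    intro j hj
    have h1 := hm j
    rw [hv j hj, mul_zero, zero_sub, abs_neg] at h1
    have h2 : |m j| < 1 := by
      have h3 : |(m j : ℝ)| < 1 := by linarith
      exact_mod_cast h3
    exact Int.abs_lt_one_iff.mp h2
  set X : ℝ := g * ε * b i + Q * N v with hX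
  -- An admissible vector for index `l` close to `(q / t) • v`: from `l` on, divide `m` by the gcd
  -- `t` of these coordinates, with error at most `ε`; below `l`, round, with error at most `1 / 2`.
  -- Since `1 ≤ t` and `q ≤ Q`, the minimality condition at this vector gives the recursive bound.
  have key : ∀ l ≤ i, b l ≤ ∑ j ∈ Finset.Iio l, b j + X := by
    intro l hl
    set t : ℤ := (Finset.Ici l).gcd m with ht
    have htdvd : ∀ j, l ≤ j → t ∣ m j := fun j hj => Finset.gcd_dvd (Finset.mem_Ici.mpr hj)
    have hmi0 : m i ≠ 0 := by rw [hmi]; exact_mod_cast (by omega : q ≠ 0)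
    have ht0 : t ≠ 0 := fun h0 => hmi0 (by simpa [h0] using htdvd i hl)
    have htpos : 0 < t := lt_of_le_of_ne
      (Int.nonneg_of_normalize_eq_self Finset.normalize_gcd) (Ne.symm ht0)
    have ht1 : (1 : ℝ) ≤ t := by exact_mod_cast htpos
    set n : Fin g → ℤ := fun j => if l ≤ j then m j / t else round ((q : ℝ) * v j / t) with hn
    have hgcd : (Finset.Ici l).gcd n = 1 := by
      have h1 := Finset.gcd_div_eq_one (f := m) (Finset.mem_Ici.mpr hl) hmi0
      rw [← ht] at h1
      rw [← h1]
      exact Finset.gcd_congr rfl fun j hj => by simp [hn, Finset.mem_Ici.mp hj]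
    have h1 : b l ≤ N fun j => (n j : ℝ) := by
      refine pow_le_pow_iff_left₀ (hb0 l) (apply_nonneg N _) two_ne_zero |>.mp ?_
      rw [hb2, ← hN]
      exact hβ.le_quadForm l n hgcd
    set w : Fin g → ℝ := fun j => (n j : ℝ) - q * v j / t with hw
    have h2 : N (fun j => (n j : ℝ)) ≤ N w + Q * N v := by
      have e : (fun j => (n j : ℝ)) = w + ((q : ℝ) / t) • v := by
        ext j; simp [hw]; ring
      rw [e]
      refine (map_add_le_add N _ _).trans ?_
      rw [map_smul_eq_mul, Real.norm_of_nonneg (by positivity)]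
      gcongr
      refine (div_le_self (by positivity) ht1).trans ?_
      exact_mod_cast hqQ
    have h3 : ∀ j, |w j| * b j ≤ (if j ∈ Finset.Iio l then b j else 0) + ε * b i := by
      intro j
      by_cases hjl : l ≤ j
      · have e1 : j ∉ Finset.Iio l := by simpa using hjl
        rw [if_neg e1, zero_add]
        have e2 : w j = ((m j : ℝ) - q * v j) / t := by
          simp only [hw, hn, if_pos hjl]
          rw [Int.cast_div (htdvd j hjl) (by exact_mod_cast ht0)]
          ring
        by_cases hij : j ≤ i
        · refine mul_le_mul ?_ (hbi j hij) (hb0 j) hεpos.le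
          rw [e2, abs_div, abs_sub_comm, abs_of_pos (by linarith : (0 : ℝ) < t)]
          exact (div_le_self (abs_nonneg _) ht1).trans (hm j)
        · rw [not_le] at hij
          rw [e2, hmj j hij, hv j hij]
          simp
          exact mul_nonneg hεpos.le (hb0 i)
      · have e1 : j ∈ Finset.Iio l := by simpa using hjl
        rw [if_pos e1]
        have e2 : |w j| ≤ 1 / 2 := by
          simp only [hw, hn, if_neg hjl]
          rw [abs_sub_comm]
          exact abs_sub_round _
        have := mul_nonneg hεpos.le (hb0 i)
        nlinarith [hb0 j]
    have h4 : N w ≤ ∑ j ∈ Finset.Iio l, b j + g * ε * b i := by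
      refine (seminorm_le_sum N w).trans ((Finset.sum_le_sum fun j _ => h3 j).trans ?_)
      rw [Finset.sum_add_distrib, Finset.sum_ite_mem, Finset.univ_inter]
      simp [mul_assoc]
    linarith
  have hfin := le_two_pow_mul key i le_rfl
  have hX0 : 0 ≤ X := add_nonneg (mul_nonneg (by positivity) (hb0 i))
    (mul_nonneg (by positivity) (apply_nonneg N v))
  have h5 : b i ≤ 2 ^ g * X := hfin.trans
    (mul_le_mul_of_nonneg_right (pow_le_pow_right₀ (by norm_num) i.2.le) hX0)
  have h6 : 2 ^ g * (g * ε) ≤ 1 / 2 := by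
    rw [hε, pow_succ]
    have : (0 : ℝ) < 2 ^ g := by positivity
    rw [mul_one_div, mul_div_assoc', div_le_div_iff₀ (by positivity) (by norm_num)]
    nlinarith
  rw [hvi, abs_one, one_mul]
  have h7 : b i ≤ 1 / 2 * b i + 2 ^ g * Q * N v := by
    calc b i ≤ 2 ^ g * X := h5
      _ = 2 ^ g * (g * ε) * b i + 2 ^ g * Q * N v := by rw [hX]; ring
      _ ≤ _ := by have := hb0 i; gcongr
  have h8 : 0 ≤ N v := apply_nonneg N v
  have h9 : (0 : ℝ) ≤ 2 ^ g * N v := by positivity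
  have h10 : (2 : ℝ) ^ (g + 1) * (Q + 1) * N v = 2 * (2 ^ g * Q * N v) + 2 * (2 ^ g * N v) := by
    rw [pow_succ]; ring
  change b i ≤ _
  linarith

/-- Minkowski reduced positive definite matrices are balanced. -/
theorem exists_balanced_of_isMinkowskiReduced (g : ℕ) : ∃ c : ℝ, 0 < c ∧
    ∀ β : Matrix (Fin g) (Fin g) ℝ, IsMinkowskiReduced β → β.PosDef → Balanced c 1 β := by
  obtain ⟨C, hC, H⟩ := exists_diag_le_of_isMinkowskiReduced g
  set D : ℝ := C * (1 + C) ^ g with hD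
  have hDpos : 0 < D := by positivity
  refine ⟨1 / (g * D ^ 2 + 1), by positivity, fun β hβ hpd => ?_⟩
  have hpos : ∀ i, 0 < β i i := fun i => hpd.diag_pos
  refine ⟨fun i j => hβ.symm.apply j i, hpos, fun i j => ?_, fun v => ?_⟩
  · rw [one_mul]
    rcases lt_trichotomy i j with h | rfl | h
    · have := hβ.two_mul_abs_le h
      have := abs_nonneg (β i j)
      linarith
    · exact (abs_of_pos (hpos i)).le
    · have h1 := hβ.two_mul_abs_le h
      have h2 : β i j = β j i := hβ.symm.apply j i
      have := abs_nonneg (β j i)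
      have := hβ.diag_mono h.le
      rw [h2]
      linarith
  · obtain ⟨N, hN⟩ := exists_seminorm hpd.posSemidef
    have hb2 : ∀ j, N (Pi.single j 1) ^ 2 = β j j := fun j => by
      rw [← hN, quadForm_single]; simp
    -- `w k` keeps the first `k` coordinates of `v`. The preceding result bounds the last nonzero
    -- coordinate, so deleting coordinates from the end costs a factor `1 + C` each time; this
    -- accounts for `D`.
    set w : ℕ → Fin g → ℝ := fun k j => if (j : ℕ) < k then v j else 0 with hw
    have hwi : ∀ i : Fin g, |v i| * N (Pi.single i 1) ≤ C * N (w (i + 1)) := by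
      intro i
      have := H β hβ N hN i (w (i + 1)) (fun j hj => by
        simp only [hw]
        rw [if_neg]
        have : (i : ℕ) < j := hj
        omega)
      simpa [hw] using this
    have hstep : ∀ k, k < g → N (w k) ≤ (1 + C) * N (w (k + 1)) := by
      intro k hk
      have e : w k = w (k + 1) + -(v ⟨k, hk⟩ • (Pi.single ⟨k, hk⟩ 1 : Fin g → ℝ)) := by
        ext j
        simp only [hw, Pi.add_apply, Pi.neg_apply, Pi.smul_apply, smul_eq_mul, Pi.single_apply,
          Fin.ext_iff]
        rcases lt_trichotomy (j : ℕ) k with h | h | h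
        · simp [h, h.ne, h.trans (Nat.lt_succ_self k)]
        · have : j = ⟨k, hk⟩ := Fin.ext h
          subst this
          simp
        · have h1 : ¬ (j : ℕ) < k := by omega
          have h2 : ¬ (j : ℕ) < k + 1 := by omega
          simp [h1, h2, h.ne']
      rw [e]
      refine (map_add_le_add N _ _).trans ?_
      rw [map_neg_eq_map, map_smul_eq_mul, Real.norm_eq_abs]
      have := hwi ⟨k, hk⟩
      linarith
    have hwg : w g = v := by
      ext j; simp [hw]
    have hall : ∀ m, m ≤ g → N (w (g - m)) ≤ (1 + C) ^ m * N v := by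
      intro m
      induction m with
      | zero => intro _; simp [hwg]
      | succ m ih =>
        intro hm
        have h1 := hstep (g - (m + 1)) (by omega)
        rw [show g - (m + 1) + 1 = g - m by omega] at h1
        refine h1.trans ?_
        rw [pow_succ']
        have := ih (by omega)
        calc _ ≤ (1 + C) * ((1 + C) ^ m * N v) := by gcongr
          _ = _ := by ring
    have hvi : ∀ i, |v i| * N (Pi.single i 1) ≤ D * N v := by
      intro i
      refine (hwi i).trans ?_
      have h1 := hall (g - (i + 1)) (by omega)
      rw [show g - (g - ((i : ℕ) + 1)) = i + 1 by omega] at h1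
      have h2 : (1 + C) ^ (g - ((i : ℕ) + 1)) ≤ (1 + C) ^ g :=
        pow_le_pow_right₀ (by linarith) (by omega)
      have h3 : 0 ≤ N v := apply_nonneg N v
      calc C * N (w (i + 1)) ≤ C * ((1 + C) ^ g * N v) := by
            gcongr
            exact h1.trans (by gcongr)
        _ = _ := by rw [hD]; ring
    have hsum : ∑ i, β i i * v i ^ 2 ≤ g * D ^ 2 * N v ^ 2 := by
      calc ∑ i, β i i * v i ^ 2 ≤ ∑ _i : Fin g, (D * N v) ^ 2 := Finset.sum_le_sum fun i _ => by
            rw [← hb2, ← sq_abs (v i), ← mul_pow, mul_comm]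
            exact pow_le_pow_left₀ (mul_nonneg (abs_nonneg _) (apply_nonneg N _)) (hvi i) 2
        _ = _ := by simp; ring
    rw [hN, one_div, inv_mul_le_iff₀ (by positivity)]
    nlinarith [sq_nonneg (N v)]

end Minkowski

/-! ### Tools for finiteness: Dickson's lemma and a Cauchy–Binet formula -/

section Dickson

/-- Dickson's lemma, for a family of vectors of natural numbers. -/
lemma exists_finset_dominating {α κ : Type*} [Finite κ] (e : α → κ → ℕ) (S : Set α) :
    ∃ F : Finset α, (∀ a ∈ F, a ∈ S) ∧ ∀ a ∈ S, ∃ b ∈ F, e b ≤ e a := by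
  classical
  have hpwo : (e '' S).IsPWO := by
    have h : (Set.univ.pi fun _ : κ => (Set.univ : Set ℕ)).IsPWO :=
      Set.IsPWO.pi fun _ => Set.isPWO_of_wellQuasiOrderedLE _
    exact h.mono fun x _ => by simp
  -- The minimal elements form an antichain in a partially well-ordered set, hence are finite in
  -- number; one preimage of each suffices.
  have hfin : {x | Minimal (· ∈ e '' S) x}.Finite := by
    refine IsAntichain.finite_of_partiallyWellOrderedOn (r := (· ≤ ·)) ?_
      (hpwo.mono fun x hx => hx.1)
    exact setOfPred_minimal_antichain _
  have hex : ∀ x ∈ {x | Minimal (· ∈ e '' S) x}, ∃ a ∈ S, e a = x := fun x hx => hx.1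
  choose r hrS hre using hex
  refine ⟨Finset.image (fun x : {x // x ∈ hfin.toFinset} => r x.1 (hfin.mem_toFinset.mp x.2))
    hfin.toFinset.attach, fun a ha => ?_, fun a ha => ?_⟩
  · obtain ⟨x, -, rfl⟩ := Finset.mem_image.mp ha
    exact hrS _ _
  · obtain ⟨x, hxa, hx⟩ := hpwo.exists_le_minimal (Set.mem_image_of_mem e ha)
    refine ⟨r x hx, Finset.mem_image.mpr
      ⟨⟨x, hfin.mem_toFinset.mpr hx⟩, Finset.mem_attach _ _, rfl⟩, ?_⟩
    rw [hre x hx]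
    exact hxa

end Dickson

section CauchyBinet

/-- A version of the Cauchy–Binet formula for sums of squares of linear forms. -/
lemma factorial_mul_det_sum {n κ : Type*} [Fintype n] [DecidableEq n] (T : Finset κ)
    (t : κ → ℝ) (a : κ → n → ℝ) :
    ((Fintype.card n).factorial : ℝ) *
        (Matrix.of fun i j => ∑ v ∈ T, t v * (a v i * a v j)).det =
      ∑ f ∈ Fintype.piFinset fun _ : n => T, (∏ i, t (f i)) * (Matrix.of fun i => a (f i)).det ^ 2 := by
  classical
  have h1 : (Matrix.of fun i j => ∑ v ∈ T, t v * (a v i * a v j)).det =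
      ∑ f ∈ Fintype.piFinset fun _ : n => T, (∏ i, t (f i)) * (∏ i, a (f i) i) *
        (Matrix.of fun i => a (f i)).det := by
    have e : (Matrix.of fun i j => ∑ v ∈ T, t v * (a v i * a v j)) =
        fun i => ∑ v ∈ T, (t v * a v i) • a v := by
      ext i j
      simp [Finset.sum_apply, mul_assoc]
    rw [e]
    change Matrix.detRowAlternating _ = _
    rw [← AlternatingMap.coe_multilinearMap, MultilinearMap.map_sum_finset]
    refine Finset.sum_congr rfl fun f _ => ?_
    rw [MultilinearMap.map_smul_univ, smul_eq_mul, Finset.prod_mul_distrib]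
    rfl
  -- Reindexing `f` by `σ` preserves the weights and multiplies the determinant by the sign. Summing
  -- over all `σ` turns the product `∏ a (f i) i` into a second determinant, whence the square and
  -- the factorial.
  have h2 : ∀ σ : Equiv.Perm n, (Matrix.of fun i j => ∑ v ∈ T, t v * (a v i * a v j)).det =
      ∑ f ∈ Fintype.piFinset fun _ : n => T, (∏ i, t (f i)) *
        (((Equiv.Perm.sign σ : ℤ) : ℝ) * ∏ i, a (f (σ i)) i) *
        (Matrix.of fun i => a (f i)).det := by
    intro σ
    rw [h1]
    symm
    refine Finset.sum_bij' (fun f _ => f ∘ σ) (fun f _ => f ∘ σ.symm) ?_ ?_ ?_ ?_ ?_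
    · intro f hf
      simp only [Fintype.mem_piFinset] at hf ⊢
      exact fun i => hf _
    · intro f hf
      simp only [Fintype.mem_piFinset] at hf ⊢
      exact fun i => hf _
    · intro f _; ext; simp
    · intro f _; ext; simp
    · intro f _
      have e1 : (Matrix.of fun i => a ((f ∘ σ) i)).det =
          Equiv.Perm.sign σ * (Matrix.of fun i => a (f i)).det := by
        rw [← Matrix.det_permute]
        rfl
      rw [e1]
      simp only [Function.comp]
      rw [Equiv.prod_comp σ fun i => t (f i)]
      ring
  have h3 := Finset.sum_congr (rfl : (Finset.univ : Finset (Equiv.Perm n)) = _) fun σ _ => h2 σ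
  rw [Finset.sum_const, Finset.card_univ, Fintype.card_perm, nsmul_eq_mul] at h3
  rw [h3, Finset.sum_comm]
  refine Finset.sum_congr rfl fun f _ => ?_
  rw [← Finset.sum_mul, ← Finset.mul_sum, mul_assoc, sq]
  congr 2
  rw [Matrix.det_apply']
  rfl

end CauchyBinet

/-! ### Determinants and inverses of balanced matrices -/

section BalancedInverse

variable {n : Type*} [Fintype n] {c C : ℝ} {β : Matrix n n ℝ}

lemma Balanced.quadForm_nonneg (hc : 0 < c) (hβ : Balanced c C β) (v : n → ℝ) :
    0 ≤ quadForm β v :=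
  le_trans (mul_nonneg hc.le (Finset.sum_nonneg fun i _ =>
    mul_nonneg (hβ.pos i).le (sq_nonneg _))) (hβ.le_quadForm v)

lemma Balanced.quadForm_le (hβ : Balanced c C β) (v : n → ℝ) :
    quadForm β v ≤ Fintype.card n * C * ∑ i, β i i * v i ^ 2 := by
  have h : ∀ i j, β i j * (v i * v j) ≤ C / 2 * (β i i * v i ^ 2) + C / 2 * (β j j * v j ^ 2) := by
    intro i j
    have h1 : β i j * (v i * v j) ≤ |β i j| * (|v i| * |v j|) := by
      rw [← abs_mul, ← abs_mul]; exact le_abs_self _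
    have h2 : |v i| * |v j| ≤ v i ^ 2 / 2 + v j ^ 2 / 2 := by
      nlinarith [sq_nonneg (|v i| - |v j|), sq_abs (v i), sq_abs (v j)]
    have h3 := hβ.abs_entry_le i j
    have h4 := hβ.abs_entry_le j i
    rw [← hβ.symm i j] at h4
    have h5 := mul_le_mul_of_nonneg_left h2 (abs_nonneg (β i j))
    have h6 := mul_le_mul_of_nonneg_right h3 (sq_nonneg (v i))
    have h7 := mul_le_mul_of_nonneg_right h4 (sq_nonneg (v j))
    nlinarith
  rw [quadForm_eq_sum]
  refine (Finset.sum_le_sum fun i _ => Finset.sum_le_sum fun j _ => h i j).trans (le_of_eq ?_)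
  simp only [Finset.sum_add_distrib, Finset.sum_const, Finset.card_univ, nsmul_eq_mul,
    ← Finset.mul_sum]
  ring

lemma Balanced.posDef (hc : 0 < c) (hβ : Balanced c C β) : β.PosDef := by
  refine Matrix.PosDef.of_dotProduct_mulVec_pos (Matrix.IsHermitian.ext fun i j => by
    simp [hβ.symm i j]) fun x hx => ?_
  have h1 := hβ.le_quadForm x
  obtain ⟨i, hi⟩ := Function.ne_iff.mp hx
  replace hi : x i ≠ 0 := hi
  have h2 : 0 < ∑ i, β i i * x i ^ 2 := Finset.sum_pos'
    (fun j _ => mul_nonneg (hβ.pos j).le (sq_nonneg _))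
    ⟨i, Finset.mem_univ i, mul_pos (hβ.pos i) (by positivity)⟩
  have h3 : 0 < c * ∑ i, β i i * x i ^ 2 := mul_pos hc h2
  simpa [quadForm] using h3.trans_le h1

variable [DecidableEq n]

/-- A lower bound in the direction opposite to Hadamard's inequality. -/
lemma Balanced.prod_le_det (hc : 0 < c) (hβ : Balanced c C β) :
    c ^ Fintype.card n * ∏ i, β i i ≤ β.det := by
  -- After rescaling to unit diagonal, the lower bound on the quadratic form says that every
  -- eigenvalue is at least `c`.
  set s : n → ℝ := fun i => √(β i i) with hs
  have hspos : ∀ i, 0 < s i := fun i => Real.sqrt_pos.mpr (hβ.pos i)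
  have hs2 : ∀ i, s i ^ 2 = β i i := fun i => Real.sq_sqrt (hβ.pos i).le
  set N : Matrix n n ℝ := Matrix.of fun i j => β i j / (s i * s j) with hN
  have hNβ : β = Matrix.diagonal s * N * Matrix.diagonal s := by
    ext i j
    rw [Matrix.mul_diagonal, Matrix.diagonal_mul, hN, Matrix.of_apply]
    have := hspos i
    have := hspos j
    field_simp
  have hH : N.IsHermitian := Matrix.IsHermitian.ext fun i j => by
    simp only [hN, Matrix.of_apply, star_trivial, hβ.symm i j]
    rw [mul_comm (s i)]
  have hle : ∀ v : n → ℝ, c * ∑ i, v i ^ 2 ≤ v ⬝ᵥ (N *ᵥ v) := by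
    intro v
    have h1 := hβ.le_quadForm fun i => v i / s i
    have e1 : quadForm β (fun i => v i / s i) = v ⬝ᵥ (N *ᵥ v) := by
      change _ = quadForm N v
      rw [quadForm_eq_sum, quadForm_eq_sum]
      refine Finset.sum_congr rfl fun i _ => Finset.sum_congr rfl fun j _ => ?_
      rw [hN, Matrix.of_apply]
      have := hspos i
      have := hspos j
      field_simp
    have e2 : ∑ i, β i i * (v i / s i) ^ 2 = ∑ i, v i ^ 2 := Finset.sum_congr rfl fun i _ => by
      rw [← hs2 i]
      have := hspos i
      field_simp
    rwa [e1, e2] at h1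
  have heig : ∀ i, c ≤ hH.eigenvalues i := by
    intro i
    rw [hH.eigenvalues_eq]
    refine le_trans ?_ (by simpa using hle (hH.eigenvectorBasis i))
    have h1 : ‖hH.eigenvectorBasis i‖ = 1 := hH.eigenvectorBasis.orthonormal.1 i
    have h2 := EuclideanSpace.norm_sq_eq (hH.eigenvectorBasis i)
    rw [h1] at h2
    simp only [Real.norm_eq_abs, sq_abs] at h2
    rw [← h2]
    simp
  have hdet : c ^ Fintype.card n ≤ N.det := by
    rw [hH.det_eq_prod_eigenvalues]
    simp only [RCLike.ofReal_real_eq_id, id]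
    rw [← Finset.card_univ, ← Finset.prod_const]
    exact Finset.prod_le_prod (fun _ _ => hc.le) fun i _ => heig i
  have hprod : ∏ i, β i i = (∏ i, s i) ^ 2 := by
    rw [← Finset.prod_pow]
    exact Finset.prod_congr rfl fun i _ => (hs2 i).symm
  have hd : β.det = (∏ i, s i) ^ 2 * N.det := by
    conv_lhs => rw [hNβ]
    rw [Matrix.det_mul, Matrix.det_mul, Matrix.det_diagonal]
    ring
  rw [hd, hprod, mul_comm]
  exact mul_le_mul_of_nonneg_left hdet (sq_nonneg _)

/-- The entries of the inverse of a balanced matrix are bounded by the inverses of the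
diagonal entries. -/
lemma Balanced.mul_abs_inv_le (hc : 0 < c) (hβ : Balanced c C β) (i j : n) :
    β i i * |β⁻¹ i j| ≤
      ((Fintype.card n).factorial * (max C 1) ^ Fintype.card n) / c ^ Fintype.card n := by
  -- Dividing column `j` by `β j j` leaves entries bounded by `C` and, by `Balanced.prod_le_det`, a
  -- determinant at least `c ^ card n`. So `W⁻¹`, which is `β⁻¹` with row `i` multiplied by `β i i`,
  -- is bounded through its adjugate; the `1` in `max C 1` allows for the unit row in the cofactor.
  set W : Matrix n n ℝ := β * Matrix.diagonal (fun j => (β j j)⁻¹) with hW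
  have hprod : 0 < ∏ i, β i i := Finset.prod_pos fun i _ => hβ.pos i
  have hWdet : c ^ Fintype.card n ≤ W.det := by
    rw [hW, Matrix.det_mul, Matrix.det_diagonal, Finset.prod_inv_distrib, ← div_eq_mul_inv,
      le_div_iff₀ hprod]
    exact hβ.prod_le_det hc
  have hcpos : 0 < c ^ Fintype.card n := pow_pos hc _
  have hWpos : 0 < W.det := hcpos.trans_le hWdet
  have hWij : ∀ i j, |W i j| ≤ max C 1 := by
    intro i j
    rw [hW, Matrix.mul_diagonal, abs_mul, abs_of_pos (inv_pos.mpr (hβ.pos j)), ← div_eq_mul_inv,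
      div_le_iff₀ (hβ.pos j), hβ.symm i j]
    refine (hβ.abs_entry_le j i).trans ?_
    exact mul_le_mul_of_nonneg_right (le_max_left _ _) (hβ.pos j).le
  have hinv : W⁻¹ i j = β i i * β⁻¹ i j := by
    rw [hW, Matrix.mul_inv_rev, Matrix.inv_diagonal, Matrix.diagonal_mul]
    congr 1
    have hu : IsUnit fun j => (β j j)⁻¹ :=
      Pi.isUnit_iff.mpr fun j => (inv_ne_zero (hβ.pos j).ne').isUnit
    have h1 := congrFun (Ring.mul_inverse_cancel _ hu) i
    have h2 := (hβ.pos i).ne'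
    simp only [Pi.mul_apply, Pi.one_apply] at h1
    exact (eq_inv_of_mul_eq_one_right h1).trans (inv_inv _)
  have habs : β i i * |β⁻¹ i j| = |W⁻¹ i j| := by
    rw [hinv, abs_mul, abs_of_pos (hβ.pos i)]
  rw [habs, Matrix.inv_def,
    Matrix.smul_apply, smul_eq_mul, abs_mul, Ring.inverse_eq_inv, abs_of_pos (inv_pos.mpr hWpos),
    inv_mul_eq_div]
  have hadj : |W.adjugate i j| ≤ (Fintype.card n).factorial * (max C 1) ^ Fintype.card n := by
    rw [Matrix.adjugate_apply]
    have := Matrix.det_le (A := W.updateRow j (Pi.single i 1)) (abv := AbsoluteValue.abs)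
      (x := max C 1) (fun a b => by
        rw [Matrix.updateRow_apply]
        split_ifs
        · by_cases h : b = i
          · subst h; simp
          · simp [h]
        · exact hWij a b)
    simpa using this
  exact div_le_div₀ (by positivity) hadj hcpos hWdet

/-- With `v i = e i / β i i`, expand `0 ≤ quadForm β (β⁻¹ e - s v)`: the value of `β⁻¹` at `e` is at
least `2 s S - s² quadForm β v`, and the chosen `s` makes the last term at most `s S` by
`Balanced.quadForm_le`. -/
lemma Balanced.le_quadForm_inv (hc : 0 < c) (hC : 0 < C) (hβ : Balanced c C β) (e : n → ℝ) :
    1 / (Fintype.card n * C + 1) * ∑ i, e i ^ 2 / β i i ≤ quadForm β⁻¹ e := by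
  set s : ℝ := 1 / (Fintype.card n * C + 1) with hs
  have hspos : 0 < s := by positivity
  set S : ℝ := ∑ i, e i ^ 2 / β i i with hS
  have hS0 : 0 ≤ S := Finset.sum_nonneg fun i _ => div_nonneg (sq_nonneg _) (hβ.pos i).le
  set v : n → ℝ := fun i => e i / β i i with hv
  have hdet : IsUnit β.det := (hβ.posDef hc).det_pos.ne'.isUnit
  have hβf : β *ᵥ (β⁻¹ *ᵥ e) = e := by
    rw [Matrix.mulVec_mulVec, Matrix.mul_nonsing_inv _ hdet, Matrix.one_mulVec]
  have hsymm : βᵀ = β := by ext i j; exact hβ.symm j i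
  have h1 : quadForm β (β⁻¹ *ᵥ e - s • v) =
      quadForm β⁻¹ e - 2 * s * (v ⬝ᵥ e) + s ^ 2 * quadForm β v := by
    have e1 : (β⁻¹ *ᵥ e) ⬝ᵥ (β *ᵥ v) = v ⬝ᵥ e := by
      rw [Matrix.dotProduct_mulVec, ← Matrix.mulVec_transpose, hsymm, hβf, dotProduct_comm]
    simp only [quadForm, Matrix.mulVec_sub, Matrix.mulVec_smul, dotProduct_sub, sub_dotProduct,
      dotProduct_smul, smul_dotProduct, smul_eq_mul, hβf, e1, dotProduct_comm (β⁻¹ *ᵥ e) e]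
    ring
  have h2 : v ⬝ᵥ e = S := Finset.sum_congr rfl fun i _ => by simp only [hv]; ring
  have h3 : ∑ i, β i i * v i ^ 2 = S := Finset.sum_congr rfl fun i _ => by
    have := hβ.pos i
    simp only [hv]; field_simp
  have h4 := hβ.quadForm_le v
  rw [h3] at h4
  have h5 := hβ.quadForm_nonneg hc (β⁻¹ *ᵥ e - s • v)
  rw [h1, h2] at h5
  have h6 : s * (Fintype.card n * C) ≤ 1 := by
    rw [hs, one_div, inv_mul_le_iff₀ (by positivity)]
    linarith
  have h7 : s ^ 2 * quadForm β v ≤ s * S := by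
    calc s ^ 2 * quadForm β v ≤ s ^ 2 * (Fintype.card n * C * S) := by gcongr
      _ = s * (s * (Fintype.card n * C)) * S := by ring
      _ ≤ s * 1 * S := by gcongr
      _ = s * S := by ring
  linarith

end BalancedInverse

/-! ### The symplectic form of a point of the Siegel half space is balanced -/

section SymplecticForm

variable {n : Type*} [Fintype n] [DecidableEq n]

/-- The symplectic positive definite form attached to the point `X + i Y` of the Siegel upper half
space. -/
noncomputable def symplecticForm (X Y : Matrix n n ℝ) : Matrix (n ⊕ n) (n ⊕ n) ℝ :=
  Matrix.fromBlocks Y⁻¹ (Y⁻¹ * X) (X * Y⁻¹) (X * Y⁻¹ * X + Y)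

lemma quadForm_symplecticForm {X Y : Matrix n n ℝ} (hX : Xᵀ = X) (d e : n → ℝ) :
    quadForm (symplecticForm X Y) (Sum.elim d e) =
      quadForm Y⁻¹ (d + X *ᵥ e) + quadForm Y e := by
  simp only [quadForm, symplecticForm, Matrix.fromBlocks_mulVec, Sum.elim_comp_inl,
    Sum.elim_comp_inr, sumElim_dotProduct_sumElim, Matrix.mulVec_add, Matrix.add_mulVec,
    Matrix.mulVec_mulVec, dotProduct_add, add_dotProduct]
  have h : ∀ v, (X *ᵥ e) ⬝ᵥ v = e ⬝ᵥ (X *ᵥ v) := fun v => by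
    rw [Matrix.dotProduct_mulVec, ← Matrix.mulVec_transpose, hX]
  simp only [h, Matrix.mulVec_mulVec, Matrix.mul_assoc]
  ring

/-- This makes `exists_cone` applicable in dimension `2g`. The two diagonal blocks have sizes
comparable to `1 / Y i i` and `Y i i`; the bounds `|X i j| ≤ 1` and `c₀ ≤ Y i i` keep the mixing
through `X` under control. -/
lemma exists_balanced_symplecticForm {c C c₀ : ℝ} (hc : 0 < c) (hC : 0 < C) (hc₀ : 0 < c₀) :
    ∃ c' C' : ℝ, 0 < c' ∧ 0 < C' ∧ ∀ X Y : Matrix n n ℝ, Xᵀ = X → (∀ i j, |X i j| ≤ 1) →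
      Balanced c C Y → (∀ i, c₀ ≤ Y i i) → Balanced c' C' (symplecticForm X Y) := by
  set m : ℝ := ((Fintype.card n : ℕ) : ℝ) with hm
  have hm0 : 0 ≤ m := Nat.cast_nonneg _
  set D : ℝ := ((Fintype.card n).factorial * (max C 1) ^ Fintype.card n) / c ^ Fintype.card n
    with hD
  have hDpos : 0 < D := by positivity
  set s : ℝ := 1 / (m * C + 1) with hs
  have hspos : 0 < s := by positivity
  set A : ℝ := 2 * D * m ^ 2 / c₀ ^ 2 + 1 + m ^ 2 * D / c₀ ^ 2 with hA
  have hApos : 0 < A := by positivity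
  refine ⟨1 / (2 * D / s + A / c), D / s + m * D / s + m * D / c₀ ^ 2 + m ^ 2 * D / c₀ ^ 2 + C,
    by positivity, by positivity, fun X Y hX hX1 hY hY0 => ?_⟩
  have hG1 : ∀ i j, |Y⁻¹ i j| ≤ D / Y i i := fun i j => by
    rw [le_div_iff₀ (hY.pos i), mul_comm]
    exact hY.mul_abs_inv_le hc i j
  have hYT : Yᵀ = Y := by ext i j; exact hY.symm j i
  have hGsymm : (Y⁻¹)ᵀ = Y⁻¹ := by rw [Matrix.transpose_nonsing_inv, hYT]
  have hGii : ∀ i, s / Y i i ≤ Y⁻¹ i i := fun i => by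
    have h1 := hY.le_quadForm_inv hc hC (Pi.single i 1)
    rw [quadForm_single, ← hm, ← hs, Finset.sum_eq_single i] at h1
    · simpa [div_eq_mul_inv] using h1
    · intro b _ hb; simp [hb]
    · simp
  have hGX : ∀ i j, |(Y⁻¹ * X) i j| ≤ ∑ k, |Y⁻¹ i k| := fun i j => by
    rw [Matrix.mul_apply]
    refine (Finset.abs_sum_le_sum_abs _ _).trans (Finset.sum_le_sum fun k _ => ?_)
    rw [abs_mul]
    exact mul_le_of_le_one_right (abs_nonneg _) (hX1 _ _)
  have hGX1 : ∀ i j, |(Y⁻¹ * X) i j| ≤ m * D / Y i i := fun i j =>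
    (hGX i j).trans ((Finset.sum_le_sum fun k _ => hG1 i k).trans (by
      simp [hm, mul_div_assoc]))
  have hGX2 : ∀ i j, |(Y⁻¹ * X) i j| ≤ m * D / c₀ := fun i j =>
    (hGX1 i j).trans (div_le_div_of_nonneg_left (by positivity) hc₀ (hY0 i))
  have hXG : X * Y⁻¹ = (Y⁻¹ * X)ᵀ := by rw [Matrix.transpose_mul, hX, hGsymm]
  have hone : ∀ i, 1 ≤ Y i i / c₀ := fun i => (one_le_div hc₀).mpr (hY0 i)
  have hXG2 : ∀ i j, |(X * Y⁻¹) i j| ≤ m * D / c₀ ^ 2 * Y i i := fun i j => by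
    rw [hXG, Matrix.transpose_apply]
    calc _ ≤ m * D / c₀ := hGX2 j i
      _ ≤ m * D / c₀ * (Y i i / c₀) := le_mul_of_one_le_right (by positivity) (hone i)
      _ = _ := by field_simp
  have hXGX : ∀ i j, |(X * Y⁻¹ * X) i j| ≤ m ^ 2 * D / c₀ ^ 2 * Y i i := fun i j => by
    rw [Matrix.mul_apply]
    calc |∑ k, (X * Y⁻¹) i k * X k j| ≤ ∑ k, |(X * Y⁻¹) i k * X k j| :=
          Finset.abs_sum_le_sum_abs _ _
      _ ≤ ∑ _k : n, m * D / c₀ ^ 2 * Y i i := Finset.sum_le_sum fun k _ => by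
          rw [abs_mul]
          exact (mul_le_of_le_one_right (abs_nonneg _) (hX1 _ _)).trans (hXG2 i k)
      _ = _ := by simp [← hm]; ring
  have hXGX0 : ∀ i, 0 ≤ (X * Y⁻¹ * X) i i := fun i => by
    have h1 : (X * Y⁻¹ * X) i i = quadForm Y⁻¹ (X *ᵥ Pi.single i 1) := by
      rw [quadForm, dotProduct_comm, ← Matrix.dotProduct_transpose_mulVec, hX]
      simp [dotProduct_comm]
      rfl
    rw [h1]
    exact le_trans (mul_nonneg hspos.le (Finset.sum_nonneg fun i _ =>
      div_nonneg (sq_nonneg _) (hY.pos i).le)) (hY.le_quadForm_inv hc hC _)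
  have hP : ∀ i, Y i i ≤ symplecticForm X Y (Sum.inr i) (Sum.inr i) := fun i => by
    simp only [symplecticForm, Matrix.fromBlocks_apply₂₂, Matrix.add_apply]
    linarith [hXGX0 i]
  have hGpos : ∀ i, 0 < Y⁻¹ i i := fun i => lt_of_lt_of_le (div_pos hspos (hY.pos i)) (hGii i)
  have hYG : ∀ i, 1 / Y i i ≤ Y⁻¹ i i / s := fun i => by
    rw [le_div_iff₀ hspos, one_div, inv_mul_eq_div]
    exact hGii i
  refine ⟨fun i j => ?_, fun i => ?_, fun i j => ?_, fun v => ?_⟩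
  · have : (symplecticForm X Y)ᵀ = symplecticForm X Y := by
      simp only [symplecticForm, Matrix.fromBlocks_transpose, Matrix.transpose_mul,
        Matrix.transpose_add, hX, hGsymm, hYT, Matrix.mul_assoc]
    exact congrFun (congrFun this j) i
  · rcases i with i | i
    · exact hGpos i
    · exact (hY.pos i).trans_le (hP i)
  · have t1 : 0 ≤ D / s := by positivity
    have t2 : 0 ≤ m * D / s := by positivity
    have t3 : 0 ≤ m * D / c₀ ^ 2 := by positivity
    have t4 : 0 ≤ m ^ 2 * D / c₀ ^ 2 := by positivity
    rcases i with i | i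
    · have hp : 0 < symplecticForm X Y (Sum.inl i) (Sum.inl i) := hGpos i
      rcases j with j | j
      · have : |symplecticForm X Y (Sum.inl i) (Sum.inl j)| ≤
            D / s * symplecticForm X Y (Sum.inl i) (Sum.inl i) := by
          simp only [symplecticForm, Matrix.fromBlocks_apply₁₁]
          calc |Y⁻¹ i j| ≤ D * (1 / Y i i) := by rw [mul_one_div]; exact hG1 i j
            _ ≤ D * (Y⁻¹ i i / s) := by have := hYG i; gcongr
            _ = _ := by ring
        exact this.trans (mul_le_mul_of_nonneg_right (by linarith) hp.le)
      · have : |symplecticForm X Y (Sum.inl i) (Sum.inr j)| ≤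
            m * D / s * symplecticForm X Y (Sum.inl i) (Sum.inl i) := by
          simp only [symplecticForm, Matrix.fromBlocks_apply₁₁, Matrix.fromBlocks_apply₁₂]
          calc |(Y⁻¹ * X) i j| ≤ m * D * (1 / Y i i) := by rw [mul_one_div]; exact hGX1 i j
            _ ≤ m * D * (Y⁻¹ i i / s) := by have := hYG i; gcongr
            _ = _ := by ring
        exact this.trans (mul_le_mul_of_nonneg_right (by linarith) hp.le)
    · have hp := hP i
      have hp0 := hY.pos i
      rcases j with j | j
      · have : |symplecticForm X Y (Sum.inr i) (Sum.inl j)| ≤ m * D / c₀ ^ 2 * Y i i := hXG2 i j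
        refine this.trans ((mul_le_mul_of_nonneg_left hp t3).trans ?_)
        exact mul_le_mul_of_nonneg_right (by linarith) (hp0.le.trans hp)
      · have : |symplecticForm X Y (Sum.inr i) (Sum.inr j)| ≤
            (m ^ 2 * D / c₀ ^ 2 + C) * Y i i := by
          simp only [symplecticForm, Matrix.fromBlocks_apply₂₂, Matrix.add_apply]
          refine (abs_add_le _ _).trans ?_
          have := hXGX i j
          have := hY.abs_entry_le i j
          linarith
        refine this.trans ((mul_le_mul_of_nonneg_left hp (by positivity)).trans ?_)
        exact mul_le_mul_of_nonneg_right (by linarith) (hp0.le.trans hp)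
  · obtain ⟨d, e, rfl⟩ : ∃ d e, v = Sum.elim d e := ⟨v ∘ Sum.inl, v ∘ Sum.inr, by
      rw [Sum.elim_comp_inl_inr]⟩
    rw [quadForm_symplecticForm hX, Fintype.sum_sum_type]
    simp only [Sum.elim_inl, Sum.elim_inr]
    set S : ℝ := ∑ i, (d + X *ᵥ e) i ^ 2 / Y i i with hS
    set E : ℝ := ∑ i, Y i i * e i ^ 2 with hE
    have hS0 : 0 ≤ S := Finset.sum_nonneg fun i _ => div_nonneg (sq_nonneg _) (hY.pos i).le
    have hE0 : 0 ≤ E := Finset.sum_nonneg fun i _ => mul_nonneg (hY.pos i).le (sq_nonneg _)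
    have h1 : s * S ≤ quadForm Y⁻¹ (d + X *ᵥ e) := hY.le_quadForm_inv hc hC _
    have h2 : c * E ≤ quadForm Y e := hY.le_quadForm e
    have h3 : ∀ i, (X *ᵥ e) i ^ 2 ≤ m / c₀ * E := fun i => by
      have e1 : (X *ᵥ e) i ^ 2 ≤ (∑ j, X i j ^ 2) * ∑ j, e j ^ 2 := by
        simp only [Matrix.mulVec, dotProduct]
        exact Finset.sum_mul_sq_le_sq_mul_sq _ _ _
      have e2 : ∑ j, X i j ^ 2 ≤ m := by
        calc ∑ j, X i j ^ 2 ≤ ∑ _j : n, (1 : ℝ) := Finset.sum_le_sum fun j _ => by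
              rw [← sq_abs]; exact pow_le_one₀ (abs_nonneg _) (hX1 i j)
          _ = m := by simp [hm]
      have e3 : ∑ j, e j ^ 2 ≤ 1 / c₀ * E := by
        rw [hE, Finset.mul_sum]
        refine Finset.sum_le_sum fun j _ => ?_
        rw [← mul_assoc, one_div, inv_mul_eq_div]
        exact le_mul_of_one_le_left (sq_nonneg _) (hone j)
      calc _ ≤ m * (1 / c₀ * E) := e1.trans (mul_le_mul e2 e3
            (Finset.sum_nonneg fun _ _ => sq_nonneg _) hm0)
        _ = _ := by ring
    -- The completed square controls `d + X e`; recovering `d` costs a multiple of `E`, since `(X e)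
    -- i ^ 2 ≤ (m / c₀) * E` by Cauchy–Schwarz.
    have h4 : ∑ i, d i ^ 2 / Y i i ≤ 2 * S + 2 * (m ^ 2 / c₀ ^ 2) * E := by
      have : ∀ i, d i ^ 2 / Y i i ≤ 2 * ((d + X *ᵥ e) i ^ 2 / Y i i) + 2 * (m / c₀ ^ 2) * E := by
        intro i
        have e1 : d i ^ 2 ≤ 2 * (d + X *ᵥ e) i ^ 2 + 2 * (X *ᵥ e) i ^ 2 := by
          simp only [Pi.add_apply]
          nlinarith [sq_nonneg (d i + 2 * (X *ᵥ e) i)]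
        have e2 : (X *ᵥ e) i ^ 2 / Y i i ≤ m / c₀ ^ 2 * E := by
          rw [div_le_iff₀ (hY.pos i)]
          calc _ ≤ m / c₀ * E := h3 i
            _ ≤ m / c₀ * E * (Y i i / c₀) := le_mul_of_one_le_right (by positivity) (hone i)
            _ = _ := by field_simp
        calc d i ^ 2 / Y i i ≤ (2 * (d + X *ᵥ e) i ^ 2 + 2 * (X *ᵥ e) i ^ 2) / Y i i := by
              have := hY.pos i; gcongr
          _ = 2 * ((d + X *ᵥ e) i ^ 2 / Y i i) + 2 * ((X *ᵥ e) i ^ 2 / Y i i) := by ring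
          _ ≤ _ := by linarith
      refine (Finset.sum_le_sum fun i _ => this i).trans (le_of_eq ?_)
      rw [Finset.sum_add_distrib, ← Finset.mul_sum, ← hS]
      simp [← hm]
      ring
    have h5 : ∑ i, symplecticForm X Y (Sum.inl i) (Sum.inl i) * d i ^ 2 ≤
        D * ∑ i, d i ^ 2 / Y i i := by
      rw [Finset.mul_sum]
      refine Finset.sum_le_sum fun i _ => ?_
      calc _ ≤ D / Y i i * d i ^ 2 := mul_le_mul_of_nonneg_right
            ((le_abs_self _).trans (hG1 i i)) (sq_nonneg _)
        _ = _ := by ring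
    have h6 : ∑ i, symplecticForm X Y (Sum.inr i) (Sum.inr i) * e i ^ 2 ≤
        (1 + m ^ 2 * D / c₀ ^ 2) * E := by
      rw [hE, Finset.mul_sum]
      refine Finset.sum_le_sum fun i _ => ?_
      rw [← mul_assoc]
      refine mul_le_mul_of_nonneg_right ?_ (sq_nonneg _)
      simp only [symplecticForm, Matrix.fromBlocks_apply₂₂, Matrix.add_apply]
      have := (le_abs_self _).trans (hXGX i i)
      linarith
    have h7 : ∑ i, symplecticForm X Y (Sum.inl i) (Sum.inl i) * d i ^ 2 +
        ∑ i, symplecticForm X Y (Sum.inr i) (Sum.inr i) * e i ^ 2 ≤ 2 * D * S + A * E := by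
      have := mul_le_mul_of_nonneg_left h4 hDpos.le
      rw [hA]
      have e1 : D * (2 * S + 2 * (m ^ 2 / c₀ ^ 2) * E) =
        2 * D * S + 2 * D * m ^ 2 / c₀ ^ 2 * E := by ring
      rw [e1] at this
      linarith
    rw [one_div, inv_mul_le_iff₀ (by positivity)]
    have h8 : 2 * D * S + A * E ≤ (2 * D / s + A / c) * (s * S + c * E) := by
      have e1 : (2 * D / s + A / c) * (s * S + c * E) =
        2 * D * S + A * E + (2 * D / s * (c * E) + A / c * (s * S)) := by field_simp; ring
      rw [e1]
      have : 0 ≤ 2 * D / s * (c * E) + A / c * (s * S) := by positivity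
      linarith
    exact h7.trans (h8.trans (mul_le_mul_of_nonneg_left (by linarith) (by positivity)))

end SymplecticForm

/-! ### The symplectic action and finitely many determinant conditions -/

section SiegelAction

variable {g : ℕ}

/-- The factor of automorphy `γ τ + δ` of the symplectic action. -/
noncomputable def siegelDenom (M : Matrix (Fin g ⊕ Fin g) (Fin g ⊕ Fin g) ℤ)
    (τ : Matrix (Fin g) (Fin g) ℂ) : Matrix (Fin g) (Fin g) ℂ :=
  M.toBlocks₂₁.map (Int.cast : ℤ → ℂ) * τ + M.toBlocks₂₂.map (Int.cast : ℤ → ℂ)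

/-- The numerator `α τ + β` of the symplectic action. -/
noncomputable def siegelNum (M : Matrix (Fin g ⊕ Fin g) (Fin g ⊕ Fin g) ℤ)
    (τ : Matrix (Fin g) (Fin g) ℂ) : Matrix (Fin g) (Fin g) ℂ :=
  M.toBlocks₁₁.map (Int.cast : ℤ → ℂ) * τ + M.toBlocks₁₂.map (Int.cast : ℤ → ℂ)

lemma siegelAction_eq (M : Matrix (Fin g ⊕ Fin g) (Fin g ⊕ Fin g) ℤ)
    (τ : Matrix (Fin g) (Fin g) ℂ) : siegelAction M τ = siegelNum M τ * (siegelDenom M τ)⁻¹ := rfl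

lemma conjTranspose_map_intCast (A : Matrix (Fin g) (Fin g) ℤ) :
    (A.map (Int.cast : ℤ → ℂ))ᴴ = (A.map (Int.cast : ℤ → ℂ))ᵀ := by
  ext i j; simp

lemma symplectic_blocks {R : Type*} [CommRing R] {M : Matrix (Fin g ⊕ Fin g) (Fin g ⊕ Fin g) ℤ}
    (hM : M ∈ symplecticGroup (Fin g) ℤ) :
    (M.toBlocks₁₁.map (Int.cast : ℤ → R))ᵀ * M.toBlocks₂₁.map (Int.cast : ℤ → R) =
      (M.toBlocks₂₁.map (Int.cast : ℤ → R))ᵀ * M.toBlocks₁₁.map (Int.cast : ℤ → R) ∧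
    (M.toBlocks₁₂.map (Int.cast : ℤ → R))ᵀ * M.toBlocks₂₂.map (Int.cast : ℤ → R) =
      (M.toBlocks₂₂.map (Int.cast : ℤ → R))ᵀ * M.toBlocks₁₂.map (Int.cast : ℤ → R) ∧
    (M.toBlocks₁₁.map (Int.cast : ℤ → R))ᵀ * M.toBlocks₂₂.map (Int.cast : ℤ → R) -
      (M.toBlocks₂₁.map (Int.cast : ℤ → R))ᵀ * M.toBlocks₁₂.map (Int.cast : ℤ → R) = 1 := by
  have h := SymplecticGroup.map_mem hM (Int.castRingHom R)
  rw [← Matrix.fromBlocks_toBlocks (M.map (Int.castRingHom R))] at h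
  exact SymplecticGroup.fromBlocks_mem_iff.mp h

lemma symplectic_lower_blocks {R : Type*} [CommRing R]
    {M : Matrix (Fin g ⊕ Fin g) (Fin g ⊕ Fin g) ℤ} (hM : M ∈ symplecticGroup (Fin g) ℤ) :
    M.toBlocks₂₁.map (Int.cast : ℤ → R) * (M.toBlocks₂₂.map (Int.cast : ℤ → R))ᵀ =
      M.toBlocks₂₂.map (Int.cast : ℤ → R) * (M.toBlocks₂₁.map (Int.cast : ℤ → R))ᵀ :=
  (symplectic_blocks (R := R) (SymplecticGroup.transpose_mem hM)).2.1

variable {M : Matrix (Fin g ⊕ Fin g) (Fin g ⊕ Fin g) ℤ} {τ : Matrix (Fin g) (Fin g) ℂ}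

/-- The symmetry of `siegelAction M τ`, cleared of denominators. -/
lemma siegelDenom_transpose_mul (hM : M ∈ symplecticGroup (Fin g) ℤ) (hτ : τ.IsSymm) :
    (siegelDenom M τ)ᵀ * siegelNum M τ = (siegelNum M τ)ᵀ * siegelDenom M τ := by
  obtain ⟨h1, h2, h3⟩ := symplectic_blocks (R := ℂ) hM
  have h4 := congrArg Matrix.transpose h3
  simp only [Matrix.transpose_sub, Matrix.transpose_mul, Matrix.transpose_transpose,
    Matrix.transpose_one] at h4
  simp only [siegelDenom, siegelNum, Matrix.transpose_add, Matrix.transpose_mul, hτ.eq]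
  set α := M.toBlocks₁₁.map (Int.cast : ℤ → ℂ)
  set β := M.toBlocks₁₂.map (Int.cast : ℤ → ℂ)
  set γ := M.toBlocks₂₁.map (Int.cast : ℤ → ℂ)
  set δ := M.toBlocks₂₂.map (Int.cast : ℤ → ℂ)
  have e : (τ * γᵀ + δᵀ) * (α * τ + β) - (τ * αᵀ + βᵀ) * (γ * τ + δ) =
      -(τ * (αᵀ * γ - γᵀ * α) * τ) - τ * (αᵀ * δ - γᵀ * β) + (δᵀ * α - βᵀ * γ) * τ
      - (βᵀ * δ - δᵀ * β) := by noncomm_ring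
  rw [← sub_eq_zero, e, h1, h2, h3, h4]
  simp

/-- With `Q` the factor of automorphy and `τ'` the image point, this is `Qᴴ (τ' - τ'ᴴ) Q = τ - τᴴ`,
the transformation law of the imaginary part. Being free of inverses, it also serves to prove that
`Q` is invertible. -/
lemma siegelDenom_conjTranspose_mul (hM : M ∈ symplecticGroup (Fin g) ℤ) :
    (siegelDenom M τ)ᴴ * siegelNum M τ - (siegelNum M τ)ᴴ * siegelDenom M τ = τ - τᴴ := by
  obtain ⟨h1, h2, h3⟩ := symplectic_blocks (R := ℂ) hM
  have h4 := congrArg Matrix.transpose h3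
  simp only [Matrix.transpose_sub, Matrix.transpose_mul, Matrix.transpose_transpose,
    Matrix.transpose_one] at h4
  simp only [siegelDenom, siegelNum, Matrix.conjTranspose_add, Matrix.conjTranspose_mul,
    conjTranspose_map_intCast]
  set α := M.toBlocks₁₁.map (Int.cast : ℤ → ℂ)
  set β := M.toBlocks₁₂.map (Int.cast : ℤ → ℂ)
  set γ := M.toBlocks₂₁.map (Int.cast : ℤ → ℂ)
  set δ := M.toBlocks₂₂.map (Int.cast : ℤ → ℂ)
  have e : (τᴴ * γᵀ + δᵀ) * (α * τ + β) - (τᴴ * αᵀ + βᵀ) * (γ * τ + δ) =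
      -(τᴴ * (αᵀ * γ - γᵀ * α) * τ) - τᴴ * (αᵀ * δ - γᵀ * β) + (δᵀ * α - βᵀ * γ) * τ
      - (βᵀ * δ - δᵀ * β) := by noncomm_ring
  rw [e, h1, h2, h3, h4]
  simp
  abel

lemma sub_conjTranspose_eq (hτ : τ.IsSymm) :
    τ - τᴴ = (2 * Complex.I) • (imPart τ).map (Complex.ofReal : ℝ → ℂ) := by
  ext i j
  simp only [Matrix.sub_apply, Matrix.conjTranspose_apply, Matrix.smul_apply, Matrix.map_apply,
    imPart, smul_eq_mul, hτ.apply i j]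
  rw [Complex.star_def, Complex.sub_conj]
  push_cast
  ring

lemma eq_zero_of_star_dotProduct_map_mulVec {Y : Matrix (Fin g) (Fin g) ℝ} (hY : Y.PosDef)
    {v : Fin g → ℂ} (h : star v ⬝ᵥ (Y.map (Complex.ofReal : ℝ → ℂ) *ᵥ v) = 0) : v = 0 := by
  set a : Fin g → ℝ := fun i => (v i).re
  set b : Fin g → ℝ := fun i => (v i).im
  have h1 : (star v ⬝ᵥ (Y.map (Complex.ofReal : ℝ → ℂ) *ᵥ v)).re = quadForm Y a + quadForm Y b := by
    simp only [dotProduct, Matrix.mulVec, Complex.re_sum, quadForm_eq_sum, Finset.mul_sum,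
      ← Finset.sum_add_distrib]
    refine Finset.sum_congr rfl fun i _ => Finset.sum_congr rfl fun j _ => ?_
    simp [a, b]
    ring
  rw [h] at h1
  have hnn : ∀ x : Fin g → ℝ, 0 ≤ quadForm Y x := fun x => by
    simpa [quadForm] using hY.posSemidef.dotProduct_mulVec_nonneg x
  have hz : ∀ x : Fin g → ℝ, quadForm Y x = 0 → x = 0 := fun x hx => by
    by_contra hne
    have := hY.dotProduct_mulVec_pos hne
    simp only [star_trivial] at this
    exact this.ne' hx
  have ha := hz a (by have := hnn a; have := hnn b; simp at h1; linarith)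
  have hb := hz b (by have := hnn a; have := hnn b; simp at h1; linarith)
  ext i
  exact Complex.ext (congrFun ha i) (congrFun hb i)

/-- On a kernel vector of `γ τ + δ` the previous identity makes the Hermitian form of `Im τ` vanish,
so the vector is zero. -/
lemma det_siegelDenom_ne_zero (hM : M ∈ symplecticGroup (Fin g) ℤ) (hτ : τ ∈ siegelHalfSpace g) :
    (siegelDenom M τ).det ≠ 0 := by
  intro h0
  obtain ⟨v, hv, hv0⟩ := Matrix.exists_mulVec_eq_zero_iff.mpr h0
  apply hv
  apply eq_zero_of_star_dotProduct_map_mulVec hτ.2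
  have h1 := siegelDenom_conjTranspose_mul (τ := τ) hM
  rw [sub_conjTranspose_eq hτ.1] at h1
  have h2 : star v ⬝ᵥ (((siegelDenom M τ)ᴴ * siegelNum M τ -
      (siegelNum M τ)ᴴ * siegelDenom M τ) *ᵥ v) = 0 := by
    rw [Matrix.sub_mulVec, ← Matrix.mulVec_mulVec, ← Matrix.mulVec_mulVec, hv0, dotProduct_sub,
      Matrix.dotProduct_mulVec (star v), ← Matrix.star_mulVec, hv0]
    simp
  rw [h1, Matrix.smul_mulVec, dotProduct_smul, smul_eq_mul] at h2
  exact (mul_eq_zero.mp h2).resolve_left (by simp)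

/-- The transformation law of the determinant of the imaginary part. -/
lemma det_imPart_siegelAction (hM : M ∈ symplecticGroup (Fin g) ℤ) (hτ : τ ∈ siegelHalfSpace g) :
    (imPart (siegelAction M τ)).det * Complex.normSq (siegelDenom M τ).det = (imPart τ).det := by
  have hu : IsUnit (siegelDenom M τ).det := (det_siegelDenom_ne_zero hM hτ).isUnit
  set A := siegelNum M τ with hA
  set Q := siegelDenom M τ with hQ
  have huT : IsUnit Qᵀ.det := by rwa [Matrix.det_transpose]
  have hsymm : (siegelAction M τ).IsSymm := by
    rw [siegelAction_eq, ← hA, ← hQ, Matrix.IsSymm, Matrix.transpose_mul,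
      Matrix.transpose_nonsing_inv]
    have h1 : Qᵀ * A = Aᵀ * Q := siegelDenom_transpose_mul hM hτ.1
    calc Qᵀ⁻¹ * Aᵀ = Qᵀ⁻¹ * (Aᵀ * Q) * Q⁻¹ := by
          rw [Matrix.mul_assoc, Matrix.mul_assoc, Matrix.mul_nonsing_inv _ hu, Matrix.mul_one]
      _ = A * Q⁻¹ := by
          rw [← h1, ← Matrix.mul_assoc, Matrix.nonsing_inv_mul _ huT, Matrix.one_mul]
  have h2 := siegelDenom_conjTranspose_mul (τ := τ) hM
  rw [← hA, ← hQ, sub_conjTranspose_eq hτ.1] at h2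
  have h3 := sub_conjTranspose_eq hsymm
  have h4 : siegelAction M τ * Q = A := by
    rw [siegelAction_eq, ← hA, ← hQ, Matrix.mul_assoc, Matrix.nonsing_inv_mul _ hu, Matrix.mul_one]
  have h5 : Qᴴ * (siegelAction M τ - (siegelAction M τ)ᴴ) * Q = Qᴴ * A - Aᴴ * Q := by
    rw [← h4, Matrix.conjTranspose_mul]
    noncomm_ring
  rw [h2, h3, Matrix.mul_smul, Matrix.smul_mul] at h5
  have h6 := smul_right_injective _ (by simp : (2 * Complex.I) ≠ 0) h5
  have h7 := congrArg Matrix.det h6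
  have hmap : ∀ B : Matrix (Fin g) (Fin g) ℝ, (B.map (Complex.ofReal : ℝ → ℂ)).det =
      ((B.det : ℝ) : ℂ) := fun B => (Complex.ofRealHom.map_det B).symm
  rw [Matrix.det_mul, Matrix.det_mul, Matrix.det_conjTranspose, hmap, hmap] at h7
  have h8 : (((imPart (siegelAction M τ)).det * Complex.normSq Q.det : ℝ) : ℂ) =
      ((imPart τ).det : ℂ) := by
    rw [← h7]
    push_cast
    rw [Complex.normSq_eq_conj_mul_self]
    simp only [Complex.star_def]
    ring
  exact_mod_cast h8

/-- Replaces the condition on the image point, which involves an inverse matrix, by one polynomial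
in the real and imaginary parts of `τ`. -/
lemma det_imPart_siegelAction_le_iff (hM : M ∈ symplecticGroup (Fin g) ℤ)
    (hτ : τ ∈ siegelHalfSpace g) :
    (imPart (siegelAction M τ)).det ≤ (imPart τ).det ↔
      1 ≤ Complex.normSq (siegelDenom M τ).det := by
  have h1 := det_imPart_siegelAction hM hτ
  have h2 : 0 < (imPart τ).det := hτ.2.det_pos
  have h3 : 0 < Complex.normSq (siegelDenom M τ).det :=
    Complex.normSq_pos.mpr (det_siegelDenom_ne_zero hM hτ)
  have h4 : 0 < (imPart (siegelAction M τ)).det := by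
    by_contra! h
    nlinarith
  rw [← h1]
  exact le_mul_iff_one_le_right h4

/-- The values of the symplectic form at the lower rows of a symplectic matrix. -/
noncomputable def lowerGram (M : Matrix (Fin g ⊕ Fin g) (Fin g ⊕ Fin g) ℤ)
    (P : Matrix (Fin g ⊕ Fin g) (Fin g ⊕ Fin g) ℝ) : Matrix (Fin g) (Fin g) ℝ :=
  Matrix.fromCols (M.toBlocks₂₂.map (Int.cast : ℤ → ℝ)) (M.toBlocks₂₁.map (Int.cast : ℤ → ℝ)) * P *
    (Matrix.fromCols (M.toBlocks₂₂.map (Int.cast : ℤ → ℝ))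
      (M.toBlocks₂₁.map (Int.cast : ℤ → ℝ)))ᵀ

/-- Write `Q = R + i S` with `R = γ X + δ` and `S = γ Y`. In `Q Y⁻¹ Qᴴ` the imaginary part cancels
because `γ δᵗ = δ γᵗ`, and what remains is the Gram matrix of the rows `(δ, γ)` under the symplectic
form. Then take determinants. -/
lemma normSq_det_siegelDenom (hM : M ∈ symplecticGroup (Fin g) ℤ) (hτ : τ ∈ siegelHalfSpace g) :
    Complex.normSq (siegelDenom M τ).det = (imPart τ).det *
      (lowerGram M (symplecticForm (τ.map Complex.re) (imPart τ))).det := by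
  set X := τ.map Complex.re with hX
  set Y := imPart τ with hY
  set γ := M.toBlocks₂₁.map (Int.cast : ℤ → ℝ) with hγ
  set δ := M.toBlocks₂₂.map (Int.cast : ℤ → ℝ) with hδ
  have hXT : Xᵀ = X := by
    ext i j
    simp [hX, hτ.1.apply i j]
  have hYT : Yᵀ = Y := by
    ext i j
    simp [hY, imPart, hτ.1.apply i j]
  have hYu : IsUnit Y.det := hτ.2.det_pos.ne'.isUnit
  have hGT : (Y⁻¹)ᵀ = Y⁻¹ := by rw [Matrix.transpose_nonsing_inv, hYT]
  have h1 : lowerGram M (symplecticForm X Y) =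
      (γ * X + δ) * Y⁻¹ * (γ * X + δ)ᵀ + γ * Y * γᵀ := by
    rw [lowerGram, ← hγ, ← hδ, symplecticForm, Matrix.fromCols_mul_fromBlocks,
      Matrix.transpose_fromCols, Matrix.fromCols_mul_fromRows]
    simp only [Matrix.transpose_add, Matrix.transpose_mul, hXT]
    noncomm_ring
  set φ := Complex.ofRealHom.mapMatrix (m := Fin g) with hφ
  have hφH : ∀ A : Matrix (Fin g) (Fin g) ℝ, (φ A)ᴴ = φ Aᵀ := fun A => by
    ext i j; simp [hφ]
  set R := γ * X + δ with hR
  set S := γ * Y with hS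
  have hQ : siegelDenom M τ = φ R + Complex.I • φ S := by
    have hτ' : τ = φ X + Complex.I • φ Y := by
      ext i j
      apply Complex.ext <;> simp [hφ, hX, hY, imPart]
    have hγ' : M.toBlocks₂₁.map (Int.cast : ℤ → ℂ) = φ γ := by ext i j; simp [hφ, hγ]
    have hδ' : M.toBlocks₂₂.map (Int.cast : ℤ → ℂ) = φ δ := by ext i j; simp [hφ, hδ]
    rw [siegelDenom, hγ', hδ', hR, hS, map_add, map_mul, map_mul]
    conv_lhs => rw [hτ']
    rw [Matrix.mul_add, Matrix.mul_smul]
    abel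
  have h2 : siegelDenom M τ * φ Y⁻¹ * (siegelDenom M τ)ᴴ =
      φ (lowerGram M (symplecticForm X Y)) := by
    have e1 : S * Y⁻¹ = γ := by rw [hS, Matrix.mul_assoc, Matrix.mul_nonsing_inv _ hYu,
      Matrix.mul_one]
    have e2 : Y⁻¹ * Sᵀ = γᵀ := by
      rw [hS, Matrix.transpose_mul, hYT, ← Matrix.mul_assoc, Matrix.nonsing_inv_mul _ hYu,
        Matrix.one_mul]
    have e3 : γ * Rᵀ = R * γᵀ := by
      have := symplectic_lower_blocks (R := ℝ) hM
      rw [← hγ, ← hδ] at this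
      rw [hR, Matrix.transpose_add, Matrix.transpose_mul, hXT, Matrix.mul_add, Matrix.add_mul, this,
        Matrix.mul_assoc]
    have e4 : (siegelDenom M τ)ᴴ = φ Rᵀ - Complex.I • φ Sᵀ := by
      rw [hQ, Matrix.conjTranspose_add, Matrix.conjTranspose_smul, hφH, hφH]
      simp [sub_eq_add_neg]
    have e5 : φ S * φ Y⁻¹ = φ γ := by rw [← map_mul, e1]
    have e6 : φ γ * φ Rᵀ = φ R * φ γᵀ := by rw [← map_mul, e3, map_mul]
    have e7 : φ Y⁻¹ * φ Sᵀ = φ γᵀ := by rw [← map_mul, e2]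
    have e8 : φ (γ * Y * γᵀ) = φ γ * φ Sᵀ := by
      rw [← map_mul, hS, Matrix.transpose_mul, hYT, Matrix.mul_assoc]
    have e9 : φ (R * Y⁻¹ * Rᵀ) = φ R * φ Y⁻¹ * φ Rᵀ := by rw [map_mul, map_mul]
    rw [h1, map_add, hS, e8, e9, e4, hQ]
    calc (φ R + Complex.I • φ S) * φ Y⁻¹ * (φ Rᵀ - Complex.I • φ Sᵀ)
        = φ R * φ Y⁻¹ * φ Rᵀ - Complex.I • (φ R * (φ Y⁻¹ * φ Sᵀ)) +
          Complex.I • (φ S * φ Y⁻¹ * φ Rᵀ) -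
          (Complex.I * Complex.I) • (φ S * φ Y⁻¹ * φ Sᵀ) := by
          simp only [Matrix.add_mul, Matrix.mul_sub, Matrix.smul_mul, Matrix.mul_smul, smul_add,
            Matrix.mul_assoc, smul_smul]
          abel
      _ = φ R * φ Y⁻¹ * φ Rᵀ + φ γ * φ Sᵀ := by
          rw [e7, e5, e6, Complex.I_mul_I]
          simp
  have hmap : ∀ B : Matrix (Fin g) (Fin g) ℝ, (φ B).det = ((B.det : ℝ) : ℂ) :=
    fun B => (Complex.ofRealHom.map_det B).symm
  have h3 := congrArg Matrix.det h2
  rw [Matrix.det_mul, Matrix.det_mul, Matrix.det_conjTranspose, hmap, hmap] at h3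
  have h4 : Complex.normSq (siegelDenom M τ).det * (Y⁻¹).det =
      (lowerGram M (symplecticForm X Y)).det := by
    have : ((Complex.normSq (siegelDenom M τ).det * (Y⁻¹).det : ℝ) : ℂ) =
        ((lowerGram M (symplecticForm X Y)).det : ℂ) := by
      rw [← h3]
      push_cast
      rw [Complex.normSq_eq_conj_mul_self]
      simp only [Complex.star_def]
      ring
    exact_mod_cast this
  have h5 : Y.det * (Y⁻¹).det = 1 := by
    rw [← Matrix.det_mul, Matrix.mul_nonsing_inv _ hYu, Matrix.det_one]
  rw [← h4]
  linear_combination -Complex.normSq (siegelDenom M τ).det * h5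

/-- The integral linear form on the lower rows of `M` given by `v`. -/
def lowerForm (M : Matrix (Fin g ⊕ Fin g) (Fin g ⊕ Fin g) ℤ) (v : Fin g ⊕ Fin g → ℤ) : Fin g → ℤ :=
  Matrix.fromCols M.toBlocks₂₂ M.toBlocks₂₁ *ᵥ v

lemma lowerGram_of_inCone {T : Finset (Fin g ⊕ Fin g → ℤ)}
    {P : Matrix (Fin g ⊕ Fin g) (Fin g ⊕ Fin g) ℝ} {t : (Fin g ⊕ Fin g → ℤ) → ℝ}
    (hP : ∀ i j, P i j = ∑ v ∈ T, t v * ((v i : ℝ) * v j))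
    (M : Matrix (Fin g ⊕ Fin g) (Fin g ⊕ Fin g) ℤ) :
    lowerGram M P =
      Matrix.of fun i j => ∑ v ∈ T, t v * ((lowerForm M v i : ℝ) * lowerForm M v j) := by
  set L := Matrix.fromCols (M.toBlocks₂₂.map (Int.cast : ℤ → ℝ))
    (M.toBlocks₂₁.map (Int.cast : ℤ → ℝ)) with hL
  have h1 : ∀ v i, (lowerForm M v i : ℝ) = ∑ k, L i k * v k := by
    intro v i
    simp only [lowerForm, Matrix.mulVec, dotProduct, Int.cast_sum, Int.cast_mul]
    refine Finset.sum_congr rfl fun k _ => ?_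
    rcases k with k | k <;> simp [hL]
  ext i j
  rw [Matrix.of_apply]
  calc lowerGram M P i j
      = ∑ l, ∑ k, ∑ v ∈ T, L i k * (t v * ((v k : ℝ) * v l)) * L j l := by
        simp only [lowerGram, ← hL, Matrix.mul_apply, Matrix.transpose_apply, hP,
          Finset.sum_mul, Finset.mul_sum]
    _ = ∑ k, ∑ v ∈ T, ∑ l, L i k * (t v * ((v k : ℝ) * v l)) * L j l := by
        rw [Finset.sum_comm]
        exact Finset.sum_congr rfl fun k _ => Finset.sum_comm
    _ = ∑ v ∈ T, ∑ k, ∑ l, L i k * (t v * ((v k : ℝ) * v l)) * L j l := Finset.sum_comm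
    _ = ∑ v ∈ T, t v * ((lowerForm M v i : ℝ) * lowerForm M v j) := by
        refine Finset.sum_congr rfl fun v _ => ?_
        rw [h1, h1, Finset.sum_mul_sum, Finset.mul_sum]
        refine Finset.sum_congr rfl fun k _ => ?_
        rw [Finset.mul_sum]
        exact Finset.sum_congr rfl fun l _ => by ring

/-- Finitely many symplectic matrices suffice in the definition of the Siegel fundamental set, as
long as the symplectic forms attached to the points are balanced. -/
theorem exists_finset_symplectic (g : ℕ) {c C : ℝ} (hc : 0 < c) (hC : 0 < C) :
    ∃ F : Finset (Matrix (Fin g ⊕ Fin g) (Fin g ⊕ Fin g) ℤ),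
      (∀ M ∈ F, M ∈ symplecticGroup (Fin g) ℤ) ∧ ∀ τ ∈ siegelHalfSpace g,
        Balanced c C (symplecticForm (τ.map Complex.re) (imPart τ)) →
        (∀ M ∈ F, 1 ≤ Complex.normSq (siegelDenom M τ).det) →
        ∀ M ∈ symplecticGroup (Fin g) ℤ, 1 ≤ Complex.normSq (siegelDenom M τ).det := by
  obtain ⟨T, hT⟩ := exists_cone (ι := Fin g ⊕ Fin g) hc hC
  -- By Cauchy–Binet, `g!` times the Gram determinant is a combination of the squares of these
  -- integers with nonnegative weights that depend on `τ` but not on `M`. So domination of the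
  -- integers implies the inequality at every `τ` at once.
  set e : Matrix (Fin g ⊕ Fin g) (Fin g ⊕ Fin g) ℤ → (Fin g → T) → ℕ := fun M f =>
    (Matrix.of fun i => lowerForm M (f i)).det.natAbs with he
  obtain ⟨F, hF, hdom⟩ := exists_finset_dominating e (symplecticGroup (Fin g) ℤ : Set _)
  refine ⟨F, hF, fun τ hτ hbal hall M hM => ?_⟩
  obtain ⟨M', hM', hle⟩ := hdom M hM
  refine (hall M' hM').trans ?_
  rw [normSq_det_siegelDenom hM hτ, normSq_det_siegelDenom (hF M' hM') hτ]
  refine mul_le_mul_of_nonneg_left ?_ hτ.2.det_pos.le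
  obtain ⟨t, ht, hP⟩ := hT _ hbal
  have hfac : (0 : ℝ) < (Fintype.card (Fin g)).factorial := by positivity
  refine le_of_mul_le_mul_left ?_ hfac
  rw [lowerGram_of_inCone hP, lowerGram_of_inCone hP,
    factorial_mul_det_sum T t fun v i => (lowerForm M' v i : ℝ),
    factorial_mul_det_sum T t fun v i => (lowerForm M v i : ℝ)]
  refine Finset.sum_le_sum fun f hf => mul_le_mul_of_nonneg_left ?_
    (Finset.prod_nonneg fun i _ => ht _)
  rw [Fintype.mem_piFinset] at hf
  have hcast : ∀ N : Matrix (Fin g ⊕ Fin g) (Fin g ⊕ Fin g) ℤ,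
      (Matrix.of fun i j => (lowerForm N (f i) j : ℝ)).det =
        (((Matrix.of fun i => lowerForm N (f i)).det : ℤ) : ℝ) := fun N =>
    ((Int.castRingHom ℝ).map_det (Matrix.of fun i => lowerForm N (f i))).symm
  have h1 := hle fun i => ⟨f i, hf i⟩
  have h2 : (Matrix.of fun i => lowerForm M' (f i)).det ^ 2 ≤
      (Matrix.of fun i => lowerForm M (f i)).det ^ 2 := Int.natAbs_le_iff_sq_le.mp h1
  have h3 := hcast M
  have h4 := hcast M'
  change (Matrix.of fun i j => (lowerForm M' (f i) j : ℝ)).det ^ 2 ≤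
    (Matrix.of fun i j => (lowerForm M (f i) j : ℝ)).det ^ 2
  rw [h3, h4]
  exact_mod_cast h2

/-- The symplectic matrix acting as `τ ↦ -1 / τ` on the `i`-th diagonal entry. -/
def partialInversion (i : Fin g) : Matrix (Fin g ⊕ Fin g) (Fin g ⊕ Fin g) ℤ :=
  Matrix.fromBlocks (1 - Matrix.single i i 1) (-Matrix.single i i 1) (Matrix.single i i 1)
    (1 - Matrix.single i i 1)

lemma partialInversion_mem (i : Fin g) : partialInversion i ∈ symplecticGroup (Fin g) ℤ := by
  refine SymplecticGroup.fromBlocks_mem_iff.mpr ⟨?_, ?_, ?_⟩ <;>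
  simp [Matrix.transpose_sub, Matrix.sub_mul, Matrix.mul_sub]

lemma det_siegelDenom_partialInversion (i : Fin g) (τ : Matrix (Fin g) (Fin g) ℂ) :
    (siegelDenom (partialInversion i) τ).det = τ i i := by
  have h : siegelDenom (partialInversion i) τ =
      (1 : Matrix (Fin g) (Fin g) ℂ).updateRow i (τ i) := by
    ext a b
    rw [Matrix.updateRow_apply]
    simp only [siegelDenom, partialInversion, Matrix.toBlocks_fromBlocks₂₁,
      Matrix.toBlocks_fromBlocks₂₂, Matrix.add_apply, Matrix.mul_apply, Matrix.map_apply,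
      Matrix.sub_apply, Matrix.single_apply, Matrix.one_apply]
    by_cases ha : a = i
    · subst ha
      by_cases hb : a = b <;> simp [hb]
    · have ha' : i ≠ a := Ne.symm ha
      by_cases hb : a = b
      · subst hb; simp [ha, ha']
      · simp [ha, ha', hb]
  rw [h, ← Matrix.cramer_transpose_apply, Matrix.transpose_one, Matrix.cramer_one]
  rfl

/-- Inverting only the `i`-th coordinate gives `|τ i i| ≥ 1`; with `|Re τ i i| ≤ 1/2` this yields
`(Im τ i i)² ≥ 3/4`. -/
lemma half_lt_im_of_mem_siegelFundamentalSet (hτ : τ ∈ siegelHalfSpace g)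
    (h : τ ∈ siegelFundamentalSet g) (i : Fin g) : 1 / 2 < imPart τ i i := by
  have h1 := (det_imPart_siegelAction_le_iff (partialInversion_mem i) hτ).mp
    (h.2.2.2 _ (partialInversion_mem i))
  rw [det_siegelDenom_partialInversion, Complex.normSq_apply] at h1
  have h2 := abs_le.mp (h.2.2.1 i i)
  have h3 : 0 < imPart τ i i := hτ.2.diag_pos
  change 1 ≤ _ + imPart τ i i * imPart τ i i at h1
  nlinarith [h2.1, h2.2]

end SiegelAction

/-! ### Analyticity of absolutely convergent series of monomials -/

section MonomialSeries

open Finset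

variable {ι α : Type*} [Fintype ι] (c : α → ℂ) (e : α → ι → ℕ)

/-- The total degree of the monomial with exponents `e n`. -/
def monomialDegree (n : α) : ℕ := ∑ j, e n j

/-- The monomial with exponents `e n`, as a multilinear map. -/
noncomputable def monomialMultilinear {d : ℕ} (n : {n // monomialDegree e n = d}) :
    ContinuousMultilinearMap ℂ (fun _ : Fin d => ι → ℂ) ℂ :=
  let idx : (Σ j, Fin (e n j)) ≃ Fin d :=
    -- The `d` arguments are distributed among the variables, with `e n j` of them assigned to
    -- variable `j`.
    Fintype.equivFinOfCardEq (by simpa [monomialDegree] using n.2)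
  (ContinuousMultilinearMap.mkPiAlgebra ℂ (Fin d) ℂ).compContinuousLinearMap
    fun i => ContinuousLinearMap.proj (idx.symm i).1

lemma monomialMultilinear_diag {d : ℕ} (n : {n // monomialDegree e n = d}) (y : ι → ℂ) :
    monomialMultilinear e n (fun _ => y) = ∏ j, y j ^ e n j := by
  simp only [monomialMultilinear, ContinuousMultilinearMap.compContinuousLinearMap_apply,
    ContinuousMultilinearMap.mkPiAlgebra_apply, ContinuousLinearMap.proj_apply]
  rw [Equiv.prod_comp (Fintype.equivFinOfCardEq _).symm fun σ : (Σ j, Fin (e n j)) => y σ.1,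
    Fintype.prod_sigma]
  simp

lemma norm_monomialMultilinear_le {d : ℕ} (n : {n // monomialDegree e n = d}) :
    ‖monomialMultilinear e n‖ ≤ 1 := by
  refine ContinuousMultilinearMap.opNorm_le_bound zero_le_one fun m => ?_
  simp only [monomialMultilinear, ContinuousMultilinearMap.compContinuousLinearMap_apply,
    ContinuousMultilinearMap.mkPiAlgebra_apply, ContinuousLinearMap.proj_apply, one_mul]
  rw [norm_prod]
  exact Finset.prod_le_prod (fun _ _ => norm_nonneg _) fun i _ => norm_le_pi_norm _ _

/-- The power series of a series of monomials. -/
noncomputable def monomialSeries : FormalMultilinearSeries ℂ (ι → ℂ) ℂ := fun d =>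
  ∑' n : {n // monomialDegree e n = d}, c n • monomialMultilinear e n

variable {c e} {ρ : ℝ}

lemma summable_norm_fiber (hρ : 0 < ρ)
    (hsum : Summable fun n => ‖c n‖ * ρ ^ monomialDegree e n) (d : ℕ) :
    Summable fun n : {n // monomialDegree e n = d} => ‖c n‖ := by
  have h1 := (hsum.comp_injective
    (Subtype.val_injective (p := fun n => monomialDegree e n = d))).mul_right (ρ ^ d)⁻¹
  refine h1.congr fun n => ?_
  have : ρ ^ d ≠ 0 := (pow_pos hρ d).ne'
  simp only [Function.comp, n.2]
  field_simp

lemma summable_smul_monomialMultilinear (hρ : 0 < ρ)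
    (hsum : Summable fun n => ‖c n‖ * ρ ^ monomialDegree e n) (d : ℕ) :
    Summable fun n : {n // monomialDegree e n = d} => ‖c n • monomialMultilinear e n‖ := by
  refine (summable_norm_fiber hρ hsum d).of_nonneg_of_le (fun _ => norm_nonneg _) fun n => ?_
  rw [norm_smul]
  exact mul_le_of_le_one_right (norm_nonneg _) (norm_monomialMultilinear_le e n)

lemma norm_monomialSeries_mul_le (hρ : 0 < ρ)
    (hsum : Summable fun n => ‖c n‖ * ρ ^ monomialDegree e n) (d : ℕ) :
    ‖monomialSeries c e d‖ * ρ ^ d ≤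
    ∑' n : {n // monomialDegree e n = d}, ‖c n‖ * ρ ^ monomialDegree e (n : α) := by
  have h1 : ‖monomialSeries c e d‖ ≤ ∑' n : {n // monomialDegree e n = d}, ‖c n‖ :=
    (norm_tsum_le_tsum_norm (summable_smul_monomialMultilinear hρ hsum d)).trans
      ((summable_smul_monomialMultilinear hρ hsum d).tsum_le_tsum (fun n => by
        rw [norm_smul]
        exact mul_le_of_le_one_right (norm_nonneg _) (norm_monomialMultilinear_le e n))
        (summable_norm_fiber hρ hsum d))
  refine (mul_le_mul_of_nonneg_right h1 (pow_pos hρ d).le).trans (le_of_eq ?_)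
  rw [← tsum_mul_right]
  exact tsum_congr fun n => by rw [n.2]

lemma monomialSeries_diag (hρ : 0 < ρ)
    (hsum : Summable fun n => ‖c n‖ * ρ ^ monomialDegree e n) (d : ℕ) (y : ι → ℂ) :
    monomialSeries c e d (fun _ => y) =
      ∑' n : {n // monomialDegree e n = d}, c n * ∏ j, y j ^ e n j := by
  have h := (summable_smul_monomialMultilinear hρ hsum d).of_norm
  have h2 := (ContinuousMultilinearMap.apply ℂ (fun _ : Fin d => ι → ℂ) ℂ fun _ => y).map_tsum h
  refine h2.trans (tsum_congr fun n => ?_)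
  simp [ContinuousMultilinearMap.apply, monomialMultilinear_diag]

lemma summable_monomials
    (hsum : Summable fun n => ‖c n‖ * ρ ^ monomialDegree e n) {y : ι → ℂ} (hy : ‖y‖ ≤ ρ) :
    Summable fun n => c n * ∏ j, y j ^ e n j := by
  refine Summable.of_norm (hsum.of_nonneg_of_le (fun _ => norm_nonneg _) fun n => ?_)
  rw [norm_mul, norm_prod]
  refine mul_le_mul_of_nonneg_left ?_ (norm_nonneg _)
  rw [monomialDegree, ← Finset.prod_pow_eq_pow_sum]
  refine Finset.prod_le_prod (fun _ _ => norm_nonneg _) fun j _ => ?_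
  rw [norm_pow]
  exact pow_le_pow_left₀ (norm_nonneg _) ((norm_le_pi_norm y j).trans hy) _

/-- A series of monomials which converges absolutely on a polydisc is analytic there. -/
theorem analyticOnNhd_tsum_monomial (hρ : 0 < ρ)
    (hsum : Summable fun n => ‖c n‖ * ρ ^ monomialDegree e n) :
    AnalyticOnNhd ℂ (fun y : ι → ℂ => ∑' n, c n * ∏ j, y j ^ e n j) (Metric.ball 0 ρ) := by
  -- Grouping the terms by total degree turns absolute summability into a summable majorant of
  -- `‖monomialSeries c e d‖ * ρ ^ d`, which gives the radius.
  have hσ : Summable fun x : (Σ d, {n // monomialDegree e n = d}) =>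
      ‖c x.2‖ * ρ ^ monomialDegree e (x.2 : α) :=
    ((Equiv.sigmaFiberEquiv (monomialDegree e)).summable_iff).mpr hsum
  have hrad : ENNReal.ofReal ρ ≤ (monomialSeries c e).radius := by
    have h := (monomialSeries c e).le_radius_of_summable (r := ⟨ρ, hρ.le⟩)
      ((hσ.sigma).of_nonneg_of_le (fun d => by positivity)
        fun d => norm_monomialSeries_mul_le hρ hsum d)
    rwa [ENNReal.ofReal_eq_coe_nnreal hρ.le]
  have hps : HasFPowerSeriesOnBall (fun y : ι → ℂ => ∑' n, c n * ∏ j, y j ^ e n j)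
      (monomialSeries c e) 0 (ENNReal.ofReal ρ) := by
    refine ⟨hrad, by simpa using hρ, fun {y} hy => ?_⟩
    rw [Metric.eball_ofReal, mem_ball_zero_iff] at hy
    have hs := summable_monomials hsum hy.le
    have hs' := (Equiv.hasSum_iff (f := fun n => c n * ∏ j, y j ^ e n j)
      (Equiv.sigmaFiberEquiv (monomialDegree e))).mpr hs.hasSum
    have hfib := hs'.sigma fun d => (hs'.summable.sigma_factor d).hasSum
    rw [zero_add]
    refine hfib.congr_fun fun d => ?_
    rw [monomialSeries_diag hρ hsum d y]
    rfl
  have := hps.analyticOnNhd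
  rwa [Metric.eball_ofReal] at this

end MonomialSeries

/-! ### Convergence and analyticity of the theta series -/

section GaussianSum

/-- These are the norms of the terms of the Jacobi theta series at `z = 0`, `τ = i δ / π`. -/
lemma summable_exp_neg_mul_sq {δ : ℝ} (hδ : 0 < δ) :
    Summable fun n : ℤ => Real.exp (-(δ * (n : ℝ) ^ 2)) := by
  have h : Summable fun n : ℤ => ‖jacobiTheta₂_term n 0 (Complex.I * (δ / Real.pi : ℝ))‖ :=
    ((summable_jacobiTheta₂_term_iff 0 _).mpr (by simp; positivity)).norm
  refine h.congr fun n => ?_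
  rw [norm_jacobiTheta₂_term]
  congr 1
  have := Real.pi_pos
  simp
  field_simp

lemma summable_exp_neg_mul_sum_sq (g : ℕ) {δ : ℝ} (hδ : 0 < δ) :
    Summable fun n : Fin g → ℤ => Real.exp (-(δ * ∑ i, (n i : ℝ) ^ 2)) := by
  induction g with
  | zero => exact .of_finite
  | succ g ih =>
    have h := (summable_exp_neg_mul_sq hδ).mul_of_nonneg ih (fun _ => (Real.exp_pos _).le)
      fun _ => (Real.exp_pos _).le
    refine ((Fin.consEquiv fun _ : Fin (g + 1) => ℤ).summable_iff).mp (h.congr fun x => ?_)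
    simp only [Function.comp, Fin.consEquiv_apply, Fin.sum_univ_succ, Fin.cons_zero, Fin.cons_succ,
      ← Real.exp_add]
    congr 1
    ring

end GaussianSum

section ThetaSeries

variable {g : ℕ}

/-- The vector `(n, 1)`. -/
def affineVector (n : Fin g → ℤ) : Fin g ⊕ Unit → ℤ := Sum.elim n fun _ => 1

/-- A series in the variables `q_v`, `v ∈ T`, and `x_ij`, which gives the theta function after
substituting exponentials of real linear forms of the imaginary part for the `q_v`. -/
noncomputable def thetaSeries (c : ℝ) (T : Finset (Fin g ⊕ Unit → ℤ))
    (w : T ⊕ ((Fin g ⊕ Unit) × (Fin g ⊕ Unit)) → ℝ) : ℂ :=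
  ∑' n : Fin g → ℤ, (Real.exp (-(Real.pi * c * ∑ i, (n i : ℝ) ^ 2)) : ℂ) *
    ((∏ v : T, (w (Sum.inl v) : ℂ) ^ ((affineVector n ⬝ᵥ v.1).natAbs ^ 2)) *
      Complex.exp (Real.pi * Complex.I * ∑ p : (Fin g ⊕ Unit) × (Fin g ⊕ Unit),
        (w (Sum.inr p) : ℂ) * ((affineVector n p.1 * affineVector n p.2 : ℤ) : ℂ)))

/-- The exponents of the theta function as a series of monomials. -/
def thetaExponent (T : Finset (Fin g ⊕ Unit → ℤ)) (n : Fin g → ℤ) :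
    T ⊕ (((Fin g ⊕ Unit) × (Fin g ⊕ Unit)) ⊕ ((Fin g ⊕ Unit) × (Fin g ⊕ Unit))) → ℕ :=
  Sum.elim (fun v => (affineVector n ⬝ᵥ v.1).natAbs ^ 2)
    (Sum.elim (fun p => (affineVector n p.1 * affineVector n p.2).toNat)
      fun p => (-(affineVector n p.1 * affineVector n p.2)).toNat)

lemma sum_affineVector_sq (n : Fin g → ℤ) :
    ∑ a, affineVector n a ^ 2 = ∑ i, n i ^ 2 + 1 := by
  simp [affineVector]

/-- Exponents grow at most quadratically in `n`, by Cauchy–Schwarz for `(v·a)²` and the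
arithmetic–geometric mean for products of coordinates. A Gaussian can therefore absorb them. -/
lemma exists_monomialDegree_thetaExponent_le (T : Finset (Fin g ⊕ Unit → ℤ)) :
    ∃ D : ℝ, 0 < D ∧ ∀ n : Fin g → ℤ,
      (monomialDegree (thetaExponent T) n : ℝ) ≤ D * (∑ i, (n i : ℝ) ^ 2 + 1) := by
  have hq : ∀ (n : Fin g → ℤ) a, affineVector n a ^ 2 ≤ ∑ i, n i ^ 2 + 1 := fun n a => by
    rw [← sum_affineVector_sq]
    exact Finset.single_le_sum (f := fun a => affineVector n a ^ 2) (fun _ _ => sq_nonneg _)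
      (Finset.mem_univ a)
  have hab : ∀ (n : Fin g → ℤ) a b, |affineVector n a * affineVector n b| ≤ ∑ i, n i ^ 2 + 1 := by
    intro n a b
    have h1 := hq n a
    have h2 := hq n b
    rw [abs_mul]
    nlinarith [sq_nonneg (|affineVector n a| - |affineVector n b|), sq_abs (affineVector n a),
      sq_abs (affineVector n b)]
  have key : ∀ j, ∃ D : ℤ, 0 ≤ D ∧ ∀ n, (thetaExponent T n j : ℤ) ≤ D * (∑ i, n i ^ 2 + 1) := by
    rintro (v | p | p)
    · refine ⟨∑ a, v.1 a ^ 2, Finset.sum_nonneg fun _ _ => sq_nonneg _, fun n => ?_⟩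
      simp only [thetaExponent, Sum.elim_inl, Nat.cast_pow, Int.natCast_natAbs, sq_abs]
      rw [← sum_affineVector_sq, mul_comm]
      exact Finset.sum_mul_sq_le_sq_mul_sq _ _ _
    · refine ⟨1, zero_le_one, fun n => ?_⟩
      simp only [thetaExponent, Sum.elim_inl, Sum.elim_inr, Int.toNat_eq_max, one_mul]
      have := hab n p.1 p.2
      have := le_abs_self (affineVector n p.1 * affineVector n p.2)
      have : 0 ≤ ∑ i, n i ^ 2 := Finset.sum_nonneg fun _ _ => sq_nonneg _
      exact max_le (by linarith) (by linarith)
    · refine ⟨1, zero_le_one, fun n => ?_⟩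
      simp only [thetaExponent, Sum.elim_inr, Int.toNat_eq_max, one_mul]
      have := hab n p.1 p.2
      have := neg_le_abs (affineVector n p.1 * affineVector n p.2)
      have : 0 ≤ ∑ i, n i ^ 2 := Finset.sum_nonneg fun _ _ => sq_nonneg _
      exact max_le (by linarith) (by linarith)
  choose D hD0 hD using key
  have hDs : 0 ≤ ∑ j, D j := Finset.sum_nonneg fun j _ => hD0 j
  refine ⟨(∑ j, D j : ℤ) + 1, by have : (0 : ℝ) ≤ ((∑ j, D j : ℤ) : ℝ) := by exact_mod_cast hDs
                                 linarith, fun n => ?_⟩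
  have h1 : (monomialDegree (thetaExponent T) n : ℤ) ≤ (∑ j, D j) * (∑ i, n i ^ 2 + 1) := by
    rw [monomialDegree, Nat.cast_sum, Finset.sum_mul]
    exact Finset.sum_le_sum fun j _ => hD j n
  have h2 : (monomialDegree (thetaExponent T) n : ℝ) ≤
      ((∑ j, D j : ℤ) : ℝ) * (∑ i, (n i : ℝ) ^ 2 + 1) := by exact_mod_cast h1
  have h3 : 0 ≤ ∑ i, (n i : ℝ) ^ 2 := Finset.sum_nonneg fun _ _ => sq_nonneg _
  linarith

/-- With `ρ = exp (π c / (2 D))` the monomials consume half of the Gaussian decay. A radius strictly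
above `1` is needed since the `q_v` may equal `1` and the phases have modulus `1`. -/
lemma exists_summable_theta {c : ℝ} (hc : 0 < c) (T : Finset (Fin g ⊕ Unit → ℤ)) :
    ∃ ρ : ℝ, 1 < ρ ∧ Summable fun n : Fin g → ℤ =>
      ‖(Real.exp (-(Real.pi * c * ∑ i, (n i : ℝ) ^ 2)) : ℂ)‖ *
        ρ ^ monomialDegree (thetaExponent T) n := by
  obtain ⟨D, hD0, hD⟩ := exists_monomialDegree_thetaExponent_le T
  have hπ := Real.pi_pos
  set η : ℝ := Real.pi * c / (2 * D) with hη
  have hη0 : 0 < η := by positivity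
  refine ⟨Real.exp η, Real.one_lt_exp_iff.mpr hη0, ?_⟩
  have h := (summable_exp_neg_mul_sum_sq g (δ := Real.pi * c / 2) (by positivity)).mul_left
    (Real.exp (Real.pi * c / 2))
  refine h.of_nonneg_of_le (fun n => by positivity) fun n => ?_
  rw [Complex.norm_real, Real.norm_of_nonneg (Real.exp_pos _).le, ← Real.exp_nat_mul,
    ← Real.exp_add, ← Real.exp_add, Real.exp_le_exp]
  have h1 := mul_le_mul_of_nonneg_right (hD n) hη0.le
  have h2 : D * (∑ i, (n i : ℝ) ^ 2 + 1) * η = Real.pi * c / 2 * (∑ i, (n i : ℝ) ^ 2 + 1) := by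
    rw [hη]; field_simp
  rw [h2] at h1
  linarith

/-- The substitution which turns the theta series into a series of monomials. -/
noncomputable def thetaSubst (T : Finset (Fin g ⊕ Unit → ℤ))
    (w : T ⊕ ((Fin g ⊕ Unit) × (Fin g ⊕ Unit)) → ℝ) :
    T ⊕ (((Fin g ⊕ Unit) × (Fin g ⊕ Unit)) ⊕ ((Fin g ⊕ Unit) × (Fin g ⊕ Unit))) → ℂ :=
  Sum.elim (fun v => (w (Sum.inl v) : ℂ))
    (Sum.elim (fun p => Complex.exp (Real.pi * Complex.I * (w (Sum.inr p) : ℂ)))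
      fun p => Complex.exp (-(Real.pi * Complex.I * (w (Sum.inr p) : ℂ))))

/-- The reason for two variables per pair in `thetaSubst`: integral powers of a phase, possibly
negative, become monomials with natural exponents in the phase and its inverse. -/
lemma exp_pow_toNat_mul (x : ℂ) (k : ℤ) :
    Complex.exp x ^ k.toNat * Complex.exp (-x) ^ (-k).toNat = Complex.exp (x * k) := by
  rw [← Complex.exp_nat_mul, ← Complex.exp_nat_mul, ← Complex.exp_add]
  congr 1
  have h : ((k.toNat : ℤ) : ℂ) - (((-k).toNat : ℤ) : ℂ) = k := by
    rw [← Int.cast_sub, Int.toNat_sub_toNat_neg]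
  push_cast at h
  linear_combination x * h

lemma thetaSeries_eq (c : ℝ) (T : Finset (Fin g ⊕ Unit → ℤ)) :
    thetaSeries c T = fun w => ∑' n : Fin g → ℤ,
      (Real.exp (-(Real.pi * c * ∑ i, (n i : ℝ) ^ 2)) : ℂ) *
        ∏ j, thetaSubst T w j ^ thetaExponent T n j := by
  ext w
  refine tsum_congr fun n => ?_
  congr 1
  simp only [Fintype.prod_sum_type, thetaSubst, thetaExponent, Sum.elim_inl, Sum.elim_inr]
  congr 1
  rw [← Finset.prod_mul_distrib, Finset.mul_sum, Complex.exp_sum]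
  refine Finset.prod_congr rfl fun p _ => ?_
  rw [exp_pow_toNat_mul]
  congr 1
  ring

lemma analyticAt_thetaSubst (T : Finset (Fin g ⊕ Unit → ℤ))
    (w : T ⊕ ((Fin g ⊕ Unit) × (Fin g ⊕ Unit)) → ℝ) : AnalyticAt ℝ (thetaSubst T) w := by
  have hproj : ∀ j, AnalyticAt ℝ (fun w : T ⊕ ((Fin g ⊕ Unit) × (Fin g ⊕ Unit)) → ℝ =>
      (w j : ℂ)) w := fun j =>
    (Complex.ofRealCLM.comp (ContinuousLinearMap.proj (R := ℝ)
      (φ := fun _ : T ⊕ ((Fin g ⊕ Unit) × (Fin g ⊕ Unit)) => ℝ) j)).analyticAt w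
  have hexp : ∀ x : ℂ, AnalyticAt ℝ Complex.exp x := fun x =>
    (analyticAt_cexp (z := x)).restrictScalars
  rw [analyticAt_pi_iff]
  rintro (v | p | p)
  · exact hproj _
  · exact (hexp _).fun_comp (analyticAt_const.mul (hproj _))
  · exact (hexp _).fun_comp (analyticAt_const.mul (hproj _)).neg

/-- The theta series is real analytic. -/
theorem analyticOnNhd_thetaSeries {c : ℝ} (hc : 0 < c) (T : Finset (Fin g ⊕ Unit → ℤ)) :
    AnalyticOnNhd ℝ (thetaSeries c T) {w | ∀ v, |w (Sum.inl v)| ≤ 1} := by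
  obtain ⟨ρ, hρ, hsum⟩ := exists_summable_theta hc T
  have hF := analyticOnNhd_tsum_monomial (zero_lt_one.trans hρ) hsum
  have heq := thetaSeries_eq c T
  generalize hG : (fun y : T ⊕ (((Fin g ⊕ Unit) × (Fin g ⊕ Unit)) ⊕
    ((Fin g ⊕ Unit) × (Fin g ⊕ Unit))) → ℂ => ∑' n : Fin g → ℤ,
      (Real.exp (-(Real.pi * c * ∑ i, (n i : ℝ) ^ 2)) : ℂ) *
        ∏ j, y j ^ thetaExponent T n j) = G at hF
  have hcomp : thetaSeries c T = G ∘ thetaSubst T := by rw [heq, ← hG]; rfl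
  intro w hw
  -- For real arguments the phases have modulus `1`, so the `x_ij` are unrestricted and only the
  -- `q_v` need a bound.
  have hmem : thetaSubst T w ∈ Metric.ball 0 ρ := by
    rw [mem_ball_zero_iff]
    refine lt_of_le_of_lt ((pi_norm_le_iff_of_nonneg zero_le_one).mpr ?_) hρ
    rintro (v | p | p)
    · simpa [thetaSubst] using hw v
    · simp only [thetaSubst, Sum.elim_inr, Sum.elim_inl]
      rw [Complex.norm_exp]
      simp
    · simp only [thetaSubst, Sum.elim_inr]
      rw [Complex.norm_exp]
      simp
  rw [hcomp]
  exact (hF _ hmem).restrictScalars.comp (analyticAt_thetaSubst T w)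

end ThetaSeries

/-! ### Theta as a value of the theta series at a decomposition of the extended matrix -/

section Extension

variable {g : ℕ}

/-- The matrix of the inhomogeneous quadratic polynomial `ᵗn Y n + 2 ᵗw n + l`. -/
def extendMatrix (Y : Matrix (Fin g) (Fin g) ℝ) (w : Fin g → ℝ) (l : ℝ) :
    Matrix (Fin g ⊕ Unit) (Fin g ⊕ Unit) ℝ :=
  Matrix.fromBlocks Y (Matrix.of fun i _ => w i) (Matrix.of fun _ i => w i)
    (Matrix.of fun _ _ => l)

lemma quadForm_extendMatrix (Y : Matrix (Fin g) (Fin g) ℝ) (w : Fin g → ℝ) (l : ℝ)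
    (v : Fin g ⊕ Unit → ℝ) : quadForm (extendMatrix Y w l) v =
      quadForm Y (v ∘ Sum.inl) + 2 * v (Sum.inr ()) * (w ⬝ᵥ (v ∘ Sum.inl)) +
        l * v (Sum.inr ()) ^ 2 := by
  simp only [quadForm_eq_sum, extendMatrix, Fintype.sum_sum_type, Finset.univ_unique,
    Finset.sum_singleton, PUnit.default_eq_unit, Matrix.fromBlocks_apply₁₁,
    Matrix.fromBlocks_apply₁₂, Matrix.fromBlocks_apply₂₁, Matrix.fromBlocks_apply₂₂,
    Matrix.of_apply, Finset.sum_add_distrib, dotProduct, Function.comp, Finset.mul_sum]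
  rw [add_assoc, add_assoc, ← add_assoc (∑ i, w i * _), ← Finset.sum_add_distrib]
  congr 1
  congr 1
  · exact Finset.sum_congr rfl fun i _ => by ring
  · ring

lemma quadForm_sub_smul_one (Y : Matrix (Fin g) (Fin g) ℝ) (c : ℝ) (v : Fin g → ℝ) :
    quadForm (Y - c • 1) v = quadForm Y v - c * ∑ i, v i ^ 2 := by
  rw [quadForm, Matrix.sub_mulVec, dotProduct_sub, Matrix.smul_mulVec, dotProduct_smul,
    Matrix.one_mulVec]
  simp [quadForm, dotProduct, sq]

lemma quadForm_eq_sum_sq {ι : Type*} [Fintype ι] {T : Finset (ι → ℤ)} {β : Matrix ι ι ℝ}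
    {t : (ι → ℤ) → ℝ} (h : ∀ i j, β i j = ∑ v ∈ T, t v * ((v i : ℝ) * v j)) (a : ι → ℤ) :
    quadForm β (fun i => (a i : ℝ)) = ∑ v ∈ T, t v * ((a ⬝ᵥ v : ℤ) : ℝ) ^ 2 := by
  simp only [quadForm_eq_sum, h, Finset.sum_mul]
  rw [Finset.sum_congr rfl fun i _ => Finset.sum_comm, Finset.sum_comm]
  refine Finset.sum_congr rfl fun v _ => ?_
  simp only [dotProduct, Int.cast_sum, Int.cast_mul]
  rw [sq, Finset.sum_mul_sum, Finset.mul_sum]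
  simp only [Finset.mul_sum]
  exact Finset.sum_congr rfl fun i _ => Finset.sum_congr rfl fun j _ => by ring

/-- The theta function as a value of the theta series. -/
theorem riemannTheta_eq_thetaSeries {z : Fin g → ℂ} {τ : Matrix (Fin g) (Fin g) ℂ} {c l : ℝ}
    {T : Finset (Fin g ⊕ Unit → ℤ)} {t : (Fin g ⊕ Unit → ℤ) → ℝ}
    (h : ∀ i j, extendMatrix (imPart τ - c • 1) (fun i => (z i).im) l i j =
      ∑ v ∈ T, t v * ((v i : ℝ) * v j)) :
    riemannTheta z τ = (Real.exp (Real.pi * l) : ℂ) * thetaSeries c T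
      (Sum.elim (fun v => Real.exp (-(Real.pi * t v)))
        fun p => extendMatrix (τ.map Complex.re) (fun i => (z i).re) 0 p.1 p.2) := by
  rw [riemannTheta, thetaSeries, ← tsum_mul_left]
  refine tsum_congr fun n => ?_
  set m : Fin g → ℝ := fun i => (n i : ℝ) with hm
  have hcast : (fun a => (affineVector n a : ℝ)) = Sum.elim m fun _ => 1 := by
    ext a
    rcases a with a | a <;> simp [affineVector, hm]
  have hre : ∑ p : (Fin g ⊕ Unit) × (Fin g ⊕ Unit),
      extendMatrix (τ.map Complex.re) (fun i => (z i).re) 0 p.1 p.2 *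
        ((affineVector n p.1 * affineVector n p.2 : ℤ) : ℝ) =
      quadForm (τ.map Complex.re) m + 2 * ((fun i => (z i).re) ⬝ᵥ m) := by
    have e1 := quadForm_extendMatrix (τ.map Complex.re) (fun i => (z i).re) 0
      (fun a => (affineVector n a : ℝ))
    rw [quadForm_eq_sum, hcast, ← hcast] at e1
    rw [Fintype.sum_prod_type]
    push_cast
    rw [e1, hcast]
    simp [affineVector, Function.comp_def, hm]
  -- The decomposed form differs from the true exponent by `- c |n|² + l`; the Gaussian coefficients
  -- of `thetaSeries` and the prefactor `exp (π l)` compensate for exactly this.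
  have him : ∑ v ∈ T, t v * ((affineVector n ⬝ᵥ v : ℤ) : ℝ) ^ 2 =
      quadForm (imPart τ) m - c * ∑ i, (n i : ℝ) ^ 2 + 2 * ((fun i => (z i).im) ⬝ᵥ m) + l := by
    have e1 := quadForm_extendMatrix (imPart τ - c • 1) (fun i => (z i).im) l
      (fun a => (affineVector n a : ℝ))
    rw [← quadForm_eq_sum_sq h, e1]
    have e2 := quadForm_sub_smul_one (imPart τ) c m
    simp only [hm] at e2
    rw [← e2]
    simp [affineVector, Function.comp_def, hm]
  have hq : ∏ v : T, ((Real.exp (-(Real.pi * t v)) : ℝ) : ℂ) ^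
      ((affineVector n ⬝ᵥ v.1).natAbs ^ 2) =
      Complex.exp (-(Real.pi * (∑ v ∈ T, t v * ((affineVector n ⬝ᵥ v : ℤ) : ℝ) ^ 2 : ℝ))) := by
    rw [Finset.prod_coe_sort T fun v => ((Real.exp (-(Real.pi * t v)) : ℝ) : ℂ) ^
      ((affineVector n ⬝ᵥ v).natAbs ^ 2)]
    push_cast
    rw [Finset.mul_sum, ← Finset.sum_neg_distrib, Complex.exp_sum]
    refine Finset.prod_congr rfl fun v _ => ?_
    rw [← Complex.exp_nat_mul]
    congr 1
    have : (((affineVector n ⬝ᵥ v).natAbs ^ 2 : ℕ) : ℂ) = ((affineVector n ⬝ᵥ v : ℤ) : ℂ) ^ 2 := by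
      have : (((affineVector n ⬝ᵥ v).natAbs ^ 2 : ℕ) : ℤ) = (affineVector n ⬝ᵥ v) ^ 2 := by
        simp
      rw [← Int.cast_pow, ← this, Int.cast_natCast]
    rw [this]
    ring
  simp only [Sum.elim_inl, Sum.elim_inr]
  rw [hq, him]
  have hre' := congrArg (Complex.ofReal : ℝ → ℂ) hre
  push_cast at hre'
  push_cast
  rw [hre', ← Complex.exp_add, ← Complex.exp_add, ← Complex.exp_add]
  congr 1
  have hτ : (fun i => (n i : ℂ)) ⬝ᵥ (τ *ᵥ fun i => (n i : ℂ)) =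
      (quadForm (τ.map Complex.re) m : ℂ) + Complex.I * (quadForm (imPart τ) m : ℂ) := by
    simp only [quadForm, dotProduct, Matrix.mulVec, hm, imPart]
    push_cast
    simp only [Finset.mul_sum, ← Finset.sum_add_distrib]
    refine Finset.sum_congr rfl fun i _ => Finset.sum_congr rfl fun j _ => ?_
    conv_lhs => rw [← Complex.re_add_im (τ i j)]
    simp only [Matrix.map_apply]
    ring
  have hz : (fun i => (n i : ℂ)) ⬝ᵥ z =
      (((fun i => (z i).re) ⬝ᵥ m : ℝ) : ℂ) + Complex.I * (((fun i => (z i).im) ⬝ᵥ m : ℝ) : ℂ) := by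
    simp only [dotProduct, hm]
    push_cast
    simp only [Finset.mul_sum, ← Finset.sum_add_distrib]
    refine Finset.sum_congr rfl fun i _ => ?_
    conv_lhs => rw [← Complex.re_add_im (z i)]
    ring
  rw [hτ, hz]
  linear_combination (Real.pi * ((quadForm (imPart τ) m : ℂ) +
    2 * (((fun i => (z i).im) ⬝ᵥ m : ℝ) : ℂ))) * Complex.I_sq

end Extension

/-- Extending a balanced matrix by a vector dominated by the diagonal. -/
lemma exists_balanced_extendMatrix (g : ℕ) {c C K : ℝ} (hc : 0 < c) (hC : 0 < C) (hK : 0 < K) :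
    ∃ c₁ l c' C' : ℝ, 0 < c₁ ∧ 0 < c' ∧ 0 < C' ∧
      ∀ (Y : Matrix (Fin g) (Fin g) ℝ) (w : Fin g → ℝ), Balanced c C Y →
        (∀ i, 1 / 2 ≤ Y i i) → (∀ i, |w i| ≤ K * Y i i) →
          Balanced c' C' (extendMatrix (Y - c₁ • 1) w (l * (1 + ∑ i, Y i i))) := by
  -- Budget for the lower bound: `c₁ ≤ c / 4` and `Y i i ≥ 1 / 2` spend at most `c / 2` of `c`, and
  -- the cross term spends `c / 4` more together with `4 K² / c` times `s² ∑ Y i i`. The latter is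
  -- why the corner entry scales with the trace, and the `+ 1` in `l` leaves `S * s ^ 2` over. The
  -- bound `c₁ ≤ 1 / 4` keeps `Y i i - c₁ ≥ Y i i / 2`.
  set l : ℝ := 4 * K ^ 2 / c + 1 with hl
  have hlpos : 0 < l := by positivity
  set c₁ : ℝ := min (c / 4) (1 / 4) with hc₁
  have hc₁pos : 0 < c₁ := by positivity
  refine ⟨c₁, l, min (c / 4) (1 / l), 2 * C + 2 * K + K / l + 1, hc₁pos, by positivity,
    by positivity, fun Y w hY hY0 hw => ?_⟩
  set S : ℝ := 1 + ∑ i, Y i i with hS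
  have hsum : 0 ≤ ∑ i, Y i i := Finset.sum_nonneg fun i _ => (hY.pos i).le
  have hS1 : 1 ≤ S := by linarith
  have hYS : ∀ i, Y i i ≤ S := fun i => by
    have := Finset.single_le_sum (f := fun i => Y i i) (fun j _ => (hY.pos j).le)
      (Finset.mem_univ i)
    linarith
  have hdiag : ∀ i, (Y - c₁ • (1 : Matrix (Fin g) (Fin g) ℝ)) i i = Y i i - c₁ := fun i => by simp
  have hoff : ∀ i j, i ≠ j → (Y - c₁ • (1 : Matrix (Fin g) (Fin g) ℝ)) i j = Y i j :=
    fun i j hij => by simp [hij]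
  have hc₁le : c₁ ≤ 1 / 4 := min_le_right _ _
  have hhalf : ∀ i, Y i i ≤ 2 * (Y i i - c₁) := fun i => by have := hY0 i; linarith
  have hlS : 0 < l * S := by positivity
  refine ⟨?_, ?_, ?_, fun v => ?_⟩
  · rintro (i | i) (j | j)
    · by_cases hij : i = j
      · rw [hij]
      · simp only [extendMatrix, Matrix.fromBlocks_apply₁₁]
        rw [hoff i j hij, hoff j i (Ne.symm hij), hY.symm]
    · rfl
    · rfl
    · rfl
  · rintro (i | i)
    · simp only [extendMatrix, Matrix.fromBlocks_apply₁₁, hdiag]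
      have := hhalf i
      have := hY.pos i
      linarith
    · exact hlS
  · rintro (i | i)
    · have hpos : 0 < Y i i - c₁ := by
        have := hhalf i
        have := hY.pos i
        linarith
      have key : ∀ x a : ℝ, 0 ≤ a → |x| ≤ a * Y i i → 2 * a ≤ 2 * C + 2 * K + K / l + 1 →
          |x| ≤ (2 * C + 2 * K + K / l + 1) * (Y i i - c₁) := fun x a ha hx hle => by
        calc |x| ≤ a * (2 * (Y i i - c₁)) := hx.trans (mul_le_mul_of_nonneg_left (hhalf i) ha)
          _ = 2 * a * (Y i i - c₁) := by ring
          _ ≤ _ := mul_le_mul_of_nonneg_right hle hpos.le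
      have hKl : 0 ≤ K / l := by positivity
      rintro (j | j)
      · simp only [extendMatrix, Matrix.fromBlocks_apply₁₁, hdiag]
        by_cases hij : i = j
        · subst hij
          rw [hdiag, abs_of_pos hpos]
          exact le_mul_of_one_le_left hpos.le (by linarith)
        · rw [hoff i j hij]
          exact key _ C hC.le (hY.abs_entry_le i j) (by linarith)
      · simp only [extendMatrix, Matrix.fromBlocks_apply₁₁, Matrix.fromBlocks_apply₁₂, hdiag,
          Matrix.of_apply]
        exact key _ K hK.le (hw i) (by linarith)
    · rintro (j | j)
      · simp only [extendMatrix, Matrix.fromBlocks_apply₂₁, Matrix.fromBlocks_apply₂₂,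
          Matrix.of_apply]
        calc |w j| ≤ K * S := (hw j).trans (mul_le_mul_of_nonneg_left (hYS j) hK.le)
          _ = K / l * (l * S) := by field_simp
          _ ≤ _ := mul_le_mul_of_nonneg_right (by linarith) hlS.le
      · simp only [extendMatrix, Matrix.fromBlocks_apply₂₂, Matrix.of_apply, abs_of_pos hlS]
        have hKl : 0 ≤ K / l := by positivity
        exact le_mul_of_one_le_left hlS.le (by linarith)
  · rw [quadForm_extendMatrix, quadForm_sub_smul_one, Fintype.sum_sum_type]
    simp only [Finset.univ_unique, Finset.sum_singleton, PUnit.default_eq_unit, extendMatrix,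
      Matrix.fromBlocks_apply₁₁, Matrix.fromBlocks_apply₂₂, Matrix.of_apply, hdiag, Function.comp]
    set s : ℝ := v (Sum.inr ()) with hs
    set u : Fin g → ℝ := fun i => v (Sum.inl i) with hu
    set E : ℝ := ∑ i, Y i i * u i ^ 2 with hE
    have hE0 : 0 ≤ E := Finset.sum_nonneg fun i _ => mul_nonneg (hY.pos i).le (sq_nonneg _)
    have h1 : c * E ≤ quadForm Y u := hY.le_quadForm u
    have h2 : c₁ * ∑ i, u i ^ 2 ≤ c / 2 * E := by
      rw [hE, Finset.mul_sum, Finset.mul_sum]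
      refine Finset.sum_le_sum fun i _ => ?_
      rw [← mul_assoc]
      refine mul_le_mul_of_nonneg_right ?_ (sq_nonneg _)
      have : c₁ ≤ c / 4 := min_le_left _ _
      have := hY0 i
      nlinarith
    have h3 : -(c / 4 * E + 4 * K ^ 2 / c * s ^ 2 * ∑ i, Y i i) ≤ 2 * s * (w ⬝ᵥ u) := by
      rw [hE, dotProduct, Finset.mul_sum, Finset.mul_sum, Finset.mul_sum,
        ← Finset.sum_add_distrib, ← Finset.sum_neg_distrib]
      refine Finset.sum_le_sum fun i _ => ?_
      have e1 : |2 * s * (w i * u i)| ≤ 2 * |s| * (K * Y i i * |u i|) := by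
        rw [abs_mul, abs_mul, abs_mul, abs_two]
        have := hw i
        gcongr
      have e2 : 2 * K * |s| * |u i| ≤ c / 4 * u i ^ 2 + 4 * K ^ 2 / c * s ^ 2 := by
        have := sq_nonneg (c / 2 * |u i| - 2 * K * |s|)
        have e3 : c * (c / 4 * u i ^ 2 + 4 * K ^ 2 / c * s ^ 2 - 2 * K * |s| * |u i|) =
            (c / 2 * |u i| - 2 * K * |s|) ^ 2 := by
          rw [← sq_abs (u i), ← sq_abs s]
          field_simp
          ring
        have e4 := nonneg_of_mul_nonneg_right (e3 ▸ this) hc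
        linarith
      have e5 := mul_le_mul_of_nonneg_right e2 (hY.pos i).le
      have e6 := neg_abs_le (2 * s * (w i * u i))
      nlinarith
    have h4 : ∑ i, (Y i i - c₁) * v (Sum.inl i) ^ 2 ≤ E :=
      Finset.sum_le_sum fun i _ => mul_le_mul_of_nonneg_right (by linarith) (sq_nonneg _)
    have h5 : 4 * K ^ 2 / c * s ^ 2 * ∑ i, Y i i ≤ 4 * K ^ 2 / c * s ^ 2 * S :=
      mul_le_mul_of_nonneg_left (by linarith) (by positivity)
    have h6 : c / 4 * E + S * s ^ 2 ≤ quadForm Y u - c₁ * ∑ i, u i ^ 2 + 2 * s * (w ⬝ᵥ u) +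
        l * S * s ^ 2 := by
      rw [hl]
      linarith
    refine le_trans ?_ h6
    have h7 : min (c / 4) (1 / l) * E ≤ c / 4 * E :=
      mul_le_mul_of_nonneg_right (min_le_left _ _) hE0
    have h8 : min (c / 4) (1 / l) * (l * S * s ^ 2) ≤ S * s ^ 2 := by
      calc _ ≤ 1 / l * (l * S * s ^ 2) :=
            mul_le_mul_of_nonneg_right (min_le_right _ _) (by positivity)
        _ = _ := by field_simp
    have h9 : 0 ≤ min (c / 4) (1 / l) := by positivity
    have h10 := mul_le_mul_of_nonneg_left h4 h9
    rw [mul_add]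
    linarith

/-! ### Closure properties of definable functions and predicates -/

section Definability

variable {α β ι : Type}

/-- Definability of a real function in `ℝ_{an,exp}` with real parameters. -/
def RealDefinable (f : (α → ℝ) → ℝ) : Prop := Set.DefinableFun anExp (Set.univ : Set ℝ) f

/-- Definability of the real and imaginary parts of a function in `ℝ_{an,exp}`. -/
def ComplexDefinable (f : (α → ℝ) → ℂ) : Prop :=
  RealDefinable (fun x => (f x).re) ∧ RealDefinable fun x => (f x).im

/-- Definability of a predicate in `ℝ_{an,exp}` with real parameters. -/
def PredDefinable (P : (α → ℝ) → Prop) : Prop :=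
  (Set.univ : Set ℝ).Definable anExp {x | P x}

lemma realDefinable_const (r : ℝ) : RealDefinable fun _ : α → ℝ => r :=
  anExp.definableFun_const α (Set.mem_univ r)

lemma realDefinable_apply (i : α) : RealDefinable fun x => x i :=
  Set.DefinableFun.proj _

lemma RealDefinable.funMap {n : ℕ} (s : AnExpFunc n) {f : Fin n → (α → ℝ) → ℝ}
    (hf : ∀ i, RealDefinable (f i)) : RealDefinable fun x => s.interp fun i => f i x :=
  Set.DefinableFun.comp (g := fun x i => f i x) hf
    (.of_empty (Set.DefinableFun.fun_symbol (L := anExp) s))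

variable {f h : (α → ℝ) → ℝ}

lemma RealDefinable.neg (hf : RealDefinable f) : RealDefinable fun x => - f x :=
  RealDefinable.funMap .neg (f := fun _ => f) fun _ => hf

lemma RealDefinable.add (hf : RealDefinable f) (hh : RealDefinable h) :
    RealDefinable fun x => f x + h x :=
  RealDefinable.funMap .add (f := ![f, h]) (by simp [Fin.forall_fin_two, hf, hh])

lemma RealDefinable.mul (hf : RealDefinable f) (hh : RealDefinable h) :
    RealDefinable fun x => f x * h x :=
  RealDefinable.funMap .mul (f := ![f, h]) (by simp [Fin.forall_fin_two, hf, hh])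

lemma RealDefinable.exp (hf : RealDefinable f) : RealDefinable fun x => Real.exp (f x) :=
  RealDefinable.funMap .exp (f := fun _ => f) fun _ => hf

lemma RealDefinable.sub (hf : RealDefinable f) (hh : RealDefinable h) :
    RealDefinable fun x => f x - h x := by
  simpa only [sub_eq_add_neg] using hf.add hh.neg

lemma RealDefinable.pow (hf : RealDefinable f) (n : ℕ) : RealDefinable fun x => f x ^ n := by
  induction n with
  | zero => simpa using realDefinable_const 1
  | succ n ih => simpa only [pow_succ] using ih.mul hf

lemma RealDefinable.sum {s : Finset ι} {f : ι → (α → ℝ) → ℝ} (hf : ∀ i, RealDefinable (f i)) :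
    RealDefinable fun x => ∑ i ∈ s, f i x := by
  classical
  induction s using Finset.induction_on with
  | empty => simpa using realDefinable_const 0
  | insert i s hi ih => simpa only [Finset.sum_insert hi] using (hf i).add ih

/-- The extension by zero of a function which is analytic on a compact box is definable. -/
lemma RealDefinable.indicator [Fintype ι] {F : (ι → ℝ) → ℝ} {l u : ι → ℝ}
    (hF : AnalyticOnNhd ℝ F (Set.Icc l u)) {f : ι → (α → ℝ) → ℝ} (hf : ∀ i, RealDefinable (f i)) :
    RealDefinable fun x => (Set.Icc l u).indicator F fun i => f i x := by
  classical
  set e := Fintype.equivFin ι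
  have hm : ∀ y : Fin (Fintype.card ι) → ℝ,
      y ∈ Set.Icc (l ∘ e.symm) (u ∘ e.symm) ↔ y ∘ e ∈ Set.Icc l u := fun y => by
    simp only [Set.mem_Icc, Pi.le_def, Function.comp]
    exact and_congr ⟨fun H i => by simpa using H (e i), fun H i => by simpa using H (e.symm i)⟩
      ⟨fun H i => by simpa using H (e i), fun H i => by simpa using H (e.symm i)⟩
  have hA : AnalyticOnNhd ℝ (fun y : Fin (Fintype.card ι) → ℝ => F (y ∘ e))
      (Set.Icc (l ∘ e.symm) (u ∘ e.symm)) := fun y hy =>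
    (hF _ ((hm y).mp hy)).fun_comp (g := F) (f := fun y : Fin (Fintype.card ι) → ℝ => y ∘ e)
      ((LinearMap.toContinuousLinearMap (LinearMap.funLeft ℝ ℝ e)).analyticAt y)
  convert RealDefinable.funMap (.restricted _ _ _ hA) (f := fun k => f (e.symm k))
    (fun k => hf _) using 2 with x
  have he : (fun k => f (e.symm k) x) ∘ e = fun i => f i x := by ext; simp
  simp only [AnExpFunc.interp, hm, he, Set.indicator]
  congr

variable {P Q : (α → ℝ) → Prop}

lemma PredDefinable.and (hP : PredDefinable P) (hQ : PredDefinable Q) :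
    PredDefinable fun x => P x ∧ Q x :=
  Set.Definable.inter hP hQ

lemma PredDefinable.imp (hP : PredDefinable P) (hQ : PredDefinable Q) :
    PredDefinable fun x => P x → Q x :=
  hP.himp hQ

lemma PredDefinable.not (hP : PredDefinable P) : PredDefinable fun x => ¬ P x :=
  Set.Definable.compl hP

lemma PredDefinable.forall [Finite ι] {P : ι → (α → ℝ) → Prop} (hP : ∀ i, PredDefinable (P i)) :
    PredDefinable fun x => ∀ i, P i x := by
  have := Set.definable_iInter_of_finite hP
  rwa [← Set.ofPred_forall] at this

lemma PredDefinable.forall_mem {s : Finset ι} {P : ι → (α → ℝ) → Prop}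
    (hP : ∀ i ∈ s, PredDefinable (P i)) : PredDefinable fun x => ∀ i ∈ s, P i x := by
  have := PredDefinable.forall (P := fun (i : s) x => P i x) fun i => hP i i.2
  simpa using this

lemma PredDefinable.exists_real [Finite β] {P : (α → ℝ) → (β → ℝ) → Prop}
    (hP : PredDefinable fun y : α ⊕ β → ℝ => P (y ∘ Sum.inl) (y ∘ Sum.inr)) :
    PredDefinable fun x => ∃ t, P x t :=
  Set.Definable.exists_of_finite hP

lemma PredDefinable.forall_real [Finite β] {P : (α → ℝ) → (β → ℝ) → Prop}
    (hP : PredDefinable fun y : α ⊕ β → ℝ => P (y ∘ Sum.inl) (y ∘ Sum.inr)) :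
    PredDefinable fun x => ∀ t, P x t :=
  Set.Definable.forall_of_finite hP

lemma RealDefinable.comp_inl (hf : RealDefinable f) :
    RealDefinable fun y : α ⊕ β → ℝ => f (y ∘ Sum.inl) := by
  simpa [RealDefinable, Set.DefinableFun, Function.tupleGraph] using!
    Set.Definable.preimage_comp (Option.map Sum.inl) hf

lemma RealDefinable.eq (hf : RealDefinable f) (hh : RealDefinable h) :
    PredDefinable fun x => f x = h x :=
  Set.DefinableFun.ofPred_eq hf hh

/-- The language has no order symbol; `f ≤ h` is expressed by `h - f` being a square. -/
lemma RealDefinable.le (hf : RealDefinable f) (hh : RealDefinable h) :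
    PredDefinable fun x => f x ≤ h x := by
  have : PredDefinable fun x => ∃ t : Unit → ℝ, h x = f x + t () ^ 2 :=
    PredDefinable.exists_real (hh.comp_inl.eq (hf.comp_inl.add ((realDefinable_apply _).pow 2)))
  convert this using 2 with x
  refine ⟨fun hx => ⟨fun _ => √(h x - f x), ?_⟩, fun ⟨t, ht⟩ => ?_⟩
  · rw [Real.sq_sqrt (sub_nonneg.mpr hx)]
    ring
  · rw [ht]
    exact le_add_of_nonneg_right (sq_nonneg _)

lemma RealDefinable.lt (hf : RealDefinable f) (hh : RealDefinable h) :
    PredDefinable fun x => f x < h x := by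
  simpa only [not_le] using (hh.le hf).not

lemma RealDefinable.abs_le (hf : RealDefinable f) (hh : RealDefinable h) :
    PredDefinable fun x => |f x| ≤ h x := by
  simpa only [_root_.abs_le] using (hh.neg.le hf).and (hf.le hh)

lemma RealDefinable.abs_lt (hf : RealDefinable f) (hh : RealDefinable h) :
    PredDefinable fun x => |f x| < h x := by
  simpa only [_root_.abs_lt] using (hh.neg.lt hf).and (hf.lt hh)

lemma RealDefinable.quadForm [Fintype ι] {Y : (α → ℝ) → Matrix ι ι ℝ} {v : ι → (α → ℝ) → ℝ}
    (hY : ∀ i j, RealDefinable fun x => Y x i j) (hv : ∀ i, RealDefinable (v i)) :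
    RealDefinable fun x => quadForm (Y x) fun i => v i x := by
  simp only [quadForm_eq_sum]
  exact .sum fun i => .sum fun j => (hY i j).mul ((hv i).mul (hv j))

end Definability

section ComplexDefinability

variable {α β ι : Type} {f h : (α → ℝ) → ℂ}

lemma complexDefinable_const (w : ℂ) : ComplexDefinable fun _ : α → ℝ => w :=
  ⟨realDefinable_const _, realDefinable_const _⟩

lemma RealDefinable.ofReal {f : (α → ℝ) → ℝ} (hf : RealDefinable f) :
    ComplexDefinable fun x => (f x : ℂ) :=
  ⟨hf, realDefinable_const 0⟩

lemma ComplexDefinable.add (hf : ComplexDefinable f) (hh : ComplexDefinable h) :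
    ComplexDefinable fun x => f x + h x :=
  ⟨hf.1.add hh.1, hf.2.add hh.2⟩

lemma ComplexDefinable.mul (hf : ComplexDefinable f) (hh : ComplexDefinable h) :
    ComplexDefinable fun x => f x * h x :=
  ⟨(hf.1.mul hh.1).sub (hf.2.mul hh.2), (hf.1.mul hh.2).add (hf.2.mul hh.1)⟩

lemma ComplexDefinable.sum {s : Finset ι} {f : ι → (α → ℝ) → ℂ}
    (hf : ∀ i, ComplexDefinable (f i)) : ComplexDefinable fun x => ∑ i ∈ s, f i x := by
  simp only [ComplexDefinable, Complex.re_sum, Complex.im_sum]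
  exact ⟨.sum fun i => (hf i).1, .sum fun i => (hf i).2⟩

lemma ComplexDefinable.prod {s : Finset ι} {f : ι → (α → ℝ) → ℂ}
    (hf : ∀ i, ComplexDefinable (f i)) : ComplexDefinable fun x => ∏ i ∈ s, f i x := by
  classical
  induction s using Finset.induction_on with
  | empty => simpa using complexDefinable_const 1
  | insert i s hi ih => simpa only [Finset.prod_insert hi] using (hf i).mul ih

lemma ComplexDefinable.det [Fintype ι] [DecidableEq ι] {A : (α → ℝ) → Matrix ι ι ℂ}
    (hA : ∀ i j, ComplexDefinable fun x => A x i j) : ComplexDefinable fun x => (A x).det := by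
  simp only [Matrix.det_apply']
  exact .sum fun σ => (complexDefinable_const _).mul (.prod fun i => hA _ _)

lemma ComplexDefinable.normSq (hf : ComplexDefinable f) :
    RealDefinable fun x => Complex.normSq (f x) := by
  simp only [Complex.normSq_apply]
  exact (hf.1.mul hf.1).add (hf.2.mul hf.2)

lemma ComplexDefinable.comp_inl (hf : ComplexDefinable f) :
    ComplexDefinable fun y : α ⊕ β → ℝ => f (y ∘ Sum.inl) :=
  ⟨hf.1.comp_inl, hf.2.comp_inl⟩

lemma ComplexDefinable.eq (hf : ComplexDefinable f) (hh : ComplexDefinable h) :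
    PredDefinable fun x => f x = h x := by
  simp only [Complex.ext_iff]
  exact (hf.1.eq hh.1).and (hf.2.eq hh.2)

lemma ComplexDefinable.indicator [Fintype ι] {F : (ι → ℝ) → ℂ} {l u : ι → ℝ}
    (hF : AnalyticOnNhd ℝ F (Set.Icc l u)) {f : ι → (α → ℝ) → ℝ} (hf : ∀ i, RealDefinable (f i)) :
    ComplexDefinable fun x => (Set.Icc l u).indicator F fun i => f i x := by
  have hre : AnalyticOnNhd ℝ (fun y => (F y).re) (Set.Icc l u) := fun y hy =>
    (Complex.reCLM.analyticAt _).comp (hF y hy)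
  have him : AnalyticOnNhd ℝ (fun y => (F y).im) (Set.Icc l u) := fun y hy =>
    (Complex.imCLM.analyticAt _).comp (hF y hy)
  refine ⟨?_, ?_⟩
  · convert RealDefinable.indicator hre hf using 2 with x
    by_cases hx : (fun i => f i x) ∈ Set.Icc l u <;> simp only [Set.indicator, hx, if_true,
      if_false, Complex.zero_re]
  · convert RealDefinable.indicator him hf using 2 with x
    by_cases hx : (fun i => f i x) ∈ Set.Icc l u <;> simp only [Set.indicator, hx, if_true,
      if_false, Complex.zero_im]

end ComplexDefinability

/-! ### Passage between points with values and their real coordinates -/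

section Coordinates

variable {g : ℕ}

/-- The index set of the complex coordinates of a point of `ℂ^g × ℍ_g` and a value. -/
abbrev GraphIndex (g : ℕ) : Type := (Fin g ⊕ {ij : Fin g × Fin g // ij.1 ≤ ij.2}) ⊕ Unit

/-- The complex numbers with given real and imaginary parts. -/
def complexCoord {ι : Type} (x : ι ⊕ ι → ℝ) (i : ι) : ℂ := ⟨x (Sum.inl i), x (Sum.inr i)⟩

/-- The vector with given coordinates. -/
def coordVector (x : GraphIndex g ⊕ GraphIndex g → ℝ) (i : Fin g) : ℂ :=
  complexCoord x (Sum.inl (Sum.inl i))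

/-- The symmetric matrix with given coordinates. -/
def coordMatrix (x : GraphIndex g ⊕ GraphIndex g → ℝ) : Matrix (Fin g) (Fin g) ℂ :=
  Matrix.of fun i j => complexCoord x (Sum.inl (Sum.inr
    (if h : i ≤ j then ⟨(i, j), h⟩ else ⟨(j, i), le_of_not_ge h⟩)))

/-- The value with given coordinates. -/
def coordValue (x : GraphIndex g ⊕ GraphIndex g → ℝ) : ℂ := complexCoord x (Sum.inr ())

lemma complexDefinable_complexCoord {ι : Type} (i : ι) :
    ComplexDefinable fun x : ι ⊕ ι → ℝ => complexCoord x i :=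
  ⟨realDefinable_apply _, realDefinable_apply _⟩

lemma complexDefinable_coordVector (i : Fin g) : ComplexDefinable fun x => coordVector x i :=
  complexDefinable_complexCoord _

lemma complexDefinable_coordMatrix (i j : Fin g) : ComplexDefinable fun x => coordMatrix x i j :=
  complexDefinable_complexCoord _

lemma complexDefinable_coordValue : ComplexDefinable (coordValue (g := g)) :=
  complexDefinable_complexCoord _

lemma realCoords_complexCoord {ι : Type} (x : ι ⊕ ι → ℝ) : realCoords (complexCoord x) = x := by
  ext (i | i) <;> rfl

lemma isSymm_coordMatrix (x : GraphIndex g ⊕ GraphIndex g → ℝ) : (coordMatrix x).IsSymm := by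
  refine Matrix.IsSymm.ext fun i j => ?_
  simp only [coordMatrix, Matrix.of_apply]
  rcases lt_trichotomy i j with h | rfl | h
  · rw [dif_neg (not_le.mpr h), dif_pos h.le]
  · rfl
  · rw [dif_neg (not_le.mpr h), dif_pos h.le]

lemma complexCoord_eq (x : GraphIndex g ⊕ GraphIndex g → ℝ)
    (h : coordMatrix x ∈ siegelHalfSpace g) :
    complexCoord x = Sum.elim (coords (coordVector x, ⟨coordMatrix x, h⟩))
      fun _ => coordValue x := by
  ext ((i | ⟨⟨i, j⟩, hij⟩) | i)
  · rfl
  · simp only [coords, coordMatrix, Sum.elim_inl, Sum.elim_inr, Matrix.of_apply]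
    rw [dif_pos hij]
  · rfl

variable (p : (Fin g → ℂ) × siegelHalfSpace g) (w : ℂ)

lemma coordVector_realCoords :
    coordVector (realCoords (Sum.elim (coords p) fun _ : Unit => w)) = p.1 := by
  ext i
  rfl

lemma coordValue_realCoords :
    coordValue (realCoords (Sum.elim (coords p) fun _ : Unit => w)) = w := rfl

lemma coordMatrix_realCoords :
    coordMatrix (realCoords (Sum.elim (coords p) fun _ : Unit => w)) = p.2 := by
  ext i j
  by_cases h : i ≤ j
  · simp only [coordMatrix, Matrix.of_apply, dif_pos h]
    rfl
  · simp only [coordMatrix, Matrix.of_apply, dif_neg h]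
    exact p.2.2.1.apply i j

variable {f : (Fin g → ℂ) × siegelHalfSpace g → ℂ} {S : Set ((Fin g → ℂ) × siegelHalfSpace g)}

/-- The upper triangle determines a symmetric matrix, so every real tuple is the coordinate tuple of
some `z`, symmetric `τ` and `w`. It then suffices to describe the graph for such triples, provided
that `Q` itself forces `τ` into the half space. -/
lemma definableOn_of_predDefinable {Q : (Fin g → ℂ) → Matrix (Fin g) (Fin g) ℂ → ℂ → Prop}
    (hQ : ∀ z τ w, τ.IsSymm →
      (Q z τ w ↔ ∃ h : τ ∈ siegelHalfSpace g, (z, ⟨τ, h⟩) ∈ S ∧ f (z, ⟨τ, h⟩) = w))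
    (hdef : PredDefinable fun x => Q (coordVector x) (coordMatrix x) (coordValue x)) :
    DefinableOn f S := by
  suffices key : (fun p => realCoords (Sum.elim (coords p) (fun _ : Unit => f p))) '' S =
      {x | Q (coordVector x) (coordMatrix x) (coordValue x)} by
    rw [DefinableOn, key]
    exact hdef
  ext x
  constructor
  · rintro ⟨p, hp, rfl⟩
    show Q _ _ _
    rw [coordVector_realCoords, coordMatrix_realCoords, coordValue_realCoords,
      hQ _ _ _ p.2.2.1]
    exact ⟨p.2.2, hp, rfl⟩
  · intro hx
    obtain ⟨h, hS, hf⟩ := (hQ _ _ _ (isSymm_coordMatrix x)).mp hx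
    refine ⟨_, hS, ?_⟩
    simp only [hf]
    rw [← complexCoord_eq x h, realCoords_complexCoord]

lemma DefinableOn.inter (hf : DefinableOn f S)
    {Q : (Fin g → ℂ) → Matrix (Fin g) (Fin g) ℂ → Prop}
    (hQ : PredDefinable fun x => Q (coordVector x) (coordMatrix x)) :
    DefinableOn f {p | p ∈ S ∧ Q p.1 p.2} := by
  suffices key : (fun p => realCoords (Sum.elim (coords p) (fun _ : Unit => f p))) ''
      {p | p ∈ S ∧ Q p.1 p.2} = (fun p => realCoords (Sum.elim (coords p)
        (fun _ : Unit => f p))) '' S ∩ {x | Q (coordVector x) (coordMatrix x)} by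
    rw [DefinableOn, key]
    exact Set.Definable.inter hf hQ
  ext x
  constructor
  · rintro ⟨p, ⟨hp, hpQ⟩, rfl⟩
    refine ⟨⟨p, hp, rfl⟩, ?_⟩
    show Q _ _
    rwa [coordVector_realCoords, coordMatrix_realCoords]
  · rintro ⟨⟨p, hp, rfl⟩, hx⟩
    change Q _ _ at hx
    rw [coordVector_realCoords, coordMatrix_realCoords] at hx
    exact ⟨p, ⟨hp, hx⟩, rfl⟩

end Coordinates

/-! ### An open definable region around the points over the Siegel set -/

section Region

variable {g : ℕ} {R K C c : ℝ} {z : Fin g → ℂ} {τ : Matrix (Fin g) (Fin g) ℂ}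

/-- A neighbourhood of the part of `ℂ^g × 𝔉_g` with bounded lattice coordinates. -/
def InRegion (R K C c : ℝ) (z : Fin g → ℂ) (τ : Matrix (Fin g) (Fin g) ℂ) : Prop :=
  (∀ i j, |(τ i j).re| < 1) ∧ (∀ i, |(z i).re| < R) ∧ (∀ i, 1 / 2 < (τ i i).im) ∧
    (∀ i j, |(τ i j).im| < C * (τ i i).im) ∧ (∀ i, |(z i).im| < K * (τ i i).im) ∧
      ∀ v : Fin g → ℝ, v ≠ 0 → c * ∑ i, (τ i i).im * v i ^ 2 < quadForm (imPart τ) v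

lemma InRegion.balanced (h : InRegion R K C c z τ) (hτ : τ.IsSymm) :
    Balanced c C (imPart τ) := by
  obtain ⟨-, -, hpos, habs, -, hq⟩ := h
  refine ⟨fun i j => congrArg Complex.im (hτ.apply j i), fun i => ?_, fun i j => (habs i j).le,
    fun v => ?_⟩
  · exact lt_trans (by norm_num) (hpos i)
  · rcases eq_or_ne v 0 with rfl | hv
    · simp [SiegelTheta.quadForm]
    · exact (hq v hv).le

lemma InRegion.mem_siegelHalfSpace (hc : 0 < c) (h : InRegion R K C c z τ) (hτ : τ.IsSymm) :
    τ ∈ siegelHalfSpace g :=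
  ⟨hτ, (h.balanced hτ).posDef hc⟩

/-- Only the condition quantified over all `v` needs an argument: by homogeneity `v` may be taken on
the unit sphere, whose compactness makes the strict inequality stable. -/
lemma isOpen_setOf_inRegion (R K C c : ℝ) :
    IsOpen {p : (Fin g → ℂ) × siegelHalfSpace g | InRegion R K C c p.1 p.2} := by
  have hent : ∀ i j, Continuous fun p : (Fin g → ℂ) × siegelHalfSpace g =>
      (p.2 : Matrix (Fin g) (Fin g) ℂ) i j := fun i j =>
    (continuous_subtype_val.comp continuous_snd).matrix_elem i j
  have hz : ∀ i, Continuous fun p : (Fin g → ℂ) × siegelHalfSpace g => p.1 i := fun i =>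
    (continuous_apply i).comp continuous_fst
  have hre : ∀ i j, Continuous fun p : (Fin g → ℂ) × siegelHalfSpace g =>
      ((p.2 : Matrix (Fin g) (Fin g) ℂ) i j).re := fun i j => Complex.continuous_re.comp (hent i j)
  have him : ∀ i j, Continuous fun p : (Fin g → ℂ) × siegelHalfSpace g =>
      ((p.2 : Matrix (Fin g) (Fin g) ℂ) i j).im := fun i j => Complex.continuous_im.comp (hent i j)
  have hsphere : ∀ p : (Fin g → ℂ) × siegelHalfSpace g,
      (∀ v : Fin g → ℝ, v ≠ 0 → c * ∑ i, ((p.2 : Matrix (Fin g) (Fin g) ℂ) i i).im * v i ^ 2 <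
        quadForm (imPart (p.2 : Matrix (Fin g) (Fin g) ℂ)) v) ↔
      ∀ v ∈ Metric.sphere (0 : Fin g → ℝ) 1,
        c * ∑ i, ((p.2 : Matrix (Fin g) (Fin g) ℂ) i i).im * v i ^ 2 <
        quadForm (imPart (p.2 : Matrix (Fin g) (Fin g) ℂ)) v := by
    intro p
    refine ⟨fun H v hv => H v fun h0 => by simp [h0] at hv, fun H v hv => ?_⟩
    have hn : 0 < ‖v‖ := norm_pos_iff.mpr hv
    have := H (‖v‖⁻¹ • v) (by simp [norm_smul, hn.ne'])
    have e1 : quadForm (imPart (p.2 : Matrix (Fin g) (Fin g) ℂ)) (‖v‖⁻¹ • v) =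
        ‖v‖⁻¹ ^ 2 * quadForm (imPart (p.2 : Matrix (Fin g) (Fin g) ℂ)) v := by
      simp only [SiegelTheta.quadForm, Matrix.mulVec_smul, smul_dotProduct, dotProduct_smul,
        smul_eq_mul]
      ring
    have e2 : c * ∑ i, ((p.2 : Matrix (Fin g) (Fin g) ℂ) i i).im * (‖v‖⁻¹ • v) i ^ 2 =
        ‖v‖⁻¹ ^ 2 * (c * ∑ i, ((p.2 : Matrix (Fin g) (Fin g) ℂ) i i).im * v i ^ 2) := by
      simp only [Pi.smul_apply, smul_eq_mul, Finset.mul_sum]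
      exact Finset.sum_congr rfl fun i _ => by ring
    rw [e1, e2] at this
    exact lt_of_mul_lt_mul_left this (by positivity)
  simp only [InRegion, hsphere, Set.ofPred_and, Set.ofPred_forall]
  refine IsOpen.inter ?_ (IsOpen.inter ?_ (IsOpen.inter ?_ (IsOpen.inter ?_
    (IsOpen.inter ?_ ?_))))
  · exact isOpen_iInter_of_finite fun i => isOpen_iInter_of_finite fun j =>
      isOpen_lt (hre i j).abs continuous_const
  · exact isOpen_iInter_of_finite fun i =>
      isOpen_lt (Complex.continuous_re.comp (hz i)).abs continuous_const
  · exact isOpen_iInter_of_finite fun i => isOpen_lt continuous_const (him i i)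
  · exact isOpen_iInter_of_finite fun i => isOpen_iInter_of_finite fun j =>
      isOpen_lt (him i j).abs (continuous_const.mul (him i i))
  · exact isOpen_iInter_of_finite fun i =>
      isOpen_lt (Complex.continuous_im.comp (hz i)).abs (continuous_const.mul (him i i))
  · simp only [← Set.ofPred_forall]
    rw [isOpen_iff_eventually]
    intro p hp
    refine (isCompact_sphere (0 : Fin g → ℝ) 1).eventually_forall_of_forall_eventually
      (P := fun (p : (Fin g → ℂ) × siegelHalfSpace g) v =>
        c * ∑ i, ((p.2 : Matrix (Fin g) (Fin g) ℂ) i i).im * v i ^ 2 <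
        quadForm (imPart (p.2 : Matrix (Fin g) (Fin g) ℂ)) v) fun v hv => ?_
    refine (isOpen_lt ?_ ?_).mem_nhds (hp v hv)
    · refine continuous_const.mul (continuous_finsetSum _ fun i _ => ?_)
      exact ((him i i).comp continuous_fst).mul
        (((continuous_apply i).comp continuous_snd).pow 2)
    · simp only [quadForm_eq_sum]
      refine continuous_finsetSum _ fun i _ => continuous_finsetSum _ fun j _ => ?_
      exact ((him i j).comp continuous_fst).mul
        (((continuous_apply i).comp continuous_snd).mul
          ((continuous_apply j).comp continuous_snd))

lemma predDefinable_inRegion (R K C c : ℝ) :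
    PredDefinable fun x : GraphIndex g ⊕ GraphIndex g → ℝ =>
      InRegion R K C c (coordVector x) (coordMatrix x) := by
  have hτ := complexDefinable_coordMatrix (g := g)
  have hz := complexDefinable_coordVector (g := g)
  refine .and (.forall fun i => .forall fun j => (hτ i j).1.abs_lt (realDefinable_const _))
    (.and (.forall fun i => (hz i).1.abs_lt (realDefinable_const _))
    (.and (.forall fun i => (realDefinable_const _).lt (hτ i i).2)
    (.and (.forall fun i => .forall fun j => (hτ i j).2.abs_lt
      ((realDefinable_const _).mul (hτ i i).2))
    (.and (.forall fun i => (hz i).2.abs_lt ((realDefinable_const _).mul (hτ i i).2)) ?_))))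
  refine PredDefinable.forall_real (P := fun x v => v ≠ 0 →
    c * ∑ i, (coordMatrix x i i).im * v i ^ 2 < quadForm (imPart (coordMatrix x)) v) ?_
  refine PredDefinable.imp ?_ (RealDefinable.lt ?_ ?_)
  · have : PredDefinable fun y : (GraphIndex g ⊕ GraphIndex g) ⊕ Fin g → ℝ =>
        ¬ ∀ i, y (Sum.inr i) = 0 :=
      .not (.forall fun i => (realDefinable_apply _).eq (realDefinable_const 0))
    simpa [funext_iff] using this
  · exact (realDefinable_const _).mul (.sum fun i => (hτ i i).2.comp_inl.mul
      ((realDefinable_apply _).pow 2))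
  · exact RealDefinable.quadForm (Y := fun y : (GraphIndex g ⊕ GraphIndex g) ⊕ Fin g → ℝ =>
      imPart (coordMatrix (y ∘ Sum.inl))) (v := fun i y => y (Sum.inr i))
      (fun i j => (hτ i j).2.comp_inl) fun i => realDefinable_apply _

end Region

/-! ### Definability of theta with characteristics on the region -/

section ThetaDefinable

variable {g : ℕ}

/-- The coefficients of the nonnegative decompositions which turn a theta function into a
convergent theta series. -/
def IsThetaDecomposition (c l : ℝ) (T : Finset (Fin g ⊕ Unit → ℤ)) (z : Fin g → ℂ)
    (τ : Matrix (Fin g) (Fin g) ℂ) (t : T → ℝ) : Prop :=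
  (∀ v, 0 ≤ t v) ∧ ∀ i j, extendMatrix (imPart τ - c • 1) (fun i => (z i).im)
    (l * (1 + ∑ i, imPart τ i i)) i j = ∑ v : T, t v * ((v.1 i : ℝ) * v.1 j)

/-- The variables of the theta series. -/
noncomputable def thetaVariables (T : Finset (Fin g ⊕ Unit → ℤ)) (z : Fin g → ℂ)
    (τ : Matrix (Fin g) (Fin g) ℂ) (t : T → ℝ) :
    T ⊕ ((Fin g ⊕ Unit) × (Fin g ⊕ Unit)) → ℝ :=
  Sum.elim (fun v => Real.exp (-(Real.pi * t v)))
    fun p => extendMatrix (τ.map Complex.re) (fun i => (z i).re) 0 p.1 p.2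

/-- A box which contains the variables of the theta series. -/
def thetaBox (T : Finset (Fin g ⊕ Unit → ℤ)) (R : ℝ) :
    Set (T ⊕ ((Fin g ⊕ Unit) × (Fin g ⊕ Unit)) → ℝ) :=
  Set.Icc (Sum.elim (fun _ => 0) fun _ => -R) (Sum.elim (fun _ => 1) fun _ => R)

lemma thetaVariables_mem_thetaBox {T : Finset (Fin g ⊕ Unit → ℤ)} {z : Fin g → ℂ}
    {τ : Matrix (Fin g) (Fin g) ℂ} {t : T → ℝ} {R : ℝ} (hR : 0 ≤ R) (ht : ∀ v, 0 ≤ t v)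
    (hz : ∀ i, |(z i).re| ≤ R) (hτ : ∀ i j, |(τ i j).re| ≤ R) :
    thetaVariables T z τ t ∈ thetaBox T R := by
  have hX : ∀ i j, |extendMatrix (τ.map Complex.re) (fun i => (z i).re) 0 i j| ≤ R := by
    rintro (i | i) (j | j)
    · exact hτ i j
    · exact hz i
    · exact hz j
    · simpa [extendMatrix] using hR
  constructor
  · rintro (v | p)
    · exact (Real.exp_pos _).le
    · exact (abs_le.mp (hX p.1 p.2)).1
  · rintro (v | p)
    · exact Real.exp_le_one_iff.mpr
        (neg_nonpos.mpr (mul_nonneg Real.pi_pos.le (ht v)))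
    · exact (abs_le.mp (hX p.1 p.2)).2

lemma analyticOnNhd_thetaSeries_thetaBox {c : ℝ} (hc : 0 < c)
    (T : Finset (Fin g ⊕ Unit → ℤ)) (R : ℝ) :
    AnalyticOnNhd ℝ (thetaSeries c T) (thetaBox T R) :=
  (analyticOnNhd_thetaSeries hc T).mono fun w hw v =>
    abs_le.mpr ⟨by linarith [show (0 : ℝ) ≤ w (Sum.inl v) from hw.1 (Sum.inl v)],
      hw.2 (Sum.inl v)⟩

/-- A finitary formula for the theta function on a region. -/
lemma exists_riemannTheta_eq_iff (g : ℕ) {c C K R : ℝ} (hc : 0 < c) (hC : 0 < C) (hK : 0 < K) :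
    ∃ c₁ l : ℝ, ∃ T : Finset (Fin g ⊕ Unit → ℤ), 0 < c₁ ∧
      ∀ (z : Fin g → ℂ) (τ : Matrix (Fin g) (Fin g) ℂ) (w w' : ℂ),
        Balanced c C (imPart τ) → (∀ i, 1 / 2 ≤ (τ i i).im) →
        (∀ i, |(z i).im| ≤ K * (τ i i).im) → 0 ≤ R → (∀ i, |(z i).re| ≤ R) →
        (∀ i j, |(τ i j).re| ≤ R) →
        (w' * riemannTheta z τ = w ↔ ∃ t : T → ℝ, IsThetaDecomposition c₁ l T z τ t ∧
          w' * ((Real.exp (Real.pi * (l * (1 + ∑ i, (τ i i).im))) : ℂ) *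
            (thetaBox T R).indicator (thetaSeries c₁ T) (thetaVariables T z τ t)) = w) := by
  obtain ⟨c₁, l, c', C', hc₁, hc', hC', H⟩ := exists_balanced_extendMatrix g hc hC hK
  obtain ⟨T, hT⟩ := exists_cone (ι := Fin g ⊕ Unit) hc' hC'
  refine ⟨c₁, l, T, hc₁, fun z τ w w' hτ hdiag hzim hR hzre hτre => ?_⟩
  -- Valid for every decomposition, not merely a chosen one. Together with existence from
  -- `exists_cone`, this lets a quantifier over `t` describe the graph without selecting `t`.
  have key : ∀ t : T → ℝ, IsThetaDecomposition c₁ l T z τ t →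
      riemannTheta z τ = (Real.exp (Real.pi * (l * (1 + ∑ i, (τ i i).im))) : ℂ) *
            (thetaBox T R).indicator (thetaSeries c₁ T) (thetaVariables T z τ t) := by
    rintro t ⟨ht, hdec⟩
    rw [Set.indicator_of_mem (thetaVariables_mem_thetaBox hR ht hzre hτre)]
    have hext : ∀ v : T, Function.extend Subtype.val t 0 v.1 = t v := fun v =>
      Subtype.val_injective.extend_apply _ _ _
    rw [riemannTheta_eq_thetaSeries (c := c₁) (l := l * (1 + ∑ i, imPart τ i i)) (T := T)
      (t := Function.extend Subtype.val t 0)]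
    · simp only [hext]
      rfl
    · intro i j
      rw [hdec i j, ← Finset.sum_coe_sort T]
      exact Finset.sum_congr rfl fun v _ => by rw [hext]
  constructor
  · rintro rfl
    obtain ⟨t, ht, hdec⟩ := hT _ (H (imPart τ) (fun i => (z i).im) hτ hdiag hzim)
    have hd : IsThetaDecomposition c₁ l T z τ fun v => t v :=
      ⟨fun v => ht v, fun i j => by rw [hdec i j, ← Finset.sum_coe_sort T]⟩
    exact ⟨_, hd, by rw [← key _ hd]⟩
  · rintro ⟨t, hd, hw⟩
    rwa [key t hd]

/-- The shift by the characteristics. -/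
noncomputable def charShift (a b : Fin g → ℝ) (z : Fin g → ℂ) (τ : Matrix (Fin g) (Fin g) ℂ) :
    Fin g → ℂ :=
  z + τ *ᵥ (fun i => (a i : ℂ)) + fun i => (b i : ℂ)

/-- The phase of the factor of automorphy in the theta function with characteristics. -/
noncomputable def charPhase (a b : Fin g → ℝ) (z : Fin g → ℂ) (τ : Matrix (Fin g) (Fin g) ℂ) : ℂ :=
  (fun i => (a i : ℂ)) ⬝ᵥ (τ *ᵥ fun i => (a i : ℂ)) +
    2 * ((fun i => (a i : ℂ)) ⬝ᵥ (z + fun i => (b i : ℂ)))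

lemma charShift_apply (a b : Fin g → ℝ) (z : Fin g → ℂ) (τ : Matrix (Fin g) (Fin g) ℂ)
    (i : Fin g) : charShift a b z τ i = z i + ∑ j, τ i j * (a j : ℂ) + (b i : ℂ) := rfl

lemma charPhase_eq (a b : Fin g → ℝ) (z : Fin g → ℂ) (τ : Matrix (Fin g) (Fin g) ℂ) :
    charPhase a b z τ = ∑ i, (a i : ℂ) * ∑ j, τ i j * (a j : ℂ) +
      2 * ∑ i, (a i : ℂ) * (z i + (b i : ℂ)) := rfl

lemma abs_re_charShift_le {R : ℝ} {a b : Fin g → ℝ} {z : Fin g → ℂ}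
    {τ : Matrix (Fin g) (Fin g) ℂ} (hτ : ∀ i j, |(τ i j).re| ≤ 1) (hz : ∀ i, |(z i).re| ≤ R)
    (i : Fin g) : |(charShift a b z τ i).re| ≤ R + ∑ j, |a j| + ∑ j, |b j| := by
  have hb : |b i| ≤ ∑ j, |b j| :=
    Finset.single_le_sum (f := fun j => |b j|) (fun j _ => abs_nonneg _) (Finset.mem_univ i)
  have hs : |∑ j, (τ i j).re * a j| ≤ ∑ j, |a j| :=
    (Finset.abs_sum_le_sum_abs _ _).trans (Finset.sum_le_sum fun j _ => by
      rw [abs_mul]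
      exact mul_le_of_le_one_left (abs_nonneg _) (hτ i j))
  rw [charShift_apply]
  simp only [Complex.add_re, Complex.re_sum, Complex.re_mul_ofReal, Complex.ofReal_re]
  exact (abs_add_three _ _ _).trans (add_le_add (add_le_add (hz i) hs) hb)

lemma abs_im_charShift_le {C K : ℝ} {a b : Fin g → ℝ} {z : Fin g → ℂ}
    {τ : Matrix (Fin g) (Fin g) ℂ} (hτ : ∀ i j, |(τ i j).im| ≤ C * (τ i i).im)
    (hz : ∀ i, |(z i).im| ≤ K * (τ i i).im) (i : Fin g) :
    |(charShift a b z τ i).im| ≤ (K + C * ∑ j, |a j|) * (τ i i).im := by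
  have hs : |∑ j, (τ i j).im * a j| ≤ C * (∑ j, |a j|) * (τ i i).im := by
    refine (Finset.abs_sum_le_sum_abs _ _).trans ?_
    rw [Finset.mul_sum, Finset.sum_mul]
    refine Finset.sum_le_sum fun j _ => ?_
    rw [abs_mul]
    calc _ ≤ C * (τ i i).im * |a j| := mul_le_mul_of_nonneg_right (hτ i j) (abs_nonneg _)
      _ = _ := by ring
  rw [charShift_apply]
  simp only [Complex.add_im, Complex.im_sum, Complex.im_mul_ofReal, Complex.ofReal_im, add_zero,
    add_mul]
  exact (abs_add_le _ _).trans (add_le_add (hz i) hs)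

lemma abs_re_charPhase_le {R : ℝ} {a b : Fin g → ℝ} {z : Fin g → ℂ}
    {τ : Matrix (Fin g) (Fin g) ℂ} (hτ : ∀ i j, |(τ i j).re| ≤ 1) (hz : ∀ i, |(z i).re| ≤ R) :
    |(charPhase a b z τ).re| ≤
      ∑ i, |a i| * ∑ j, |a j| + 2 * ∑ i, |a i| * (R + |b i|) := by
  rw [charPhase_eq]
  simp only [Complex.add_re, Complex.re_sum, Complex.ofReal_re, Complex.ofReal_im, Complex.mul_re,
    Complex.re_ofNat, Complex.im_ofNat, zero_mul, mul_zero, sub_zero]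
  refine (abs_add_le _ _).trans (add_le_add ?_ ?_)
  · refine (Finset.abs_sum_le_sum_abs _ _).trans (Finset.sum_le_sum fun i _ => ?_)
    rw [abs_mul]
    refine mul_le_mul_of_nonneg_left ((Finset.abs_sum_le_sum_abs _ _).trans
      (Finset.sum_le_sum fun j _ => ?_)) (abs_nonneg _)
    rw [abs_mul]
    exact mul_le_of_le_one_left (abs_nonneg _) (hτ i j)
  · rw [abs_mul, abs_two]
    refine mul_le_mul_of_nonneg_left ((Finset.abs_sum_le_sum_abs _ _).trans
      (Finset.sum_le_sum fun i _ => ?_)) zero_le_two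
    rw [abs_mul]
    exact mul_le_mul_of_nonneg_left ((abs_add_le _ _).trans (by linarith [hz i])) (abs_nonneg _)

lemma analyticOnNhd_exp_phase (s : Set (Unit → ℝ)) :
    AnalyticOnNhd ℝ (fun y : Unit → ℝ => Complex.exp (Real.pi * Complex.I * (y () : ℂ))) s := by
  intro y _
  have h1 : AnalyticAt ℝ (fun y : Unit → ℝ => (y () : ℂ)) y :=
    (Complex.ofRealCLM.comp (ContinuousLinearMap.proj (R := ℝ) (φ := fun _ : Unit => ℝ) ())
      ).analyticAt y
  exact (analyticAt_cexp.restrictScalars (𝕜 := ℝ)).fun_comp (analyticAt_const.mul h1)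

/-- Only the real exponential is available globally; the oscillating factor is used as a restricted
analytic function, which is legitimate because the real part of the phase stays bounded. -/
lemma exp_phase_eq {M : ℝ} {A : ℂ} (h : |A.re| ≤ M) :
    Complex.exp (Real.pi * Complex.I * A) = (Real.exp (-(Real.pi * A.im)) : ℂ) *
      (Set.Icc (fun _ : Unit => -M) fun _ => M).indicator
        (fun y => Complex.exp (Real.pi * Complex.I * (y () : ℂ))) fun _ => A.re := by
  have hmem : (fun _ : Unit => A.re) ∈ Set.Icc (fun _ : Unit => -M) fun _ => M :=
    ⟨fun _ => (abs_le.mp h).1, fun _ => (abs_le.mp h).2⟩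
  rw [Set.indicator_of_mem hmem,
    Complex.ofReal_exp, ← Complex.exp_add]
  congr 1
  conv_lhs => rw [← Complex.re_add_im A]
  push_cast
  linear_combination (Real.pi : ℂ) * A.im * Complex.I_mul_I

end ThetaDefinable

section DefinableExpressions

variable {g : ℕ} {α : Type} {z : (α → ℝ) → Fin g → ℂ} {τ : (α → ℝ) → Matrix (Fin g) (Fin g) ℂ}

lemma complexDefinable_charShift (hz : ∀ i, ComplexDefinable fun x => z x i)
    (hτ : ∀ i j, ComplexDefinable fun x => τ x i j) (a b : Fin g → ℝ) (i : Fin g) :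
    ComplexDefinable fun x => charShift a b (z x) (τ x) i := by
  simp only [charShift_apply]
  exact ((hz i).add (.sum fun j => (hτ i j).mul (complexDefinable_const _))).add
    (complexDefinable_const _)

lemma complexDefinable_charPhase (hz : ∀ i, ComplexDefinable fun x => z x i)
    (hτ : ∀ i j, ComplexDefinable fun x => τ x i j) (a b : Fin g → ℝ) :
    ComplexDefinable fun x => charPhase a b (z x) (τ x) := by
  simp only [charPhase_eq]
  exact (ComplexDefinable.sum fun i => (complexDefinable_const _).mul
    (.sum fun j => (hτ i j).mul (complexDefinable_const _))).add
    ((complexDefinable_const _).mul (.sum fun i => (complexDefinable_const _).mul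
      ((hz i).add (complexDefinable_const _))))

lemma realDefinable_extendMatrix {Y : (α → ℝ) → Matrix (Fin g) (Fin g) ℝ}
    {w : (α → ℝ) → Fin g → ℝ} {l : (α → ℝ) → ℝ} (hY : ∀ i j, RealDefinable fun x => Y x i j)
    (hw : ∀ i, RealDefinable fun x => w x i) (hl : RealDefinable l) (i j : Fin g ⊕ Unit) :
    RealDefinable fun x => extendMatrix (Y x) (w x) (l x) i j := by
  rcases i with i | i <;> rcases j with j | j
  · exact hY i j
  · exact hw i
  · exact hw j
  · exact hl

lemma predDefinable_isThetaDecomposition (hz : ∀ i, ComplexDefinable fun x => z x i)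
    (hτ : ∀ i j, ComplexDefinable fun x => τ x i j) (c l : ℝ) (T : Finset (Fin g ⊕ Unit → ℤ))
    {t : (α → ℝ) → T → ℝ} (ht : ∀ v, RealDefinable fun x => t x v) :
    PredDefinable fun x => IsThetaDecomposition c l T (z x) (τ x) (t x) := by
  refine .and (.forall fun v => (realDefinable_const _).le (ht v))
    (.forall fun i => .forall fun j => RealDefinable.eq (realDefinable_extendMatrix (fun i j => ?_)
      (fun i => (hz i).2) ?_ i j) (.sum fun v => (ht v).mul (realDefinable_const _)))
  · exact (hτ i j).2.sub (realDefinable_const _)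
  · exact (realDefinable_const _).mul ((realDefinable_const _).add (.sum fun i => (hτ i i).2))

lemma realDefinable_thetaVariables (hz : ∀ i, ComplexDefinable fun x => z x i)
    (hτ : ∀ i j, ComplexDefinable fun x => τ x i j) (T : Finset (Fin g ⊕ Unit → ℤ))
    {t : (α → ℝ) → T → ℝ} (ht : ∀ v, RealDefinable fun x => t x v)
    (k : T ⊕ ((Fin g ⊕ Unit) × (Fin g ⊕ Unit))) :
    RealDefinable fun x => thetaVariables T (z x) (τ x) (t x) k := by
  rcases k with v | p
  · exact ((realDefinable_const _).mul (ht v)).neg.exp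
  · exact realDefinable_extendMatrix (fun i j => (hτ i j).1) (fun i => (hz i).1)
      (realDefinable_const _) _ _

end DefinableExpressions

/-- The theta function with characteristics is definable on the regions. -/
theorem definableOn_thetaChar_inRegion {g : ℕ} (a b : Fin g → ℝ) {R K C c : ℝ} (hR : 0 < R)
    (hK : 0 < K) (hC : 0 < C) (hc : 0 < c) :
    DefinableOn (thetaChar a b) {p | InRegion R K C c p.1 p.2} := by
  have ha : 0 ≤ ∑ j, |a j| := Finset.sum_nonneg fun _ _ => abs_nonneg _
  have hb : 0 ≤ ∑ j, |b j| := Finset.sum_nonneg fun _ _ => abs_nonneg _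
  -- `R'` bounds the real parts of the shifted argument and, thanks to the `+ 1`, those of the
  -- entries of `τ`; `M` bounds the real part of the phase. The shift by `τ a` likewise enlarges `K`
  -- to `K + C * ∑ j, |a j|`.
  set R' : ℝ := R + ∑ j, |a j| + ∑ j, |b j| + 1 with hR'
  set M : ℝ := ∑ i, |a i| * ∑ j, |a j| + 2 * ∑ i, |a i| * (R + |b i|) with hM
  obtain ⟨c₁, l, T, hc₁, H⟩ := exists_riemannTheta_eq_iff g (c := c) (C := C)
    (K := K + C * ∑ j, |a j|) (R := R') hc hC (by positivity)
  set pre : (Fin g → ℂ) → Matrix (Fin g) (Fin g) ℂ → ℂ := fun z τ =>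
    (Real.exp (-(Real.pi * (charPhase a b z τ).im)) : ℂ) *
      (Set.Icc (fun _ : Unit => -M) fun _ => M).indicator
        (fun y => Complex.exp (Real.pi * Complex.I * (y () : ℂ)))
          fun _ => (charPhase a b z τ).re with hpre
  refine definableOn_of_predDefinable (Q := fun z τ w => InRegion R K C c z τ ∧
    ∃ t : T → ℝ, IsThetaDecomposition c₁ l T (charShift a b z τ) τ t ∧
      pre z τ * ((Real.exp (Real.pi * (l * (1 + ∑ i, (τ i i).im))) : ℂ) *
            (thetaBox T R').indicator (thetaSeries c₁ T)
              (thetaVariables T (charShift a b z τ) τ t)) = w) (fun z τ w hsymm => ?_) ?_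
  · have hval : ∀ h : InRegion R K C c z τ,
        thetaChar a b (z, ⟨τ, h.mem_siegelHalfSpace hc hsymm⟩) =
          pre z τ * riemannTheta (charShift a b z τ) τ := fun h => by
      rw [hpre]
      simp only
      rw [← exp_phase_eq (abs_re_charPhase_le (fun i j => (h.1 i j).le) fun i => (h.2.1 i).le)]
      rfl
    have hiff : ∀ h : InRegion R K C c z τ, _ := fun h =>
      H (charShift a b z τ) τ w (pre z τ) (h.balanced hsymm) (fun i => (h.2.2.1 i).le)
        (abs_im_charShift_le (fun i j => (h.2.2.2.1 i j).le) fun i => (h.2.2.2.2.1 i).le)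
        (by positivity)
        (fun i => (abs_re_charShift_le (fun i j => (h.1 i j).le)
          (fun i => (h.2.1 i).le) i).trans (by linarith))
        fun i j => (h.1 i j).le.trans (by linarith)
    constructor
    · rintro ⟨h, ht⟩
      exact ⟨h.mem_siegelHalfSpace hc hsymm, h, (hval h).trans ((hiff h).mpr ht)⟩
    · rintro ⟨_, h, hw⟩
      exact ⟨h, (hiff h).mp ((hval h).symm.trans hw)⟩
  · have hτ := complexDefinable_coordMatrix (g := g)
    have hz := complexDefinable_coordVector (g := g)
    refine (predDefinable_inRegion R K C c).and (PredDefinable.exists_real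
      (P := fun x t => IsThetaDecomposition c₁ l T
        (charShift a b (coordVector x) (coordMatrix x)) (coordMatrix x) t ∧
        pre (coordVector x) (coordMatrix x) *
          ((Real.exp (Real.pi * (l * (1 + ∑ i, (coordMatrix x i i).im))) : ℂ) *
            (thetaBox T R').indicator (thetaSeries c₁ T)
              (thetaVariables T (charShift a b (coordVector x) (coordMatrix x))
                (coordMatrix x) t)) = coordValue x) ?_)
    have hτ' : ∀ i j, ComplexDefinable fun y : (GraphIndex g ⊕ GraphIndex g) ⊕ T → ℝ =>
      coordMatrix (y ∘ Sum.inl) i j := fun i j => (hτ i j).comp_inl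
    have hz' : ∀ i, ComplexDefinable fun y : (GraphIndex g ⊕ GraphIndex g) ⊕ T → ℝ =>
      coordVector (y ∘ Sum.inl) i := fun i => (hz i).comp_inl
    have hs := complexDefinable_charShift hz' hτ' a b
    have hph := complexDefinable_charPhase hz' hτ' a b
    have ht : ∀ v, RealDefinable fun y : (GraphIndex g ⊕ GraphIndex g) ⊕ T → ℝ =>
      (y ∘ Sum.inr) v := fun v => realDefinable_apply _
    refine (predDefinable_isThetaDecomposition hs hτ' c₁ l T ht).and
      (ComplexDefinable.eq (.mul (.mul ?_ ?_) (.mul ?_ ?_)) complexDefinable_coordValue.comp_inl)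
    · exact (((realDefinable_const _).mul hph.2).neg.exp).ofReal
    · exact ComplexDefinable.indicator (analyticOnNhd_exp_phase _) fun _ => hph.1
    · exact (((realDefinable_const _).mul ((realDefinable_const _).mul
        ((realDefinable_const _).add (.sum fun i => (hτ' i i).2)))).exp).ofReal
    · exact ComplexDefinable.indicator (analyticOnNhd_thetaSeries_thetaBox hc₁ T R')
        (realDefinable_thetaVariables hs hτ' T ht)

/-! ### Definability of the Siegel fundamental set inside the region -/

section Finiteness

/-- Finitely many of the Minkowski conditions suffice for balanced matrices. -/
theorem exists_finset_minkowski (g : ℕ) {c C : ℝ} (hc : 0 < c) (hC : 0 < C) :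
    ∃ F : Fin g → Finset (Fin g → ℤ), (∀ k, ∀ a ∈ F k, (Finset.Ici k).gcd a = 1) ∧
      ∀ β : Matrix (Fin g) (Fin g) ℝ, Balanced c C β →
        (∀ k, ∀ a ∈ F k, β k k ≤ quadForm β fun i => (a i : ℝ)) →
          ∀ k (a : Fin g → ℤ), (Finset.Ici k).gcd a = 1 → β k k ≤ quadForm β fun i => (a i : ℝ) := by
  obtain ⟨T, hT⟩ := exists_cone (ι := Fin g) hc hC
  -- The value at `a` is `∑ t_v (a·v)²` with weights independent of `a`, so domination of all
  -- `|a·v|` gives the inequality for every balanced matrix at once.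
  choose F hF hdom using fun k : Fin g => exists_finset_dominating
    (fun (a : Fin g → ℤ) (v : T) => (a ⬝ᵥ v.1).natAbs) {a | (Finset.Ici k).gcd a = 1}
  refine ⟨F, hF, fun β hβ hall k a ha => ?_⟩
  obtain ⟨b, hb, hle⟩ := hdom k a ha
  refine (hall k b hb).trans ?_
  obtain ⟨t, ht, hdec⟩ := hT β hβ
  rw [quadForm_eq_sum_sq hdec, quadForm_eq_sum_sq hdec]
  refine Finset.sum_le_sum fun v hv => mul_le_mul_of_nonneg_left ?_ (ht v)
  exact_mod_cast Int.natAbs_le_iff_sq_le.mp (hle ⟨v, hv⟩)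

/-- On the regions, the Siegel fundamental set is cut out by a definable condition. -/
theorem exists_predDefinable_siegelFundamentalSet (g : ℕ) {R K C c : ℝ} (hC : 0 < C)
    (hc : 0 < c) :
    ∃ Q : Matrix (Fin g) (Fin g) ℂ → Prop,
      (PredDefinable fun x : GraphIndex g ⊕ GraphIndex g → ℝ => Q (coordMatrix x)) ∧
      ∀ z, ∀ τ ∈ siegelHalfSpace g, InRegion R K C c z τ → (τ ∈ siegelFundamentalSet g ↔ Q τ) := by
  obtain ⟨F, hF, hmink⟩ := exists_finset_minkowski g hc hC
  obtain ⟨c', C', hc', hC', hbal⟩ :=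
    exists_balanced_symplecticForm (n := Fin g) hc hC (c₀ := 1 / 2) (by norm_num)
  obtain ⟨G, hG, hsymp⟩ := exists_finset_symplectic g hc' hC'
  refine ⟨fun τ => (∀ k, ∀ a ∈ F k, (τ k k).im ≤ quadForm (imPart τ) fun i => (a i : ℝ)) ∧
    (∀ k l : Fin g, (l : ℕ) = k + 1 → 0 ≤ (τ k l).im) ∧ (∀ i j, |(τ i j).re| ≤ 1 / 2) ∧
    ∀ M ∈ G, 1 ≤ Complex.normSq (siegelDenom M τ).det, ?_, fun z τ hτ hreg => ?_⟩
  · have hτ := complexDefinable_coordMatrix (g := g)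
    refine .and (.forall fun k => .forall_mem fun a _ => (hτ k k).2.le
      (.quadForm (fun i j => (hτ i j).2) fun i => realDefinable_const _)) (.and
      (.forall fun k => .forall fun l => ?_) (.and (.forall fun i => .forall fun j =>
        (hτ i j).1.abs_le (realDefinable_const _)) (.forall_mem fun M _ =>
          (realDefinable_const _).le (ComplexDefinable.det fun i j => ?_).normSq)))
    · by_cases h : (l : ℕ) = k + 1
      · simpa [h] using (realDefinable_const 0).le (hτ k l).2
      · simp [h, PredDefinable]
    · exact (ComplexDefinable.sum fun k => (complexDefinable_const _).mul (hτ k j)).add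
        (complexDefinable_const _)
  · have hb := hreg.balanced hτ.1
    constructor
    · rintro ⟨-, hM, hre, hdet⟩
      exact ⟨fun k a ha => hM.le k a (hF k a ha), hM.nonneg, hre, fun M hMG =>
        (det_imPart_siegelAction_le_iff (hG M hMG) hτ).mp (hdet M (hG M hMG))⟩
    · rintro ⟨hle, hnonneg, hre, hdet⟩
      refine ⟨hτ.1, ⟨Matrix.IsSymm.ext fun i j => hb.symm j i, fun i _ => hb.pos i,
        hmink _ hb hle, hnonneg⟩, hre, fun σ hσ => ?_⟩
      refine (det_imPart_siegelAction_le_iff hσ hτ).mpr (hsymp τ hτ (hbal _ _ ?_ ?_ hb ?_) hdet σ hσ)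
      · exact Matrix.ext fun i j => congrArg Complex.re (hτ.1.apply i j)
      · exact fun i j => (hreg.1 i j).le
      · exact fun i => (hreg.2.2.1 i).le

end Finiteness

/-! ### Parallelograms over the fundamental set and the conclusion -/

section Parallelogram

variable {g : ℕ} {d : Fin g → ℕ}

lemma latticeCombination_apply (d : Fin g → ℕ) (τ : Matrix (Fin g) (Fin g) ℂ)
    (r s : Fin g → ℝ) (i : Fin g) :
    latticeCombination d τ r s i = ∑ j, τ i j * (r j : ℂ) + (d i : ℂ) * (s i : ℂ) := by
  simp [latticeCombination, Matrix.mulVec, dotProduct, Matrix.diagonal_apply]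

/-- The points over the fundamental set with bounded lattice coordinates lie in a region. -/
theorem exists_overFundamentalSet_wideParallelogram_subset (d : Fin g → ℕ) {K : ℝ} (hK : 0 < K) :
    ∃ R K' c : ℝ, 0 < R ∧ 0 < K' ∧ 0 < c ∧ overFundamentalSet (wideParallelogram d K) ⊆
      {p | InRegion R K' 2 c p.1 p.2} := by
  obtain ⟨c, hc, hbal⟩ := exists_balanced_of_isMinkowskiReduced g
  -- The estimates hold with `g * K + ∑ i, d i * K`, `g * K`, `1` and `c`; enlarging the first three
  -- and halving the last makes the inequalities of `InRegion` strict.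
  refine ⟨g * K + ∑ i, d i * K + 1, g * K + 1, c / 2, by positivity, by positivity, by positivity,
    ?_⟩
  rintro ⟨z, τ, hτ⟩ ⟨hF, r, s, hr, hs, hz⟩
  obtain rfl : z = latticeCombination d τ r s := hz
  replace hF : τ ∈ siegelFundamentalSet g := hF
  have hb := hbal _ hF.2.1 hτ.2
  have hpos : ∀ i, 0 < (τ i i).im := hb.pos
  have habs : ∀ i j, |(τ i j).im| ≤ (τ i i).im := fun i j => by
    simpa [imPart] using hb.abs_entry_le i j
  have hre : ∀ i j, |(τ i j).re| < 1 := fun i j => (hF.2.2.1 i j).trans_lt (by norm_num)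
  refine ⟨hre, fun i => ?_, half_lt_im_of_mem_siegelFundamentalSet hτ hF, fun i j => ?_,
    fun i => ?_, fun v hv => ?_⟩
  · simp only [latticeCombination_apply, Complex.add_re, Complex.re_sum, Complex.re_mul_ofReal,
      Complex.natCast_re]
    have h1 : |∑ j, (τ i j).re * r j| ≤ g * K := by
      refine (Finset.abs_sum_le_sum_abs _ _).trans ((Finset.sum_le_card_nsmul _ _ K
        fun j _ => ?_).trans (by simp))
      rw [abs_mul]
      exact (mul_le_of_le_one_left (abs_nonneg _) (hre i j).le).trans (hr j).le
    have h2 : |(d i : ℝ) * s i| ≤ ∑ i, d i * K := by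
      refine le_trans ?_ (Finset.single_le_sum (f := fun i => (d i : ℝ) * K)
        (fun j _ => by positivity) (Finset.mem_univ i))
      rw [abs_mul, Nat.abs_cast]
      exact mul_le_mul_of_nonneg_left (hs i).le (Nat.cast_nonneg _)
    linarith [abs_add_le (∑ j, (τ i j).re * r j) (d i * s i)]
  · have := habs i j
    have := hpos i
    linarith
  · simp only [latticeCombination_apply, Complex.add_im, Complex.im_sum, Complex.im_mul_ofReal,
      Complex.natCast_im, zero_mul, add_zero]
    have h1 : |∑ j, (τ i j).im * r j| ≤ g * K * (τ i i).im := by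
      refine (Finset.abs_sum_le_sum_abs _ _).trans ((Finset.sum_le_card_nsmul _ _ (K * (τ i i).im)
        fun j _ => ?_).trans (by simp [mul_assoc]))
      rw [abs_mul, mul_comm]
      exact mul_le_mul (hr j).le (habs i j) (abs_nonneg _) hK.le
    have := hpos i
    linarith
  · have h1 := hb.le_quadForm v
    obtain ⟨k, hk⟩ := Function.ne_iff.mp hv
    have h2 : 0 < ∑ i, (τ i i).im * v i ^ 2 :=
      Finset.sum_pos' (fun i _ => mul_nonneg (hpos i).le (sq_nonneg _))
        ⟨k, Finset.mem_univ k, mul_pos (hpos k) (sq_pos_of_ne_zero hk)⟩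
    have h3 : c * ∑ i, (τ i i).im * v i ^ 2 ≤ quadForm (imPart τ) v := h1
    have h4 := mul_pos hc h2
    linarith

/-- A family of parallelograms is definable if the conditions on the coordinates are. -/
lemma predDefinable_exists_latticeCombination {I : ℝ → Prop}
    (hI : ∀ {α : Type} {f : (α → ℝ) → ℝ}, RealDefinable f → PredDefinable fun x => I (f x))
    (d : Fin g → ℕ) :
    PredDefinable fun x : GraphIndex g ⊕ GraphIndex g → ℝ => ∃ r s : Fin g → ℝ,
      (∀ i, I (r i)) ∧ (∀ i, I (s i)) ∧
        coordVector x = latticeCombination d (coordMatrix x) r s := by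
  refine PredDefinable.exists_real (P := fun x r => ∃ s : Fin g → ℝ,
      (∀ i, I (r i)) ∧ (∀ i, I (s i)) ∧
        coordVector x = latticeCombination d (coordMatrix x) r s) ?_
  refine PredDefinable.exists_real (P := fun (y : (GraphIndex g ⊕ GraphIndex g) ⊕ Fin g → ℝ) s =>
      (∀ i, I ((y ∘ Sum.inr) i)) ∧ (∀ i, I (s i)) ∧
        coordVector (y ∘ Sum.inl) = latticeCombination d (coordMatrix (y ∘ Sum.inl))
          (y ∘ Sum.inr) s) ?_
  refine .and (.forall fun i => hI (realDefinable_apply _)) (.and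
    (.forall fun i => hI (realDefinable_apply _)) ?_)
  simp only [funext_iff, latticeCombination_apply]
  refine .forall fun i => ComplexDefinable.eq (complexDefinable_coordVector i).comp_inl.comp_inl
    (.add (.sum fun j => .mul (complexDefinable_coordMatrix i j).comp_inl.comp_inl ?_)
      ((complexDefinable_const _).mul ?_))
  · exact (realDefinable_apply (Sum.inl (Sum.inr j))).ofReal
  · exact (realDefinable_apply (Sum.inr i)).ofReal

/-- The theta function is definable over the fundamental set on definable families of subsets of
the closed parallelograms. -/
theorem definableOn_thetaChar_overFundamentalSet (a b : Fin g → ℝ) {d : Fin g → ℕ} {K : ℝ}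
    (hK : 0 < K) {P : Matrix (Fin g) (Fin g) ℂ → Set (Fin g → ℂ)}
    (hP : ∀ τ, P τ ⊆ wideParallelogram d K τ)
    (hdef : PredDefinable fun x : GraphIndex g ⊕ GraphIndex g → ℝ =>
      coordVector x ∈ P (coordMatrix x)) :
    DefinableOn (thetaChar a b) (overFundamentalSet P) := by
  obtain ⟨R, K', c, hR, hK', hc, hsub⟩ :=
    exists_overFundamentalSet_wideParallelogram_subset d hK
  obtain ⟨Q, hQ, hiff⟩ :=
    exists_predDefinable_siegelFundamentalSet g (R := R) (K := K') two_pos hc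
  convert (definableOn_thetaChar_inRegion a b hR hK' two_pos hc).inter
    (Q := fun z τ => Q τ ∧ z ∈ P τ) (hQ.and hdef) using 1
  ext p
  constructor
  · rintro ⟨hF, hp⟩
    have hreg := hsub (show p ∈ _ from ⟨hF, hP _ hp⟩)
    exact ⟨hreg, (hiff _ _ p.2.2 hreg).mp hF, hp⟩
  · rintro ⟨hreg, hF, hp⟩
    exact ⟨(hiff _ _ p.2.2 hreg).mpr hF, hp⟩

lemma parallelogram_subset_closedParallelogram (d : Fin g → ℕ) (τ : Matrix (Fin g) (Fin g) ℂ) :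
    parallelogram d τ ⊆ closedParallelogram d τ := by
  rintro z ⟨r, s, hr, hs, h⟩
  exact ⟨r, s, fun i => ⟨(hr i).1, (hr i).2.le⟩, fun i => ⟨(hs i).1, (hs i).2.le⟩, h⟩

lemma closedParallelogram_subset_wideParallelogram (d : Fin g → ℕ)
    (τ : Matrix (Fin g) (Fin g) ℂ) : closedParallelogram d τ ⊆ wideParallelogram d 2 τ := by
  have h : ∀ x : ℝ, 0 ≤ x ∧ x ≤ 1 → |x| < 2 := fun x hx =>
    abs_lt.mpr ⟨by linarith [hx.1], by linarith [hx.2]⟩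
  rintro z ⟨r, s, hr, hs, hz⟩
  exact ⟨r, s, fun i => h _ (hr i), fun i => h _ (hs i), hz⟩

/-- The theta function is definable on an open neighbourhood of the points over the fundamental
set with bounded lattice coordinates. -/
theorem exists_isOpen_definableOn_thetaChar (a b : Fin g → ℝ) (d : Fin g → ℕ) {K : ℝ}
    (hK : 0 < K) : ∃ U : Set ((Fin g → ℂ) × siegelHalfSpace g), IsOpen U ∧
      overFundamentalSet (wideParallelogram d K) ⊆ U ∧ DefinableOn (thetaChar a b) U := by
  obtain ⟨R, K', c, hR, hK', hc, hsub⟩ :=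
    exists_overFundamentalSet_wideParallelogram_subset d hK
  exact ⟨_, isOpen_setOf_inRegion R K' 2 c, hsub,
    definableOn_thetaChar_inRegion a b hR hK' two_pos hc⟩

end Parallelogram

end SiegelTheta

theorem theorem1p3 (g : ℕ) (hg : 0 < g) (d : Fin g → ℕ)
    (hd : SiegelTheta.IsPolarizationType d) (a b : Fin g → ℝ) :
    SiegelTheta.DefinableOn (SiegelTheta.thetaChar a b)
        (SiegelTheta.overFundamentalSet (SiegelTheta.parallelogram d)) ∧
      SiegelTheta.DefinableOn (SiegelTheta.thetaChar a b)
        (SiegelTheta.overFundamentalSet (SiegelTheta.closedParallelogram d)) ∧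
      (∀ K : ℝ, 0 < K → ∃ U : Set ((Fin g → ℂ) × SiegelTheta.siegelHalfSpace g),
        IsOpen U ∧
        SiegelTheta.overFundamentalSet (SiegelTheta.wideParallelogram d K) ⊆ U ∧
        SiegelTheta.DefinableOn (SiegelTheta.thetaChar a b) U) ∧
      ∃ U : Set ((Fin g → ℂ) × SiegelTheta.siegelHalfSpace g),
        IsOpen U ∧
        SiegelTheta.overFundamentalSet (SiegelTheta.closedParallelogram d) ⊆ U ∧
        SiegelTheta.DefinableOn (SiegelTheta.thetaChar a b) U := by
  have hclosed := SiegelTheta.closedParallelogram_subset_wideParallelogram d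
  refine ⟨SiegelTheta.definableOn_thetaChar_overFundamentalSet a b two_pos
      (fun τ => (SiegelTheta.parallelogram_subset_closedParallelogram d τ).trans (hclosed τ))
      (SiegelTheta.predDefinable_exists_latticeCombination (I := fun x => 0 ≤ x ∧ x < 1)
        (fun hf => ((SiegelTheta.realDefinable_const 0).le hf).and
          (hf.lt (SiegelTheta.realDefinable_const 1))) d),
    SiegelTheta.definableOn_thetaChar_overFundamentalSet a b two_pos hclosed
      (SiegelTheta.predDefinable_exists_latticeCombination (I := fun x => 0 ≤ x ∧ x ≤ 1)
        (fun hf => ((SiegelTheta.realDefinable_const 0).le hf).and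
          (hf.le (SiegelTheta.realDefinable_const 1))) d),
    fun K hK => SiegelTheta.exists_isOpen_definableOn_thetaChar a b d hK, ?_⟩
  obtain ⟨U, hU, hsub, hdef⟩ := SiegelTheta.exists_isOpen_definableOn_thetaChar a b d two_pos
  exact ⟨U, hU, fun p hp => hsub ⟨hp.1, hclosed _ hp.2⟩, hdef⟩
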